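/- **Setting.** Let $Y=[0,1)^3$; "periodic" means $\mathbb Z^3$-periodic a.e. (resp. $1$-periodic for functions on $\mathbb R$). Write $\langle f\rangle=\int_Y f$ and $\langle f\rangle_{h}=\langle f^{-1}\rangle^{-1}$. Let $\lambda,\mu\in L^\infty_{\rm per}([0,1))$ with $\operatorname{ess\,inf}\mu>0$ and $\operatorname{ess\,inf}(\lambda+\tfrac23\mu)>0$, and set $Q(y,G)=\lambda(y_1)(\operatorname{tr}G)^2+2\mu(y_1)|\operatorname{sym}G|^2$ for $G\in\mathbb R^{3\times3}$. Let $\mathbb L_Q(y)$ be given by $F:\mathbb L_Q(y)G=\tfrac12\big(Q(y,F+G)-Q(y,F)-Q(y,G)\big)$. Let $A:\mathbb R^3\to\mathbb R^{3\times 3}$ be a periodic stress-free joint depending only on $y_1$: $A$ is periodic, $\det A>0$ a.e., $A$ and $A^{-1}$ are essentially bounded, and $A=Da$ a.e. for a continuous $a\in W^{1,\infty}_{\rm loc}(\mathbb R^3,\mathbb R^3)$, normalized by $a(0)=0$. Put $\bar A=\int_Y A$. Then $a$ is a bilipschitz bijection of $\mathbb R^3$ and $\det\bar A>0$. Define $\alpha=\bar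 A^{-T}e_1$ and, with $x=a^{-1}(\bar A y)$, $$\hat Q(y,G)=Q(x,G)\,\frac{\det\bar A}{\det A(x)},\quad \hat\lambda(y)=\lambda(x_1)\frac{\det\bar A}{\det A(x)},\quad \hat\mu(y)=\mu(x_1)\frac{\det\bar A}{\det A(x)},\quad \hat K=\hat\lambda+\tfrac23\hat\mu,\quad \hat M=\hat\lambda+2\hat\mu .$$ Let $G_1=\tfrac13 I$, $G_2=\operatorname{diag}(\tfrac23,-\tfrac13,-\tfrac13)$, $G_3=\operatorname{diag}(0,-\tfrac12,\tfrac12)$, and let $G_4,G_5,G_6$ be the symmetric matrices whose only nonzero entries are $\tfrac12$ at the positions $(1,2),(2,1)$, resp. $(1,3),(3,1)$, resp. $(2,3),(3,2)$. Let $H^1_{\rm per,0}(Y,\mathbb R^3)$ be the space of periodic $H^1_{\rm loc}$ maps with mean zero over $Y$. **(1) Transformed correctors.** For each $i$ the functional $\varphi\mapsto\int_Y\hat Q(y,G_i+D\varphi(y)\bar A^{-1})\,dy$ has a minimizer $\hat\varphi_{G_i}$ in $H^1_{\rm per,0}(Y,\mathbb R^3)$. Every minimizer depends only on $y_1$ and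 satisfies, a.e., $$D\hat\varphi_{G_1}=\frac{\langle\hat M\rangle_h\langle\hat K/\hat M\rangle-\hat K}{|\alpha|^2\hat M}\,\alpha e_1^T,$$ $$D\hat\varphi_{G_2}=\frac{4\beta_1}{3|\alpha|^2}\begin{pmatrix}\alpha_1\\-\frac12\alpha_2\\-\frac12\alpha_3\end{pmatrix}e_1^T+\frac{4\alpha_1^2-2\alpha_2^2-2\alpha_3^2}{3|\alpha|^4}\beta_2\,\alpha e_1^T,$$ $$D\hat\varphi_{G_3}=\frac{\beta_1}{|\alpha|^2}\begin{pmatrix}0\\-\alpha_2\\\alpha_3\end{pmatrix}e_1^T+\frac{\alpha_3^2-\alpha_2^2}{|\alpha|^4}\beta_2\,\alpha e_1^T,\qquad D\hat\varphi_{G_4}=\frac{\beta_1}{|\alpha|^2}\begin{pmatrix}\alpha_2\\\alpha_1\\0\end{pmatrix}e_1^T+\frac{2\alpha_1\alpha_2}{|\alpha|^4}\beta_2\,\alpha e_1^T,$$ $$D\hat\varphi_{G_5}=\frac{\beta_1}{|\alpha|^2}\begin{pmatrix}\alpha_3\\0\\\alpha_1\end{pmatrix}e_1^T+\frac{2\alpha_1\alpha_3}{|\alpha|^4}\beta_2\,\alpha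 e_1^T,\qquad D\hat\varphi_{G_6}=\frac{\beta_1}{|\alpha|^2}\begin{pmatrix}0\\\alpha_3\\\alpha_2\end{pmatrix}e_1^T+\frac{2\alpha_2\alpha_3}{|\alpha|^4}\beta_2\,\alpha e_1^T,$$ where $$\beta_1=\frac{\langle\hat\mu\rangle_h}{\hat\mu}-1,\qquad \beta_2=\frac{\langle\hat M\rangle_h\langle\hat\mu/\hat M\rangle}{\hat M}-\frac{\langle\hat\mu\rangle_h}{\hat\mu}+1-\frac{\hat\mu}{\hat M}.$$ **(2) Homogenized quantities.** Suppose that $\alpha$ is parallel to $e_1$. For each $i$ the functional $\varphi\mapsto\int_Y Q(y,G_i+D\varphi(y)A(y)^{-1})\,dy$ has a minimizer $\varphi_{G_i}$ in $H^1_{\rm per,0}(Y,\mathbb R^3)$, and, for any such minimizers, the matrix $\mathbf Q_{ij}=\int_Y(G_i+D\varphi_{G_i}A^{-1}):\mathbb L_Q(G_j+D\varphi_{G_j}A^{-1})\,dy$ equals $$\mathbf Q=\begin{pmatrix}A_1&0\\0&A_2\end{pmatrix},\quad A_1=\begin{pmatrix}\langle\frac{\hat K}{\hat M}\rangle\langle\hat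 M\rangle_h-\frac43\langle\gamma\hat\mu\rangle&\frac43\langle\gamma\hat\mu\rangle\\[1mm]\frac43\langle\gamma\hat\mu\rangle&\frac43\langle\frac{\hat\mu}{\hat M}\rangle\langle\hat M\rangle_h-\frac43\langle\gamma\hat\mu\rangle\end{pmatrix},\quad A_2=\operatorname{diag}(\langle\hat\mu\rangle,\langle\hat\mu\rangle_h,\langle\hat\mu\rangle_h,\langle\hat\mu\rangle),$$ with $\gamma=\big(\langle\hat K/\hat M\rangle\langle\hat M\rangle_h-\hat K\big)/\hat M$. Moreover, let $B\in L^2_{\rm loc}(\mathbb R^3,\mathbb R^{3\times3})$ be periodic and $\hat B(y)=B(a^{-1}(\bar Ay))$. Let $(\Phi,\Psi)_Q=\int_Y\Phi:\mathbb L_Q\Psi$, let $\mathcal S=\{\operatorname{sym}(D\varphi A^{-1}):\varphi\in H^1_{\rm per}(Y,\mathbb R^3)\}$, and let $\mathcal O$ be the $(\cdot,\cdot)_Q$-orthogonal complement of $\mathcal S$ in $\mathcal S+\mathbb R^{3\times3}_{\rm sym}$, with orthogonal projection $P_{\mathcal O}$. Then there is exactly one $B_{\hom}\in\mathbb R^{3\times3}_{\rm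 sym}$ with $P_{\mathcal O}(B_{\hom})=P_{\mathcal O}(\operatorname{sym}B)$, namely $B_{\hom}=\sum_{i=1}^6\mathbf B_iG_i$ with $$\mathbf B_1=\Big\langle\hat B_{11}+\tfrac{\hat\lambda}{\hat M}\hat B_{22}+\tfrac{\hat\lambda}{\hat M}\hat B_{33}\Big\rangle+2\Big\langle(\hat B_{22}+\hat B_{33})\tfrac{\hat K\hat\mu}{\hat M}\Big\rangle\frac{\langle\hat\mu/\hat M\rangle}{\langle\hat K\hat\mu/\hat M\rangle},$$ $$\mathbf B_2=\Big\langle\hat B_{11}+\tfrac{\hat\lambda}{\hat M}\hat B_{22}+\tfrac{\hat\lambda}{\hat M}\hat B_{33}\Big\rangle-\tfrac32\Big\langle(\hat B_{22}+\hat B_{33})\tfrac{\hat K\hat\mu}{\hat M}\Big\rangle\frac{\langle\hat K/\hat M\rangle}{\langle\hat K\hat\mu/\hat M\rangle},$$ $$\mathbf B_3=\frac{\langle\hat\mu(\hat B_{33}-\hat B_{22})\rangle}{\langle\hat\mu\rangle},\quad \mathbf B_4=\langle\hat B_{12}+\hat B_{21}\rangle,\quad \mathbf B_5=\langle\hat B_{13}+\hat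 B_{31}\rangle,\quad \mathbf B_6=\frac{\langle\hat\mu(\hat B_{23}+\hat B_{32})\rangle}{\langle\hat\mu\rangle}.$$ -/

import Mathlib

open MeasureTheory
open scoped ContDiff

noncomputable section

namespace Laminate

/-- Points and vectors of three-dimensional space. Coordinates are indexed by `0, 1, 2`, so that
`y 0` is the first coordinate. Only notions that do not depend on the choice of a norm are used
on this type (continuity, bilipschitz maps, local integrability), and Lebesgue measure. -/
abbrev V3 := Fin 3 → ℝ

/-- Real `3 × 3` matrices. -/
abbrev Mat3 := Matrix (Fin 3) (Fin 3) ℝ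

/-- The first unit vector. -/
def e1 : V3 := Pi.single 0 1

/-- The symmetric part of a matrix. -/
def symPart (G : Mat3) : Mat3 := (1 / 2 : ℝ) • (G + G.transpose)

/-! Periodicity and means -/

/-- The cell of periodicity `Y = [0,1)³`. -/
def unitCell : Set V3 := Set.pi Set.univ fun _ => Set.Ico (0 : ℝ) 1

/-- `Y`-periodicity, in the almost everywhere sense. -/
def IsCellPeriodic {β : Type*} (f : V3 → β) : Prop :=
  ∀ k : Fin 3 → ℤ, ∀ᵐ y : V3, f (y + fun i => (k i : ℝ)) = f y

/-- The mean over `Y` (which has measure one). -/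
def mean (f : V3 → ℝ) : ℝ := ∫ y in unitCell, f y

/-- The harmonic mean over `Y`. -/
def harmMean (f : V3 → ℝ) : ℝ := (mean fun y => (f y)⁻¹)⁻¹

/-- The entrywise mean over `Y` of a matrix field. -/
def meanMat (A : V3 → Mat3) : Mat3 := Matrix.of fun i j => mean fun y => A y i j

/-! Sobolev spaces -/

/-- `g` is the weak partial derivative of `u` in direction `j` on the whole space
(used for locally integrable `u` and `g`). -/
def IsWeakPartial (u : V3 → ℝ) (j : Fin 3) (g : V3 → ℝ) : Prop :=
  ∀ θ : V3 → ℝ, ContDiff ℝ ∞ θ → HasCompactSupport θ →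
    ∫ y, u y * fderiv ℝ θ y (Pi.single j 1) = -∫ y, g y * θ y

/-- `f` belongs to `Lᵖ_loc`. -/
def MemLpLoc (p : ENNReal) (f : V3 → ℝ) : Prop :=
  ∀ K : Set V3, IsCompact K → MemLp f p (volume.restrict K)

/-- `φ` belongs to `H¹_per(Y, ℝ³)` and `Φ` is (a representative of) its weak Jacobian `Dφ`,
where `(Dφ) i j` is the `j`-th partial derivative of the `i`-th component. -/
structure IsH1Per (φ : V3 → V3) (Φ : V3 → Mat3) : Prop where
  periodic : IsCellPeriodic φ
  memL2 : ∀ i, MemLpLoc 2 fun y => φ y i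
  memL2_deriv : ∀ i j, MemLpLoc 2 fun y => Φ y i j
  weak_deriv : ∀ i j, IsWeakPartial (fun y => φ y i) j (fun y => Φ y i j)

/-- `φ` belongs to `H¹_{per,0}(Y, ℝ³)`, the mean-free functions in `H¹_per(Y, ℝ³)`,
and `Φ` is its weak Jacobian. -/
structure IsH1PerZero (φ : V3 → V3) (Φ : V3 → Mat3) : Prop extends IsH1Per φ Φ where
  mean_zero : ∀ i, mean (fun y => φ y i) = 0

/-! Stress-free joints -/

/-- `a` is a potential of `A`: it is continuous, belongs to `W^{1,∞}_loc(ℝ³, ℝ³)`,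
and `Da = A` almost everywhere. -/
structure IsPotential (a : V3 → V3) (A : V3 → Mat3) : Prop where
  continuous : Continuous a
  memLp_deriv : ∀ i j, MemLpLoc ⊤ fun y => A y i j
  weak_deriv : ∀ i j, IsWeakPartial (fun y => a y i) j (fun y => A y i j)

/-- Periodic stress-free joints. (Bounding the entries is the same as bounding a matrix norm,
up to the value of `L`.) -/
structure IsPeriodicStressFreeJoint (A : V3 → Mat3) : Prop where
  periodic : IsCellPeriodic A
  bounds : ∃ L : ℝ, ∀ᵐ y : V3,
    0 < (A y).det ∧ ∀ i j, |A y i j| ≤ L ∧ |(A y)⁻¹ i j| ≤ L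
  exists_potential : ∃ a, IsPotential a A

/-! Quadratic energy densities -/

/-- The isotropic quadratic form `G ↦ l (tr G)² + 2 m |sym G|²`. -/
def isoForm (l m : ℝ) (G : Mat3) : ℝ :=
  l * G.trace ^ 2 + 2 * m * ∑ i, ∑ j, symPart G i j ^ 2

/-- `polar q F G` is `F : 𝕃 G`, where `𝕃` is the fourth-order tensor of the quadratic form `q`. -/
def polar (q : Mat3 → ℝ) (F G : Mat3) : ℝ := (1 / 2) * (q (F + G) - q F - q G)

/-- The energy density `Q(y, G)` of the isotropic laminate with Lamé constants `lam`, `mu`. -/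
def laminateForm (lam mu : ℝ → ℝ) (y : V3) (G : Mat3) : ℝ :=
  isoForm (lam (y 0)) (mu (y 0)) G

/-- An admissible Lamé constant is a 1-periodic, essentially bounded function on the line. -/
structure IsPerLinfty (f : ℝ → ℝ) : Prop where
  memLp : MemLp f ⊤ volume
  periodic : ∀ᵐ t : ℝ, f (t + 1) = f t

/-- `f` has a positive essential infimum. -/
def EssBoundedBelow (f : ℝ → ℝ) : Prop := ∃ c : ℝ, 0 < c ∧ ∀ᵐ t : ℝ, c ≤ f t

/-- `φ` is a corrector for `G`: a minimizer in `H¹_{per,0}(Y, ℝ³)` of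
`φ ↦ ∫_Y q(y, G + Dφ(y) T(y)) dy`; its weak Jacobian is `Φ`. -/
structure IsCorrector (q : V3 → Mat3 → ℝ) (T : V3 → Mat3) (G : Mat3)
    (φ : V3 → V3) (Φ : V3 → Mat3) : Prop where
  mem : IsH1PerZero φ Φ
  minimal : ∀ (ψ : V3 → V3) (Ψ : V3 → Mat3), IsH1PerZero ψ Ψ →
    mean (fun y => q y (G + Φ y * T y)) ≤ mean (fun y => q y (G + Ψ y * T y))

/-! Transformed quantities -/

/-- The point `a⁻¹(Ā y)`. -/
def pullPoint (a : V3 → V3) (A : V3 → Mat3) (y : V3) : V3 :=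
  Function.invFun a ((meanMat A).mulVec y)

/-- The factor `det A(a⁻¹(Ā y))⁻¹ det Ā`. -/
def jacFactor (a : V3 → V3) (A : V3 → Mat3) (y : V3) : ℝ :=
  (A (pullPoint a A y)).det⁻¹ * (meanMat A).det

/-- The transformed energy density `Q̂(y, G) = Q(a⁻¹(Ā y), G) det A(a⁻¹(Ā y))⁻¹ det Ā`. -/
def hatForm (q : V3 → Mat3 → ℝ) (a : V3 → V3) (A : V3 → Mat3) (y : V3) (G : Mat3) : ℝ :=
  q (pullPoint a A y) G * jacFactor a A y

/-- The transformed modulus `f̂(y) = f([a⁻¹(Ā y)]₁) det A(a⁻¹(Ā y))⁻¹ det Ā`. -/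
def hatModulus (f : ℝ → ℝ) (a : V3 → V3) (A : V3 → Mat3) (y : V3) : ℝ :=
  f (pullPoint a A y 0) * jacFactor a A y

/-- The transformed bulk modulus `K̂ = λ̂ + (2/3) μ̂`. -/
def hatBulk (lam mu : ℝ → ℝ) (a : V3 → V3) (A : V3 → Mat3) (y : V3) : ℝ :=
  hatModulus lam a A y + 2 / 3 * hatModulus mu a A y

/-- The transformed P-wave modulus `M̂ = K̂ + (4/3) μ̂ = λ̂ + 2 μ̂`. -/
def hatPWave (lam mu : ℝ → ℝ) (a : V3 → V3) (A : V3 → Mat3) (y : V3) : ℝ :=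
  hatBulk lam mu a A y + 4 / 3 * hatModulus mu a A y

/-- The vector `α = Ā^{-T} e₁`. -/
def alphaVec (A : V3 → Mat3) : V3 := (meanMat A)⁻¹.transpose.mulVec e1

/-- The basis `G₁, …, G₆` of the symmetric matrices. -/
def basisG : Fin 6 → Mat3 :=
  ![!![1/3, 0, 0; 0, 1/3, 0; 0, 0, 1/3],
    !![2/3, 0, 0; 0, -1/3, 0; 0, 0, -1/3],
    !![0, 0, 0; 0, -1/2, 0; 0, 0, 1/2],
    !![0, 1/2, 0; 1/2, 0, 0; 0, 0, 0],
    !![0, 0, 1/2; 0, 0, 0; 1/2, 0, 0],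
    !![0, 0, 0; 0, 0, 1/2; 0, 1/2, 0]]

/-! The effective incremental prestrain -/

/-- `Ψ` belongs to `𝒮 = {sym(Dφ A⁻¹) : φ ∈ H¹_per(Y, ℝ³)}`. -/
def InS (A : V3 → Mat3) (Ψ : V3 → Mat3) : Prop :=
  ∃ φ Φ, IsH1Per φ Φ ∧ ∀ᵐ y : V3, Ψ y = symPart (Φ y * (A y)⁻¹)

/-- `Ψ` belongs to `𝒮 + ℝ^{3×3}_sym`. -/
def InSPlusSym (A : V3 → Mat3) (Ψ : V3 → Mat3) : Prop :=
  ∃ (S : V3 → Mat3) (M : Mat3), InS A S ∧ M.IsSymm ∧ ∀ᵐ y : V3, Ψ y = S y + M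

/-- The scalar product `(Φ, Ψ)_Q = ∫_Y Φ : 𝕃 Ψ` on `L²(Y, ℝ^{3×3}_sym)`. -/
def innerQ (q : V3 → Mat3 → ℝ) (Φ Ψ : V3 → Mat3) : ℝ :=
  mean fun y => polar (q y) (Φ y) (Ψ y)

/-- `Ψ` belongs to `𝒪`, the orthogonal complement of `𝒮` in `𝒮 + ℝ^{3×3}_sym`. -/
def InO (q : V3 → Mat3 → ℝ) (A : V3 → Mat3) (Ψ : V3 → Mat3) : Prop :=
  InSPlusSym A Ψ ∧ ∀ S, InS A S → innerQ q S Ψ = 0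

/-- `Ψ` is the orthogonal projection of `Φ` onto `𝒪`. -/
def IsProjO (q : V3 → Mat3 → ℝ) (A : V3 → Mat3) (Φ Ψ : V3 → Mat3) : Prop :=
  InO q A Ψ ∧ ∀ Θ, InO q A Θ → innerQ q (fun y => Φ y - Ψ y) Θ = 0

/-- `M` is an effective incremental prestrain for `B`: it is a symmetric matrix such that
`M` (as a constant field) and `sym B` have the same orthogonal projection onto `𝒪`. -/
def IsEffectivePrestrain (q : V3 → Mat3 → ℝ) (A : V3 → Mat3) (B : V3 → Mat3) (M : Mat3) : Prop :=
  M.IsSymm ∧ ∃ Ψ, IsProjO q A (fun _ => M) Ψ ∧ IsProjO q A (fun y => symPart (B y)) Ψ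

/-- The matrix `𝐐 i j = ∫_Y (G_i + Dφ_i A⁻¹) : 𝕃 (G_j + Dφ_j A⁻¹)`, where `Φ i = Dφ_i`. -/
def matrixQ (q : V3 → Mat3 → ℝ) (A : V3 → Mat3) (Φ : Fin 6 → V3 → Mat3) :
    Matrix (Fin 6) (Fin 6) ℝ :=
  Matrix.of fun i j => innerQ q (fun y => basisG i + Φ i y * (A y)⁻¹)
    (fun y => basisG j + Φ j y * (A y)⁻¹)

/-! Explicit formulas, in terms of the vector `α` and the moduli `K`, `M`, `μ`, `λ` -/

/-- `β₁ = ⟨μ⟩_harm / μ - 1`. -/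
def beta1 (mu : V3 → ℝ) (y : V3) : ℝ := harmMean mu / mu y - 1

/-- `β₂ = ⟨M⟩_harm ⟨μ/M⟩ / M - ⟨μ⟩_harm / μ + 1 - μ / M`. -/
def beta2 (M mu : V3 → ℝ) (y : V3) : ℝ :=
  harmMean M * mean (fun z => mu z / M z) / M y - harmMean mu / mu y + 1 - mu y / M y

/-- `γ = (⟨K/M⟩ ⟨M⟩_harm - K) / M`. -/
def gammaFun (K M : V3 → ℝ) (y : V3) : ℝ :=
  (mean (fun z => K z / M z) * harmMean M - K y) / M y

/-- The vectors `v_i(y)` for which the corrector gradients are `v_i(y) e₁ᵀ`;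
here `n` is `|α|²`. -/
def correctorSlope (α : V3) (K M mu : V3 → ℝ) (i : Fin 6) (y : V3) : V3 :=
  let n : ℝ := α ⬝ᵥ α
  (![((harmMean M * mean (fun z => K z / M z) - K y) / (n * M y)) • α,
    (4 * beta1 mu y / (3 * n)) • ![α 0, -(1 / 2) * α 1, -(1 / 2) * α 2]
      + ((4 * α 0 ^ 2 - 2 * α 1 ^ 2 - 2 * α 2 ^ 2) / (3 * n ^ 2) * beta2 M mu y) • α,
    (beta1 mu y / n) • ![0, -α 1, α 2]
      + ((α 2 ^ 2 - α 1 ^ 2) / n ^ 2 * beta2 M mu y) • α,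
    (beta1 mu y / n) • ![α 1, α 0, 0]
      + (2 * α 0 * α 1 / n ^ 2 * beta2 M mu y) • α,
    (beta1 mu y / n) • ![α 2, 0, α 0]
      + (2 * α 0 * α 2 / n ^ 2 * beta2 M mu y) • α,
    (beta1 mu y / n) • ![0, α 2, α 1]
      + (2 * α 1 * α 2 / n ^ 2 * beta2 M mu y) • α] : Fin 6 → V3) i

/-- The explicit block-diagonal matrix. -/
def explicitQ (K M mu : V3 → ℝ) : Matrix (Fin 6) (Fin 6) ℝ :=
  let g : ℝ := 4 / 3 * mean (fun y => gammaFun K M y * mu y)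
  !![mean (fun y => K y / M y) * harmMean M - g, g, 0, 0, 0, 0;
     g, 4 / 3 * mean (fun y => mu y / M y) * harmMean M - g, 0, 0, 0, 0;
     0, 0, mean mu, 0, 0, 0;
     0, 0, 0, harmMean mu, 0, 0;
     0, 0, 0, 0, harmMean mu, 0;
     0, 0, 0, 0, 0, mean mu]

/-- The explicit coefficients of the effective incremental prestrain. -/
def explicitB (lam K M mu : V3 → ℝ) (B : V3 → Mat3) : Fin 6 → ℝ :=
  let x : ℝ := mean fun y => B y 0 0 + lam y / M y * B y 1 1 + lam y / M y * B y 2 2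
  let z : ℝ := mean fun y => (B y 1 1 + B y 2 2) * (K y * mu y / M y)
  let w : ℝ := mean fun y => K y * mu y / M y
  ![x + 2 * z * (mean (fun y => mu y / M y) / w),
    x - 3 / 2 * z * (mean (fun y => K y / M y) / w),
    mean (fun y => mu y * (B y 2 2 - B y 1 1)) / mean mu,
    mean fun y => B y 0 1 + B y 1 0,
    mean fun y => B y 0 2 + B y 2 0,
    mean (fun y => mu y * (B y 1 2 + B y 2 1)) / mean mu]

end Laminate

end

open MeasureTheory
open scoped ContDiff

noncomputable section

namespace Laminate

/-! Since the joint is a gradient and depends only on the first coordinate, equality of mixed weak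
derivatives makes its second and third columns constant (`potential_structure`). The determinant is
linear in the remaining column, and the cofactors of that column are constant. Hence `det A = ρ det
Ā` for a periodic density `ρ` of mean one, and the first row of `A⁻¹` is `αᵀ / ρ`. Moreover `Ā⁻¹ a`
stretches the first coordinate by the primitive of `ρ` and translates the other two by amounts
depending on the first (`exists_jointProfile`). Such a map is bilipschitz, commutes with lattice
translations and carries `ρ dy` to Lebesgue measure. So a hatted modulus is `f / ρ` at the
pulled-back point, and cell means of hatted quantities become means with weight `ρ`.

The correctors come from a one-dimensional ansatz. A gradient `v e₁ᵀ`, with `v` a function of the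
first coordinate, turns into `(v / ρ) αᵀ` after multiplication by `A⁻¹`. Equilibrium then only asks
that the stress applied to `α` be constant, because a derivative in another direction has mean zero
against any function of the first coordinate (`IsH1Per.mean_profile_mul`). This is a pointwise
linear system for the slope, solved in `stress_slopeVec`; the constants, which involve harmonic
means, are fixed by requiring the slopes to have weighted mean zero (`IsLaminate.mean_slope`).
Convexity turns equilibrium into minimality and determines the symmetrized strain of every minimizer
(`IsModuli.corrector_unique`). The structure `IsLaminate` covers both the original problem (`T =
A⁻¹`, weight `ρ`) and the transformed one (`T = Ā⁻¹`, weight one, hatted moduli). In the second case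
`T` is constant, and the rigidity statement `IsH1PerZero.eq_zero_of_skew` identifies the corrector
itself.

For the homogenized quantities, let `α` be parallel to `e₁`. The corrector stresses are then
explicit (`stress_slopeVec_e1`). By equilibrium the entries of `𝐐` are these stresses tested against
the constant matrices `G_j`. The space `𝒪` is spanned by the symmetrized corrector strains, so
equality of projections amounts to six scalar equations (`IsLaminate.isEffectivePrestrain_iff`).
Four of these decouple, the other two involve only the normal part and the in-plane trace, and
`IsLaminate.prestrain_iff` solves the system. -/

/-! ### Test functions and weak derivatives -/

/-- Smooth compactly supported functions. -/
structure IsTest (θ : V3 → ℝ) : Prop where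
  smooth : ContDiff ℝ ∞ θ
  compact : HasCompactSupport θ

theorem IsTest.fderiv {θ : V3 → ℝ} (h : IsTest θ) (v : V3) :
    IsTest fun y => fderiv ℝ θ y v :=
  ⟨(h.smooth.fderiv_right (m := ∞) (by simp)).clm_apply contDiff_const,
    h.compact.fderiv_apply ℝ v⟩

theorem IsTest.comp_add {θ : V3 → ℝ} (h : IsTest θ) (v : V3) : IsTest fun y => θ (y + v) :=
  ⟨h.smooth.comp (contDiff_id.add contDiff_const),
    h.compact.comp_homeomorph (Homeomorph.addRight v)⟩

theorem IsTest.differentiable {θ : V3 → ℝ} (h : IsTest θ) : Differentiable ℝ θ :=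
  h.smooth.differentiable (by simp)

theorem fderiv_comp_add (θ : V3 → ℝ) (v w y : V3) :
    fderiv ℝ (fun z => θ (z + v)) y w = fderiv ℝ θ (y + v) w := by
  rw [fderiv_comp_add_right]

theorem IsTest.fderiv_comm {θ : V3 → ℝ} (h : IsTest θ) (v w y : V3) :
    _root_.fderiv ℝ (fun z => _root_.fderiv ℝ θ z v) y w =
      _root_.fderiv ℝ (fun z => _root_.fderiv ℝ θ z w) y v := by
  have hd : Differentiable ℝ (_root_.fderiv ℝ θ) :=
    (h.smooth.fderiv_right (m := ∞) (by simp)).differentiable (by simp)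
  have key : ∀ v w : V3, _root_.fderiv ℝ (fun z => _root_.fderiv ℝ θ z v) y w =
      _root_.fderiv ℝ (_root_.fderiv ℝ θ) y w v := by
    intro v w
    rw [fderiv_clm_apply (hd y) (differentiableAt_const v)]
    simp
  rw [key, key]
  have hs : IsSymmSndFDerivAt ℝ θ y :=
    (h.smooth.contDiffAt).isSymmSndFDerivAt
      (by simpa [minSmoothness_of_isRCLikeNormedField] using ENat.LEInfty.out)
  exact hs w v

theorem MemLpLoc.locallyIntegrable {p : ENNReal} (hp : 1 ≤ p) {f : V3 → ℝ} (h : MemLpLoc p f) :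
    LocallyIntegrable f := by
  rw [locallyIntegrable_iff]
  intro K hK
  have : IsFiniteMeasure (volume.restrict K) := ⟨by simpa using hK.measure_lt_top⟩
  exact (h K hK).integrable hp

theorem IsTest.integrable_mul {θ u : V3 → ℝ} (h : IsTest θ) (hu : LocallyIntegrable u) :
    Integrable fun y => u y * θ y :=
  hu.integrable_smul_right_of_hasCompactSupport h.smooth.continuous h.compact

theorem isWeakPartial_iff {u g : V3 → ℝ} {j : Fin 3} :
    IsWeakPartial u j g ↔ ∀ θ, IsTest θ →
      ∫ y, u y * fderiv ℝ θ y (Pi.single j 1) = -∫ y, g y * θ y :=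
  ⟨fun h θ hθ => h θ hθ.1 hθ.2, fun h θ h1 h2 => h θ ⟨h1, h2⟩⟩

theorem IsWeakPartial.congr {u u' g g' : V3 → ℝ} {j : Fin 3} (h : IsWeakPartial u j g)
    (hu : ∀ᵐ y, u y = u' y) (hg : ∀ᵐ y, g y = g' y) : IsWeakPartial u' j g' := by
  intro θ h1 h2
  have e1 : ∫ y, u' y * fderiv ℝ θ y (Pi.single j 1) =
      ∫ y, u y * fderiv ℝ θ y (Pi.single j 1) :=
    integral_congr_ae (hu.mono fun y hy => by simp only [hy])
  have e2 : ∫ y, g' y * θ y = ∫ y, g y * θ y :=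
    integral_congr_ae (hg.mono fun y hy => by simp only [hy])
  rw [e1, e2, h θ h1 h2]

theorem IsWeakPartial.add {u u' g g' : V3 → ℝ} {j : Fin 3} (h : IsWeakPartial u j g)
    (h' : IsWeakPartial u' j g') (hu : LocallyIntegrable u) (hu' : LocallyIntegrable u')
    (hg : LocallyIntegrable g) (hg' : LocallyIntegrable g') :
    IsWeakPartial (fun y => u y + u' y) j fun y => g y + g' y := by
  rw [isWeakPartial_iff] at *
  intro θ hθ
  have hθ' := hθ.fderiv (Pi.single j 1)
  simp only [add_mul]
  rw [integral_add (hθ'.integrable_mul hu) (hθ'.integrable_mul hu'),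
    integral_add (hθ.integrable_mul hg) (hθ.integrable_mul hg'), h θ hθ, h' θ hθ]
  ring

theorem IsWeakPartial.const_mul {u g : V3 → ℝ} {j : Fin 3} (h : IsWeakPartial u j g) (c : ℝ) :
    IsWeakPartial (fun y => c * u y) j fun y => c * g y := by
  intro θ h1 h2
  simp only [mul_assoc]
  rw [integral_const_mul, integral_const_mul, h θ h1 h2]
  ring

theorem IsWeakPartial.sub {u u' g g' : V3 → ℝ} {j : Fin 3} (h : IsWeakPartial u j g)
    (h' : IsWeakPartial u' j g') (hu : LocallyIntegrable u) (hu' : LocallyIntegrable u')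
    (hg : LocallyIntegrable g) (hg' : LocallyIntegrable g') :
    IsWeakPartial (fun y => u y - u' y) j fun y => g y - g' y := by
  have := h.add (h'.const_mul (-1)) hu (hu'.smul (-1 : ℝ)) hg (hg'.smul (-1 : ℝ))
  refine this.congr (.of_forall fun y => ?_) (.of_forall fun y => ?_) <;> ring

theorem IsWeakPartial.unique {u g g' : V3 → ℝ} {j : Fin 3} (h : IsWeakPartial u j g)
    (h' : IsWeakPartial u j g') (hg : LocallyIntegrable g) (hg' : LocallyIntegrable g') :
    ∀ᵐ y, g y = g' y := by
  refine ae_eq_of_integral_contDiff_smul_eq hg hg' fun θ h1 h2 => ?_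
  simp only [smul_eq_mul, mul_comm (θ _)]
  have := h θ h1 h2
  rw [h' θ h1 h2] at this
  exact (neg_injective this).symm

theorem IsWeakPartial.comp_add {u g : V3 → ℝ} {j : Fin 3} (h : IsWeakPartial u j g) (v : V3) :
    IsWeakPartial (fun y => u (y + v)) j fun y => g (y + v) := by
  rw [isWeakPartial_iff] at *
  intro θ hθ
  have := h _ (hθ.comp_add (-v))
  simp only [fderiv_comp_add] at this
  rw [← integral_add_right_eq_self _ v, ← integral_add_right_eq_self (fun y => g y * _) v] at this
  simpa using this

/-- Integration by parts between a Lipschitz function and a compactly supported Lipschitz one.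
Constants, coordinates and primitives of bounded functions all get their weak derivatives from it.
-/
theorem isWeakPartial_of_lipschitz {u g : V3 → ℝ} {C : NNReal} (hu : LipschitzWith C u)
    {j : Fin 3} (hg : ∀ᵐ y, HasLineDerivAt ℝ u (g y) y (Pi.single j 1)) :
    IsWeakPartial u j g := by
  intro θ h1 h2
  obtain ⟨D, hD⟩ := h1.lipschitzWith_of_hasCompactSupport h2 (by simp)
  have := hu.integral_lineDeriv_mul_eq (μ := volume) hD h2 (Pi.single j 1)
  have e1 : ∫ y, lineDeriv ℝ u y (Pi.single j 1) * θ y = ∫ y, g y * θ y :=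
    integral_congr_ae (hg.mono fun y hy => by simp only [hy.lineDeriv])
  rw [← e1, this, ← integral_neg]
  refine integral_congr_ae (.of_forall fun y => ?_)
  have hd : DifferentiableAt ℝ θ y := h1.differentiable (by simp) y
  simp only [hd.lineDeriv_eq_fderiv, map_neg]
  ring

theorem isWeakPartial_const (c : ℝ) (j : Fin 3) : IsWeakPartial (fun _ => c) j fun _ => 0 :=
  isWeakPartial_of_lipschitz (LipschitzWith.const c) (.of_forall fun _ => by
    simpa using (hasFDerivAt_const c _).hasLineDerivAt (Pi.single j 1))

theorem isWeakPartial_coord (i j : Fin 3) :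
    IsWeakPartial (fun y => y i) j fun _ => (Pi.single j 1 : V3) i :=
  isWeakPartial_of_lipschitz (LipschitzWith.eval i) (.of_forall fun _ =>
    (ContinuousLinearMap.proj (R := ℝ) (φ := fun _ : Fin 3 => ℝ) i).hasFDerivAt.hasLineDerivAt _)

/-- A locally integrable function with vanishing weak gradient is constant. -/
theorem ae_const_of_weak_gradient_zero {u : V3 → ℝ} (hu : LocallyIntegrable u)
    (h : ∀ j, IsWeakPartial u j fun _ => 0) : ∃ c, ∀ᵐ y, u y = c := by
  -- Mollifiers with outer radius exactly twice the inner one: a bounded ratio is what almost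
  -- everywhere convergence of the mollifications of a merely locally integrable function needs.
  let φ : ℕ → ContDiffBump (0 : V3) := fun n =>
    ⟨1 / (n + 1), 2 / (n + 1), by positivity, by gcongr; norm_num⟩
  have hout : Filter.Tendsto (fun n => (φ n).rOut) Filter.atTop (nhds 0) := by
    have := (tendsto_one_div_add_atTop_nhds_zero_nat (𝕜 := ℝ)).const_mul 2
    simpa [φ, div_eq_mul_inv] using this
  have hae := ContDiffBump.ae_convolution_tendsto_right_of_locallyIntegrable (μ := volume)
    (K := 2) hout (.of_forall fun n => by simp only [φ]; field_simp; norm_num) hu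
  have htest : ∀ n, IsTest ((φ n).normed volume) := fun n =>
    ⟨(φ n).contDiff_normed, (φ n).hasCompactSupport_normed⟩
  -- Each mollification is constant: its derivative at `x` pairs `u` with a derivative of the
  -- reflected bump `y ↦ φ n (x - y)`, which is again a test function.
  have hconst : ∀ n x y, convolution ((φ n).normed volume) u (ContinuousLinearMap.lsmul ℝ ℝ)
      volume x = convolution ((φ n).normed volume) u (ContinuousLinearMap.lsmul ℝ ℝ) volume y := by
    intro n
    have hd := fun x => (htest n).compact.hasFDerivAt_convolution_left
      (ContinuousLinearMap.lsmul ℝ ℝ) ((htest n).smooth.of_le (by simp)) hu x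
    refine is_const_of_fderiv_eq_zero (fun x => (hd x).differentiableAt) fun x => ?_
    rw [(hd x).fderiv]
    have hcont : Continuous (fderiv ℝ ((φ n).normed volume)) :=
      (htest n).smooth.continuous_fderiv (by simp)
    have hint := (htest n).compact.fderiv (𝕜 := ℝ) |>.convolutionExists_left
      (ContinuousLinearMap.precompL V3 (ContinuousLinearMap.lsmul ℝ ℝ)) hcont hu x
    refine ContinuousLinearMap.coe_injective ((Pi.basisFun ℝ (Fin 3)).ext fun j => ?_)
    simp only [Pi.basisFun_apply, ContinuousLinearMap.coe_coe, convolution,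
      zero_apply]
    rw [ContinuousLinearMap.integral_apply hint, ← integral_sub_left_eq_self _ volume x]
    have hθ : IsTest fun y => (φ n).normed volume (x - y) :=
      ⟨(htest n).smooth.comp (contDiff_const.sub contDiff_id),
        (htest n).compact.comp_homeomorph (Homeomorph.subLeft x)⟩
    have := isWeakPartial_iff.1 (h j) _ hθ
    simp only [zero_mul, integral_zero, neg_zero] at this
    rw [← neg_eq_zero, ← integral_neg, ← this]
    refine integral_congr_ae (.of_forall fun y => ?_)
    have hc : HasFDerivAt (fun y => (φ n).normed volume (x - y))
        ((fderiv ℝ ((φ n).normed volume) (x - y)).comp (-ContinuousLinearMap.id ℝ V3 : V3 →L[ℝ] V3)) y :=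
      ((htest n).differentiable (x - y)).hasFDerivAt.comp y
        ((hasFDerivAt_id y).const_sub x)
    simp [hc.fderiv, mul_comm]
  obtain ⟨x, hx⟩ := hae.exists
  refine ⟨u x, hae.mono fun y hy => ?_⟩
  refine tendsto_nhds_unique hy ?_
  simpa only [fun n => hconst n y x] using hx

/-- The fundamental theorem of calculus along the segment from `z` to `z + e`, followed by Fubini.
It exchanges a finite translation of the test function for derivatives, so that invariance or
periodicity of `u` can be used. -/
theorem IsTest.integral_increment {u θ : V3 → ℝ} (hu : LocallyIntegrable u) (hθ : IsTest θ)
    (e : V3) : ∫ z, u z * (θ (z + e) - θ z) =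
      ∫ t in (0 : ℝ)..1, ∫ z, u z * _root_.fderiv ℝ θ (z + t • e) e := by
  have hcont : Continuous fun y => _root_.fderiv ℝ θ y e := (hθ.fderiv e).smooth.continuous
  have hftc : ∀ z, θ (z + e) - θ z = ∫ t in (0 : ℝ)..1, _root_.fderiv ℝ θ (z + t • e) e := by
    intro z
    rw [intervalIntegral.integral_eq_sub_of_hasDerivAt (f := fun t : ℝ => θ (z + t • e))]
    · simp
    · intro t _
      have h1 : HasDerivAt (fun t : ℝ => z + t • e) e t := by
        simpa using ((hasDerivAt_id t).smul_const e).const_add z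
      exact (hθ.differentiable _).hasFDerivAt.comp_hasDerivAt t h1
    · exact (hcont.comp (by fun_prop)).intervalIntegrable 0 1
  simp only [hftc, ← intervalIntegral.integral_const_mul]
  rw [intervalIntegral_integral_swap]
  -- The compact set swept by the support under the backward translations. Outside it the integrand
  -- vanishes, so local integrability of `u` suffices for Fubini.
  let K : Set V3 := (fun p : ℝ × V3 => p.2 - p.1 • e) ''
    (Set.Icc (0 : ℝ) 1 ×ˢ tsupport fun y => _root_.fderiv ℝ θ y e)
  have hK : IsCompact K := (isCompact_Icc.prod (hθ.fderiv e).compact).image (by fun_prop)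
  obtain ⟨C, hC⟩ := (hθ.fderiv e).compact.exists_bound_of_continuous hcont
  have hind : Integrable (K.indicator u) :=
    (integrable_indicator_iff hK.measurableSet).2 (hu.integrableOn_isCompact hK)
  have : IsFiniteMeasure (volume.restrict (Set.uIoc (0 : ℝ) 1)) := by
    rw [Set.uIoc_of_le zero_le_one]; infer_instance
  have hdom : Integrable (fun p : ℝ × V3 => C * ‖K.indicator u p.2‖)
      ((volume.restrict (Set.uIoc (0 : ℝ) 1)).prod volume) :=
    (hind.norm.comp_snd (volume.restrict (Set.uIoc (0 : ℝ) 1))).const_mul C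
  refine hdom.mono' ?_ ?_
  · exact (hu.aestronglyMeasurable.comp_snd).mul
      (hcont.comp (by fun_prop : Continuous fun p : ℝ × V3 => p.2 + p.1 • e)).aestronglyMeasurable
  · rw [← Measure.restrict_univ (μ := (volume : Measure V3)), Measure.prod_restrict,
      Set.uIoc_of_le zero_le_one]
    filter_upwards [ae_restrict_mem (measurableSet_Ioc.prod MeasurableSet.univ)] with p hp
    simp only [Function.uncurry, norm_mul]
    by_cases hz : p.2 ∈ K
    · rw [Set.indicator_of_mem hz, mul_comm]
      gcongr
      exact hC _
    · have : _root_.fderiv ℝ θ (p.2 + p.1 • e) e = 0 := by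
        by_contra hne
        exact hz ⟨(p.1, p.2 + p.1 • e), ⟨⟨hp.1.1.le, hp.1.2⟩, subset_tsupport _ hne⟩, by simp⟩
      simp [this, hz]

/-- A function invariant under translations in direction `j` has vanishing `j`-th weak partial. -/
theorem isWeakPartial_zero_of_invariant {u : V3 → ℝ} (hu : LocallyIntegrable u) {j : Fin 3}
    (h : ∀ t : ℝ, ∀ y, u (y + t • Pi.single j 1) = u y) : IsWeakPartial u j fun _ => 0 := by
  rw [isWeakPartial_iff]
  intro θ hθ
  have key := IsTest.integral_increment hu hθ (Pi.single j 1)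
  -- Translating the variable by the invariant direction removes `t`, so the average over `t` below
  -- is the derivative pairing itself.
  have h1 : ∀ t : ℝ, ∫ z, u z * fderiv ℝ θ (z + t • Pi.single j 1) (Pi.single j 1) =
      ∫ z, u z * fderiv ℝ θ z (Pi.single j 1) := by
    intro t
    rw [← integral_add_right_eq_self (fun z => u z * fderiv ℝ θ z (Pi.single j 1))
      (t • Pi.single j 1)]
    simp only [h]
  simp only [h1, intervalIntegral.integral_const, sub_zero, one_smul] at key
  rw [← key]
  have h2 : ∫ z, u z * θ (z + Pi.single j 1) = ∫ z, u z * θ z := by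
    rw [← integral_add_right_eq_self (fun z => u z * θ z) (Pi.single j 1)]
    have := h 1
    simp only [one_smul] at this
    simp only [this]
  simp only [mul_sub]
  rw [integral_sub ((hθ.comp_add _).integrable_mul hu) (hθ.integrable_mul hu), h2]
  simp

/-! ### Periodic functions and means over the cell -/

/-- The lattice `ℤ³`. -/
def cellLattice : AddSubgroup V3 := ((Int.castAddHom ℝ).compLeft (Fin 3)).range

instance : Countable cellLattice :=
  (((Int.castAddHom ℝ).compLeft (Fin 3)).rangeRestrict_surjective).countable

theorem mem_cellLattice {v : V3} : v ∈ cellLattice ↔ ∃ k : Fin 3 → ℤ, v = fun i => (k i : ℝ) :=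
  ⟨fun ⟨k, hk⟩ => ⟨k, hk.symm⟩, fun ⟨k, hk⟩ => ⟨k, hk.symm⟩⟩

theorem mem_unitCell {y : V3} : y ∈ unitCell ↔ ∀ i, 0 ≤ y i ∧ y i < 1 := by
  simp [unitCell, Set.mem_pi]

theorem measurableSet_unitCell : MeasurableSet unitCell :=
  MeasurableSet.univ_pi fun _ => measurableSet_Ico

theorem volume_unitCell : volume unitCell = 1 := by
  simp [unitCell, Real.volume_pi_Ico]

instance : IsProbabilityMeasure (volume.restrict unitCell) :=
  ⟨by simp [volume_unitCell]⟩

theorem unitCell_subset_Icc : unitCell ⊆ Set.Icc 0 1 := fun _ hy =>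
  ⟨fun i => (mem_unitCell.1 hy i).1, fun i => (mem_unitCell.1 hy i).2.le⟩

theorem MemLpLoc.memLp_cell {p : ENNReal} {f : V3 → ℝ} (h : MemLpLoc p f) :
    MemLp f p (volume.restrict unitCell) :=
  (h _ isCompact_Icc).mono_measure (Measure.restrict_mono unitCell_subset_Icc le_rfl)

/-- The preimage of the unit cell under a map commuting with the lattice translations. -/
theorem isAddFundamentalDomain_preimage {b : V3 → V3} (hb : Measurable b)
    (hbk : ∀ (k : Fin 3 → ℤ) y, b (y + fun i => (k i : ℝ)) = b y + fun i => (k i : ℝ)) :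
    IsAddFundamentalDomain cellLattice (b ⁻¹' unitCell) volume := by
  refine IsAddFundamentalDomain.mk' (hb measurableSet_unitCell).nullMeasurableSet fun x => ?_
  refine ⟨⟨fun i => ((-⌊b x i⌋ : ℤ) : ℝ), mem_cellLattice.2 ⟨fun i => -⌊b x i⌋, rfl⟩⟩, ?_, ?_⟩
  · simp only [AddSubgroup.vadd_def, vadd_eq_add, Set.mem_preimage]
    rw [add_comm, hbk fun i => -⌊b x i⌋, mem_unitCell]
    intro i
    simp only [Pi.add_apply, Int.cast_neg]
    constructor
    · linarith [Int.floor_le (b x i)]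
    · linarith [Int.lt_floor_add_one (b x i)]
  · rintro ⟨v, hv⟩ hx
    obtain ⟨k, rfl⟩ := mem_cellLattice.1 hv
    simp only [AddSubgroup.vadd_def, vadd_eq_add, Set.mem_preimage] at hx
    rw [add_comm, hbk, mem_unitCell] at hx
    simp only [Subtype.mk.injEq]
    funext i
    have := hx i
    simp only [Pi.add_apply] at this
    congr 1
    have h2 : ⌊b x i⌋ = -k i := by
      rw [Int.floor_eq_iff]
      push_cast
      constructor <;> linarith
    omega

/-- An almost everywhere periodic function has an everywhere periodic representative. -/
theorem IsCellPeriodic.exists_invariant {f : V3 → ℝ} (hf : IsCellPeriodic f) :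
    ∃ f' : V3 → ℝ, (∀ᵐ y, f y = f' y) ∧
      ∀ (k : Fin 3 → ℤ) y, f' (y + fun i => (k i : ℝ)) = f' y := by
  classical
  have hae : ∀ᵐ y, ∀ k : Fin 3 → ℤ, f (y + fun i => (k i : ℝ)) = f y := ae_all_iff.2 hf
  -- The set of points where every lattice translation preserves `f` has full measure, the lattice
  -- being countable, and is itself lattice-invariant; the default value `0` off it therefore keeps
  -- periodicity.
  refine ⟨fun y => if ∀ k : Fin 3 → ℤ, f (y + fun i => (k i : ℝ)) = f y then f y else 0,
    hae.mono fun y hy => (if_pos hy).symm, fun k y => ?_⟩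
  have hadd : ∀ l : Fin 3 → ℤ, (y + fun i => (k i : ℝ)) + (fun i => (l i : ℝ)) =
      y + fun i => ((k + l) i : ℝ) := fun l => by
    funext i; simp [add_assoc]
  by_cases h : ∀ l : Fin 3 → ℤ, f (y + fun i => (l i : ℝ)) = f y
  · have h' : ∀ l : Fin 3 → ℤ, f ((y + fun i => (k i : ℝ)) + fun i => (l i : ℝ)) =
        f (y + fun i => (k i : ℝ)) := fun l => by rw [hadd, h, h]
    beta_reduce
    rw [if_pos h, if_pos h', h]
  · have h' : ¬ ∀ l : Fin 3 → ℤ, f ((y + fun i => (k i : ℝ)) + fun i => (l i : ℝ)) =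
        f (y + fun i => (k i : ℝ)) := by
      intro h'
      refine h fun l => ?_
      have e1 := h' (l - k)
      have e2 := h' (-k)
      rw [hadd] at e1 e2
      simp only [add_sub_cancel, add_neg_cancel] at e1 e2
      rw [e1, ← e2]
      congr 1
      funext i; simp
    simp only [if_neg h, if_neg h']

theorem mean_congr {f g : V3 → ℝ} (h : ∀ᵐ y, f y = g y) : mean f = mean g :=
  integral_congr_ae (ae_restrict_of_ae h)

/-- The cell and its preimage are both fundamental domains of the lattice, and an invariant function
has the same integral over any two of them. -/
theorem setIntegral_preimage_cell {b : V3 → V3} (hb : Measurable b)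
    (hbk : ∀ (k : Fin 3 → ℤ) y, b (y + fun i => (k i : ℝ)) = b y + fun i => (k i : ℝ))
    {f : V3 → ℝ} (hf : IsCellPeriodic f) : ∫ y in b ⁻¹' unitCell, f y = mean f := by
  obtain ⟨f', hff', hf'⟩ := hf.exists_invariant
  rw [mean_congr hff', integral_congr_ae (ae_restrict_of_ae hff')]
  refine IsAddFundamentalDomain.setIntegral_eq (isAddFundamentalDomain_preimage hb hbk)
    (isAddFundamentalDomain_preimage measurable_id fun _ _ => rfl) ?_
  rintro ⟨v, hv⟩ x
  obtain ⟨k, rfl⟩ := mem_cellLattice.1 hv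
  simp only [AddSubgroup.vadd_def, vadd_eq_add]
  rw [add_comm, hf']

theorem mean_comp_add {f : V3 → ℝ} (hf : IsCellPeriodic f) (v : V3) :
    mean (fun y => f (y + v)) = mean f := by
  rw [← setIntegral_preimage_cell (b := fun y => y - v) (by fun_prop)
    (fun k y => by simp [add_sub_right_comm]) hf]
  have hp : MeasurePreserving (fun y : V3 => y + v) volume volume :=
    measurePreserving_add_right volume v
  have key := hp.setIntegral_preimage_emb (measurableEmbedding_addRight v) f
    ((fun y => y - v) ⁻¹' unitCell)
  rw [← Set.preimage_comp] at key
  rw [← key, mean]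
  congr 2
  ext y
  simp

/-- Change of variables for cell means of periodic functions. -/
theorem mean_comp_symm (b : V3 ≃ᵐ V3)
    (hbk : ∀ (k : Fin 3 → ℤ) y, b (y + fun i => (k i : ℝ)) = b y + fun i => (k i : ℝ))
    {w : V3 → ℝ} (hw : Measurable w) (hw0 : ∀ y, 0 ≤ w y)
    (hb : MeasurePreserving b (volume.withDensity fun y => ENNReal.ofReal (w y)) volume)
    {f : V3 → ℝ} (hfw : IsCellPeriodic fun y => f y * w y) :
    mean (fun y => f (b.symm y)) = mean fun y => f y * w y := by
  rw [← setIntegral_preimage_cell b.measurable hbk hfw, mean,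
    ← hb.setIntegral_preimage_emb b.measurableEmbedding]
  simp only [MeasurableEquiv.symm_apply_apply]
  rw [setIntegral_withDensity_eq_setIntegral_toReal_smul (by fun_prop) (by simp)
    _ (b.measurable measurableSet_unitCell)]
  simp only [ENNReal.toReal_ofReal (hw0 _), smul_eq_mul, mul_comm]

/-- Subtracting the integer parts of the coordinates moves a point into the cell, and only countably
many translations occur. -/
theorem IsCellPeriodic.ae_of_ae_cell {β : Type*} {f : V3 → β} (hf : IsCellPeriodic f)
    {p : β → Prop} (h : ∀ᵐ y ∂volume.restrict unitCell, p (f y)) : ∀ᵐ y, p (f y) := by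
  rw [ae_restrict_iff' measurableSet_unitCell] at h
  have h1 : ∀ k : Fin 3 → ℤ, ∀ᵐ y : V3, (y + fun i => (k i : ℝ)) ∈ unitCell →
      p (f (y + fun i => (k i : ℝ))) := fun k =>
    (measurePreserving_add_right volume (fun i => (k i : ℝ) : V3)).quasiMeasurePreserving.ae h
  filter_upwards [ae_all_iff.2 h1, ae_all_iff.2 hf] with y hy1 hy2
  rw [← hy2 fun i => -⌊y i⌋]
  refine hy1 _ (mem_unitCell.2 fun i => ?_)
  simp only [Pi.add_apply, Int.cast_neg]
  constructor
  · linarith [Int.floor_le (y i)]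
  · linarith [Int.lt_floor_add_one (y i)]

/-! ### Functions of the first coordinate -/

theorem quasiMeasurePreserving_fst : Measure.QuasiMeasurePreserving (fun y : V3 => y 0)
    volume volume :=
  Measure.quasiMeasurePreserving_eval (fun _ : Fin 3 => (volume : Measure ℝ)) 0

theorem ae_comp_fst {p : ℝ → Prop} (h : ∀ᵐ s, p s) : ∀ᵐ y : V3, p (y 0) :=
  quasiMeasurePreserving_fst.ae h

/-- The measurable equivalence splitting off the first coordinate. -/
def splitFst : V3 ≃ᵐ ℝ × (Fin 2 → ℝ) := MeasurableEquiv.piFinSuccAbove (fun _ : Fin 3 => ℝ) 0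

theorem measurePreserving_splitFst : MeasurePreserving splitFst :=
  volume_preserving_piFinSuccAbove (fun _ : Fin 3 => ℝ) 0

/-- Fubini supplies one line parallel to the first axis on which the property holds almost
everywhere. This is how statements in space are reduced to statements on the real line. -/
theorem exists_ae_of_ae {p : V3 → Prop} (h : ∀ᵐ y, p y) :
    ∃ z : Fin 2 → ℝ, ∀ᵐ s : ℝ, p (splitFst.symm (s, z)) := by
  have h1 : ∀ᵐ x : ℝ × (Fin 2 → ℝ), p (splitFst.symm x) :=
    (measurePreserving_splitFst.symm).quasiMeasurePreserving.ae h
  have h2 : ∀ᵐ x : (Fin 2 → ℝ) × ℝ, p (splitFst.symm x.swap) :=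
    (Measure.measurePreserving_swap (μ := volume) (ν := volume)).quasiMeasurePreserving.ae h1
  exact (Measure.ae_ae_of_ae_prod h2).exists

theorem splitFst_symm_zero (s : ℝ) (z : Fin 2 → ℝ) : splitFst.symm (s, z) 0 = s := rfl

theorem ae_of_ae_comp_fst {p : ℝ → Prop} (h : ∀ᵐ y : V3, p (y 0)) : ∀ᵐ s, p s := by
  obtain ⟨z, hz⟩ := exists_ae_of_ae h
  simpa only [splitFst_symm_zero] using hz

theorem measurePreserving_fst_cell : MeasurePreserving (fun y : V3 => y 0)
    (volume.restrict unitCell) (volume.restrict (Set.Ico (0 : ℝ) 1)) := by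
  have : IsProbabilityMeasure (volume.restrict (Set.Ico (0 : ℝ) 1)) := ⟨by simp⟩
  have := measurePreserving_eval (fun _ : Fin 3 => volume.restrict (Set.Ico (0 : ℝ) 1)) 0
  rwa [← Measure.restrict_pi_pi] at this

theorem mean_fst {f : ℝ → ℝ} (hf : Measurable f) :
    mean (fun y => f (y 0)) = ∫ s in (0 : ℝ)..1, f s := by
  rw [intervalIntegral.integral_of_le zero_le_one, ← integral_Ico_eq_integral_Ioc,
    ← measurePreserving_fst_cell.map_eq,
    integral_map (measurable_pi_apply 0).aemeasurable hf.aestronglyMeasurable]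
  rfl

theorem isCellPeriodic_fst {β : Type*} {f : ℝ → β} (hf : Function.Periodic f 1) :
    IsCellPeriodic fun y => f (y 0) := fun k => .of_forall fun y => by
  simpa using hf.int_mul (k 0) (y 0)

theorem memLpLoc_of_bounded {f : V3 → ℝ} (hf : AEStronglyMeasurable f) {C : ℝ}
    (hC : ∀ᵐ y, |f y| ≤ C) (p : ENNReal) : MemLpLoc p f := fun K hK => by
  have : IsFiniteMeasure (volume.restrict K) := ⟨by simpa using hK.measure_lt_top⟩
  exact MemLp.of_bound hf.restrict C (ae_restrict_of_ae hC)

/-! ### Means of derivatives of periodic functions -/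

theorem locallyIntegrable_comp_add {u : V3 → ℝ} (hu : LocallyIntegrable u) (v : V3) :
    LocallyIntegrable fun y => u (y + v) := by
  rw [locallyIntegrable_iff] at *
  intro K hK
  have hp : MeasurePreserving (fun y : V3 => y + v) volume volume :=
    measurePreserving_add_right volume v
  have hK' := hu _ (hK.image (f := fun y => y + v) (by fun_prop))
  rw [← hp.integrableOn_comp_preimage (measurableEmbedding_addRight v)] at hK'
  exact hK'.mono_set (Set.subset_preimage_image _ _)

/-- A translate of `g` is a weak derivative of the same translate of `u`, that is of `u` itself, and
weak derivatives are unique. -/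
theorem IsWeakPartial.isCellPeriodic {u g : V3 → ℝ} {j : Fin 3} (h : IsWeakPartial u j g)
    (hu : IsCellPeriodic u) (hg : LocallyIntegrable g) : IsCellPeriodic g := fun k =>
  ((h.comp_add _).congr (hu k) (.of_forall fun _ => rfl)).unique h
    (locallyIntegrable_comp_add hg _) hg

/-- The integrability that Fubini requires when translates of a locally integrable function are
averaged over a unit time. -/
theorem integrable_translates {g : V3 → ℝ} (hg : LocallyIntegrable g) (e : V3) {K : Set V3}
    (hK : IsCompact K) : Integrable (fun p : ℝ × V3 => g (p.2 + p.1 • e))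
      ((volume.restrict (Set.uIoc (0 : ℝ) 1)).prod (volume.restrict K)) := by
  rw [Set.uIoc_of_le zero_le_one]
  let K' : Set V3 := (fun p : ℝ × V3 => p.2 + p.1 • e) '' (Set.Icc (0 : ℝ) 1 ×ˢ K)
  have hK' : IsCompact K' := (isCompact_Icc.prod hK).image (by fun_prop)
  have hind : Integrable (K'.indicator g) :=
    (integrable_indicator_iff hK'.measurableSet).2 (hg.integrableOn_isCompact hK')
  -- The shear of space-time preserves the product measure, since for each fixed time it is a
  -- translation.
  have hp : MeasurePreserving (fun p : ℝ × V3 => (p.1, p.2 + p.1 • e))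
      ((volume.restrict (Set.Ioc (0 : ℝ) 1)).prod volume)
      ((volume.restrict (Set.Ioc (0 : ℝ) 1)).prod volume) :=
    (MeasurePreserving.id _).skew_product (g := fun t z => z + t • e)
      (by fun_prop)
      (.of_forall fun t => (measurePreserving_add_right volume (t • e)).map_eq)
  have h1 : Integrable (fun p : ℝ × V3 => K'.indicator g (p.2 + p.1 • e))
      ((volume.restrict (Set.Ioc (0 : ℝ) 1)).prod volume) :=
    hp.integrable_comp_of_integrable (hind.comp_snd _)
  have h2 := h1.mono_measure (μ := (volume.restrict (Set.Ioc (0 : ℝ) 1)).prod (volume.restrict K))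
    (Measure.prod_mono le_rfl Measure.restrict_le_self)
  refine h2.congr ?_
  rw [Measure.prod_restrict]
  filter_upwards [ae_restrict_mem (measurableSet_Ioc.prod hK.measurableSet)] with p hp
  exact Set.indicator_of_mem (s := K') ⟨p, ⟨⟨hp.1.1.le, hp.1.2⟩, hp.2⟩, rfl⟩ _

/-- The increment of a function over one period is the integral of its weak derivative. -/
theorem ae_integral_weakPartial_eq_zero {u g : V3 → ℝ} {j : Fin 3} (h : IsWeakPartial u j g)
    (hu : LocallyIntegrable u) (hg : LocallyIntegrable g) (hper : IsCellPeriodic u) :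
    ∀ᵐ y, ∫ t in (0 : ℝ)..1, g (y + t • Pi.single j 1) = 0 := by
  set e : V3 := Pi.single j 1 with he
  have hloc : LocallyIntegrable fun y => ∫ t in (0 : ℝ)..1, g (y + t • e) := by
    rw [locallyIntegrable_iff]
    intro K hK
    have := (integrable_translates hg e hK).integral_prod_right
    simpa only [IntegrableOn, intervalIntegral.integral_of_le zero_le_one,
      Set.uIoc_of_le zero_le_one] using this
  refine ae_eq_zero_of_integral_contDiff_smul_eq_zero hloc fun θ h1 h2 => ?_
  have hθ : IsTest θ := ⟨h1, h2⟩
  -- The test function is moved backwards so that, after integration by parts and a change of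
  -- variables, `g` appears at the forward translates `z + t • e`.
  have key := IsTest.integral_increment hu hθ (-e)
  have hl : ∫ z, u z * (θ (z + -e) - θ z) = 0 := by
    simp only [mul_sub]
    rw [integral_sub ((hθ.comp_add _).integrable_mul hu) (hθ.integrable_mul hu), sub_eq_zero,
      ← integral_add_right_eq_self _ e]
    refine integral_congr_ae ((hper (Pi.single j 1)).mono fun y hy => ?_)
    have hk : (fun i => (((Pi.single j 1 : Fin 3 → ℤ) i : ℤ) : ℝ)) = e := by
      funext i
      simp only [he, Pi.single_apply]
      split_ifs <;> simp
    rw [hk] at hy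
    simp [hy]
  have hr : ∀ t : ℝ, ∫ z, u z * fderiv ℝ θ (z + t • -e) (-e) = ∫ z, θ z * g (z + t • e) := by
    intro t
    have := isWeakPartial_iff.1 h _ (hθ.comp_add (t • -e))
    simp only [fderiv_comp_add] at this
    simp only [map_neg, mul_neg, integral_neg]
    rw [this, neg_neg, ← integral_add_right_eq_self _ (t • e)]
    simp [mul_comm]
  rw [hl] at key
  simp only [hr] at key
  simp only [smul_eq_mul, ← intervalIntegral.integral_const_mul]
  rw [← intervalIntegral_integral_swap, ← key]
  obtain ⟨C, hC⟩ := h2.exists_bound_of_continuous h1.continuous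
  have hint := (integrable_translates hg e h2).bdd_mul (c := C) (f := fun p : ℝ × V3 => θ p.2)
    (h1.continuous.comp continuous_snd).aestronglyMeasurable (.of_forall fun p => hC p.2)
  refine (integrableOn_iff_integrable_of_support_subset (s := Set.univ ×ˢ tsupport θ) ?_).1 ?_
  · rintro ⟨t, y⟩ hty
    exact ⟨trivial, subset_tsupport _ (left_ne_zero_of_mul hty)⟩
  · rw [IntegrableOn, ← Measure.prod_restrict, Measure.restrict_univ]
    exact hint

/-- Derivatives of periodic functions have vanishing mean, also against functions that are
invariant in the direction of differentiation. -/
theorem mean_mul_weakPartial_eq_zero {u g σ : V3 → ℝ} {j : Fin 3} (h : IsWeakPartial u j g)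
    (hu : LocallyIntegrable u) (hg : LocallyIntegrable g) (hper : IsCellPeriodic u)
    (hσm : Measurable σ) {C : ℝ} (hσb : ∀ y, |σ y| ≤ C) (hσp : IsCellPeriodic σ)
    (hσ : ∀ (t : ℝ) y, σ (y + t • Pi.single j 1) = σ y) :
    mean (fun y => σ y * g y) = 0 := by
  set e : V3 := Pi.single j 1 with he
  have hgp := h.isCellPeriodic hper hg
  have hp : IsCellPeriodic fun y => σ y * g y := fun k => by
    filter_upwards [hσp k, hgp k] with y h1 h2
    rw [h1, h2]
  -- Translating the whole product changes nothing in the mean, and `σ` does not feel the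
  -- translation. Averaging over `t` thus leaves the mean unchanged, while the inner integral over
  -- one period of `g` vanishes.
  have h1 : ∀ t : ℝ, mean (fun y => σ y * g (y + t • e)) = mean fun y => σ y * g y := by
    intro t
    rw [← mean_comp_add hp (t • e)]
    simp only [hσ]
  have h2 : ∫ t in (0 : ℝ)..1, mean (fun y => σ y * g (y + t • e)) =
      mean fun y => σ y * g y := by simp [h1]
  rw [← h2]
  simp only [mean]
  rw [intervalIntegral_integral_swap]
  · simp only [intervalIntegral.integral_const_mul]
    refine integral_eq_zero_of_ae (ae_restrict_of_ae ?_)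
    filter_upwards [ae_integral_weakPartial_eq_zero h hu hg hper] with y hy
    rw [hy]; simp
  · have h3 := (integrable_translates hg e (isCompact_Icc (a := 0) (b := 1))).bdd_mul (c := C)
      (f := fun p : ℝ × V3 => σ p.2) (hσm.comp measurable_snd).aestronglyMeasurable
      (.of_forall fun p => hσb p.2)
    exact h3.mono_measure (Measure.prod_mono le_rfl
      (Measure.restrict_mono unitCell_subset_Icc le_rfl))

/-! ### Representatives of periodic functions and their primitives -/

/-- Bounded almost everywhere periodic functions have representatives that are measurable,
periodic and bounded everywhere. -/
theorem exists_periodic_representative {f : ℝ → ℝ} (hm : AEMeasurable f) {lo hi : ℝ}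
    (hb : ∀ᵐ s, lo ≤ f s ∧ f s ≤ hi) (hp : ∀ᵐ s, f (s + 1) = f s) :
    ∃ f' : ℝ → ℝ, Measurable f' ∧ (∀ s, lo ≤ f' s ∧ f' s ≤ hi) ∧ Function.Periodic f' 1 ∧
      ∀ᵐ s, f s = f' s := by
  have hlh : lo ≤ hi := by
    obtain ⟨s, hs⟩ := hb.exists
    exact hs.1.trans hs.2
  have shift : ∀ {p : ℝ → Prop}, (∀ᵐ s, p s) → ∀ᵐ s : ℝ, ∀ n : ℤ, p (s + n) := fun h =>
    ae_all_iff.2 fun n => (measurePreserving_add_right volume (n : ℝ)).quasiMeasurePreserving.ae h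
  -- Composition with the fractional part enforces periodicity, truncation enforces the bounds, and
  -- neither changes the function outside a null set.
  refine ⟨fun s => max lo (min hi (hm.mk f (Int.fract s))), ?_, fun s => ?_, fun s => ?_, ?_⟩
  · exact measurable_const.max (measurable_const.min (hm.measurable_mk.comp measurable_fract))
  · exact ⟨le_max_left _ _, max_le hlh (min_le_left _ _)⟩
  · simp
  · filter_upwards [shift hp, shift hm.ae_eq_mk, shift hb] with s h1 h2 h3
    have h4 : ∀ n : ℤ, f (s + n) = f s := by
      intro n
      induction n using Int.induction_on with
      | zero => simp
      | succ i ih => rw [← ih, ← h1 i]; push_cast; congr 1; ring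
      | pred i ih => rw [← ih, ← h1 (-i - 1)]; push_cast; congr 1; ring
    have h5 : Int.fract s = s + (-⌊s⌋ : ℤ) := by rw [Int.fract]; push_cast; ring
    rw [h5, ← h2, h4, min_eq_right, max_eq_right]
    · simpa using (h3 0).1
    · simpa using (h3 0).2

/-- The primitive of `c` vanishing at the origin. -/
def primitive (c : ℝ → ℝ) (s : ℝ) : ℝ := ∫ t in (0 : ℝ)..s, c t

theorem locallyIntegrable_of_bounded {c : ℝ → ℝ} (hc : Measurable c) {C : ℝ} (hb : ∀ s, |c s| ≤ C)
    : LocallyIntegrable c := by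
  rw [locallyIntegrable_iff]
  intro K hK
  have : IsFiniteMeasure (volume.restrict K) := ⟨by simpa using hK.measure_lt_top⟩
  exact Integrable.of_bound hc.aestronglyMeasurable C (.of_forall hb)

theorem intervalIntegrable_of_bounded {c : ℝ → ℝ} (hc : Measurable c) {C : ℝ} (hb : ∀ s, |c s| ≤ C)
    (s t : ℝ) : IntervalIntegrable c volume s t :=
  intervalIntegrable_iff.2 (((locallyIntegrable_of_bounded hc hb).integrableOn_isCompact
    isCompact_uIcc).mono_set Set.uIoc_subset_uIcc)

theorem primitive_sub {c : ℝ → ℝ} (hc : Measurable c) {C : ℝ} (hb : ∀ s, |c s| ≤ C)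
    (s t : ℝ) : primitive c t - primitive c s = ∫ x in s..t, c x :=
  intervalIntegral.integral_interval_sub_left (intervalIntegrable_of_bounded hc hb _ _)
    (intervalIntegrable_of_bounded hc hb _ _)

theorem lipschitzWith_primitive {c : ℝ → ℝ} (hc : Measurable c) {C : ℝ} (hb : ∀ s, |c s| ≤ C)
    : LipschitzWith C.toNNReal (primitive c) := by
  have hC : 0 ≤ C := (abs_nonneg _).trans (hb 0)
  refine LipschitzWith.of_dist_le_mul fun s t => ?_
  rw [Real.dist_eq, Real.dist_eq, primitive_sub hc hb t s, Real.coe_toNNReal _ hC]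
  exact intervalIntegral.norm_integral_le_of_norm_le_const (f := c) fun x _ => hb x

theorem ae_hasDerivAt_primitive {c : ℝ → ℝ} (hc : Measurable c) {C : ℝ} (hb : ∀ s, |c s| ≤ C)
    : ∀ᵐ s, HasDerivAt (primitive c) (c s) s :=
  (_root_.LocallyIntegrable.ae_hasDerivAt_integral (locallyIntegrable_of_bounded hc hb)).mono
    fun _ h => h 0

theorem primitive_add_one {c : ℝ → ℝ} (hc : Measurable c) {C : ℝ} (hb : ∀ s, |c s| ≤ C)
    (hp : Function.Periodic c 1) (s : ℝ) :
    primitive c (s + 1) = primitive c s + primitive c 1 := by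
  have h1 := primitive_sub hc hb s (s + 1)
  rw [hp.intervalIntegral_add_eq s 0, zero_add] at h1
  simp only [primitive] at *
  linarith

/-- The weak gradient of the primitive of a function of the first coordinate. -/
theorem isWeakPartial_primitive {c : ℝ → ℝ} (hc : Measurable c) {C : ℝ} (hb : ∀ s, |c s| ≤ C)
    (j : Fin 3) :
    IsWeakPartial (fun y => primitive c (y 0)) j fun y => (Pi.single j 1 : V3) 0 * c (y 0) := by
  have hl : LipschitzWith (C.toNNReal * 1) fun y : V3 => primitive c (y 0) :=
    (lipschitzWith_primitive hc hb).comp (LipschitzWith.eval 0)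
  refine isWeakPartial_of_lipschitz hl ?_
  filter_upwards [ae_comp_fst (ae_hasDerivAt_primitive hc hb)] with y hy
  have h1 := (ContinuousLinearMap.proj (R := ℝ) (φ := fun _ : Fin 3 => ℝ) 0).hasFDerivAt (x := y)
  have h2 := (HasDerivAt.comp_hasFDerivAt (h₂ := primitive c) y (by exact hy) h1).hasLineDerivAt
    (Pi.single j 1)
  have e : (c (y 0) • ContinuousLinearMap.proj (R := ℝ) (φ := fun _ : Fin 3 => ℝ) 0)
      (Pi.single j 1) = (Pi.single j 1 : V3) 0 * c (y 0) := by simp [mul_comm]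
  rwa [e] at h2

/-! ### The structure of the potential -/

theorem locallyIntegrable_fst {c : ℝ → ℝ} (hc : Measurable c) {C : ℝ} (hb : ∀ s, |c s| ≤ C) :
    LocallyIntegrable fun y : V3 => c (y 0) :=
  (memLpLoc_of_bounded (p := 1) (hc.comp (measurable_pi_apply 0)).aestronglyMeasurable
    (.of_forall fun y => hb (y 0))).locallyIntegrable le_rfl

theorem isWeakPartial_fst_zero {c : ℝ → ℝ} (hc : Measurable c) {C : ℝ} (hb : ∀ s, |c s| ≤ C)
    {j : Fin 3} (hj : j ≠ 0) : IsWeakPartial (fun y => c (y 0)) j fun _ => 0 :=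
  isWeakPartial_zero_of_invariant (locallyIntegrable_fst hc hb) fun t y => by
    simp [hj.symm]

/-- An almost everywhere periodic bounded function of the first coordinate. -/
theorem exists_fst_representative {f : V3 → ℝ} (hm : AEStronglyMeasurable f) {lo hi : ℝ}
    (hb : ∀ᵐ y, lo ≤ f y ∧ f y ≤ hi) (hp : IsCellPeriodic f) {f₁ : ℝ → ℝ}
    (hf : ∀ᵐ y, f y = f₁ (y 0)) :
    ∃ c : ℝ → ℝ, Measurable c ∧ (∀ s, lo ≤ c s ∧ c s ≤ hi) ∧ Function.Periodic c 1 ∧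
      ∀ᵐ y, f y = c (y 0) := by
  -- Nothing is assumed about `f₁`; its measurability is read off from a measurable version of `f`
  -- on one good line.
  have hm1 : AEMeasurable f₁ := by
    obtain ⟨z, hz⟩ := exists_ae_of_ae (p := fun y => f₁ (y 0) = hm.mk f y)
      (by filter_upwards [hf, hm.ae_eq_mk] with y h1 h2; rw [← h1, h2])
    refine ⟨fun s => hm.mk f (splitFst.symm (s, z)), ?_, hz⟩
    exact hm.stronglyMeasurable_mk.measurable.comp
      (splitFst.symm.measurable.comp (measurable_id.prodMk measurable_const))
  have hk : ∀ y : V3, (y + fun i => (((Pi.single 0 1 : Fin 3 → ℤ) i : ℤ) : ℝ)) 0 = y 0 + 1 := by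
    intro y; simp
  have hf' : ∀ᵐ y, f (y + fun i => (((Pi.single 0 1 : Fin 3 → ℤ) i : ℤ) : ℝ)) = f₁ (y 0 + 1) := by
    have := (measurePreserving_add_right volume
      (fun i => (((Pi.single 0 1 : Fin 3 → ℤ) i : ℤ) : ℝ) : V3)).quasiMeasurePreserving.ae hf
    exact this.mono fun y hy => by rw [hy, hk]
  obtain ⟨c, h1, h2, h3, h4⟩ := exists_periodic_representative hm1 (lo := lo) (hi := hi)
    (ae_of_ae_comp_fst (p := fun s => lo ≤ f₁ s ∧ f₁ s ≤ hi) (by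
      filter_upwards [hf, hb] with y h1 h2; rwa [← h1]))
    (ae_of_ae_comp_fst (p := fun s => f₁ (s + 1) = f₁ s) (by
      filter_upwards [hf, hf', hp (Pi.single 0 1)] with y h1 h2 h3
      rw [← h1, ← h2, h3]))
  exact ⟨c, h1, h2, h3, by
    filter_upwards [hf, ae_comp_fst h4] with y h5 h6; rw [h5, h6]⟩

/-- For `j ≠ 0` the entry `A i j` has zero weak gradient: its derivatives in the directions `k ≠ 0`
vanish because it depends on the first coordinate only, and its derivative in direction `0` equals
the derivative of `A i 0` in direction `j`, which vanishes for the same reason. Integration then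
gives the potential. -/
theorem potential_structure {A : V3 → Mat3} {a : V3 → V3} (ha : IsPotential a A) (ha0 : a 0 = 0)
    (hper : IsCellPeriodic A) {L : ℝ} (hL : ∀ᵐ y, ∀ i j, |A y i j| ≤ L)
    (hA1 : ∃ A₁ : ℝ → Mat3, ∀ᵐ y : V3, A y = A₁ (y 0)) :
    ∃ (c : Fin 3 → ℝ → ℝ) (N : Mat3), (∀ i, Measurable (c i)) ∧
      (∀ i s, |c i s| ≤ L) ∧ (∀ i, Function.Periodic (c i) 1) ∧
      (∀ᵐ y, ∀ i, A y i 0 = c i (y 0)) ∧ (∀ᵐ y, ∀ i, ∀ j ≠ 0, A y i j = N i j) ∧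
      ∀ y i, a y i = primitive (c i) (y 0) + N i 1 * y 1 + N i 2 * y 2 := by
  obtain ⟨A₁, hA1⟩ := hA1
  have hloc : ∀ i j, LocallyIntegrable fun y => A y i j := fun i j =>
    (ha.memLp_deriv i j).locallyIntegrable le_top
  have hrep : ∀ i j, ∃ c : ℝ → ℝ, Measurable c ∧ (∀ s, -L ≤ c s ∧ c s ≤ L) ∧
      Function.Periodic c 1 ∧ ∀ᵐ y, A y i j = c (y 0) := fun i j =>
    exists_fst_representative (hloc i j).aestronglyMeasurable
      (hL.mono fun y hy => abs_le.1 (hy i j)) (fun k => (hper k).mono fun y hy => congrFun (congrFun hy i) j)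
      (f₁ := fun s => A₁ s i j) (hA1.mono fun y hy => by rw [hy])
  choose c hcm hcb hcp hc using hrep
  have hcb' : ∀ i j s, |c i j s| ≤ L := fun i j s => abs_le.2 (hcb i j s)
  have hconst : ∀ i j, j ≠ 0 → ∃ n, ∀ᵐ y, A y i j = n := by
    intro i j hj
    refine ae_const_of_weak_gradient_zero (hloc i j) fun k => ?_
    by_cases hk : k = 0
    · subst hk
      rw [isWeakPartial_iff]
      intro θ hθ
      -- Both entries are derivatives of the same component of `a`; testing them with first
      -- derivatives of `θ` and using symmetry of its second derivative gives the mixed-derivative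
      -- identity.
      have h1 := isWeakPartial_iff.1 (ha.weak_deriv i j) _ (hθ.fderiv (Pi.single 0 1))
      have h2 := isWeakPartial_iff.1 (ha.weak_deriv i 0) _ (hθ.fderiv (Pi.single j 1))
      have h3 := isWeakPartial_iff.1 ((isWeakPartial_fst_zero (hcm i 0) (hcb' i 0) hj).congr
        ((hc i 0).mono fun _ h => h.symm) (.of_forall fun _ => rfl)) _ hθ
      simp only [hθ.fderiv_comm (Pi.single 0 1)] at h1
      rw [h1] at h2
      rw [neg_injective h2, h3]
    · exact (isWeakPartial_fst_zero (hcm i j) (hcb' i j) hk).congr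
        ((hc i j).mono fun _ h => h.symm) (.of_forall fun _ => rfl)
  have hN : ∀ i j, ∃ n, j ≠ 0 → ∀ᵐ y, A y i j = n := fun i j => by
    by_cases hj : j = 0
    · exact ⟨0, fun h => absurd hj h⟩
    · obtain ⟨n, hn⟩ := hconst i j hj
      exact ⟨n, fun _ => hn⟩
  choose N hN using hN
  refine ⟨fun i => c i 0, N, fun i => hcm i 0, fun i => hcb' i 0, fun i => hcp i 0,
    ae_all_iff.2 fun i => hc i 0, ?_, fun y i => ?_⟩
  · refine ae_all_iff.2 fun i => ae_all_iff.2 fun j => ?_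
    by_cases hj : j = 0
    · exact .of_forall fun y h => absurd hj h
    · exact (hN i j hj).mono fun y hy _ => hy
  have hai : Continuous fun y => a y i := (continuous_apply i).comp ha.continuous
  have hV : Continuous fun y : V3 => primitive (c i 0) (y 0) :=
    (lipschitzWith_primitive (hcm i 0) (hcb' i 0)).continuous.comp (continuous_apply 0)
  -- The difference between `a` and the claimed formula has zero weak gradient; being continuous and
  -- zero at the origin, it vanishes everywhere and not just almost everywhere.
  have hzero : ∀ j, IsWeakPartial
      (fun y => a y i - (primitive (c i 0) (y 0) + N i 1 * y 1 + N i 2 * y 2)) j fun _ => 0 := by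
    intro j
    have hl : ∀ k, LocallyIntegrable fun y : V3 => N i k * y k := fun k =>
      (by fun_prop : Continuous fun y : V3 => N i k * y k).locallyIntegrable
    have hlc : ∀ r : ℝ, LocallyIntegrable fun _ : V3 => r := fun r =>
      continuous_const.locallyIntegrable
    have hl0 : LocallyIntegrable fun y : V3 => (Pi.single j 1 : V3) 0 * c i 0 (y 0) :=
      (locallyIntegrable_fst (hcm i 0) (hcb' i 0)).smul ((Pi.single j 1 : V3) 0)
    have h1 := ((isWeakPartial_primitive (hcm i 0) (hcb' i 0) j).add
      ((isWeakPartial_coord 1 j).const_mul (N i 1)) hV.locallyIntegrable (hl 1) hl0 (hlc _))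
    have h2 := h1.add ((isWeakPartial_coord 2 j).const_mul (N i 2))
      (hV.locallyIntegrable.add (hl 1)) (hl 2) (hl0.add (hlc _)) (hlc _)
    have h3 := (ha.weak_deriv i j).sub h2 hai.locallyIntegrable
      ((hV.locallyIntegrable.add (hl 1)).add (hl 2)) (hloc i j) ((hl0.add (hlc _)).add (hlc _))
    refine h3.congr (.of_forall fun _ => rfl) ?_
    fin_cases j
    · filter_upwards [hc i 0] with y hy
      simp [hy]
    · filter_upwards [hN i 1 (by simp)] with y hy
      simp [hy]
    · filter_upwards [hN i 2 (by simp)] with y hy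
      simp [hy]
  have hcont : Continuous fun y : V3 =>
      a y i - (primitive (c i 0) (y 0) + N i 1 * y 1 + N i 2 * y 2) := by fun_prop
  obtain ⟨r, hr⟩ := ae_const_of_weak_gradient_zero hcont.locallyIntegrable hzero
  have hr' := (Continuous.ae_eq_iff_eq volume hcont continuous_const).1 hr
  have e0 := congrFun hr' 0
  have ey := congrFun hr' y
  simp only [ha0, Pi.zero_apply, primitive, intervalIntegral.integral_same] at e0 ey ⊢
  linarith

/-! ### Bilipschitz changes of the first coordinate -/

/-- A stretch density: a bounded measurable function that is bounded away from zero, `1`-periodic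
and of mean one. -/
structure IsStretch (ρ : ℝ → ℝ) : Prop where
  measurable : Measurable ρ
  bounds : ∃ lo hi : ℝ, 0 < lo ∧ ∀ s, lo ≤ ρ s ∧ ρ s ≤ hi
  periodic : Function.Periodic ρ 1
  integral_eq_one : ∫ s in (0 : ℝ)..1, ρ s = 1

namespace IsStretch

variable {ρ : ℝ → ℝ}

theorem pos (h : IsStretch ρ) (s : ℝ) : 0 < ρ s := by
  obtain ⟨lo, hi, h0, hb⟩ := h.bounds
  exact h0.trans_le (hb s).1

theorem exists_abs_le (h : IsStretch ρ) : ∃ C, ∀ s, |ρ s| ≤ C := by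
  obtain ⟨lo, hi, h0, hb⟩ := h.bounds
  exact ⟨hi, fun s => by rw [abs_of_pos (h.pos s)]; exact (hb s).2⟩

theorem one : IsStretch fun _ => 1 :=
  ⟨measurable_const, ⟨1, 1, one_pos, fun _ => ⟨le_rfl, le_rfl⟩⟩, fun _ => rfl, by simp⟩

theorem intervalIntegrable (h : IsStretch ρ) (s t : ℝ) : IntervalIntegrable ρ volume s t := by
  obtain ⟨C, hC⟩ := h.exists_abs_le
  exact intervalIntegrable_of_bounded h.measurable hC s t

theorem primitive_sub (h : IsStretch ρ) (s t : ℝ) :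
    primitive ρ t - primitive ρ s = ∫ x in s..t, ρ x := by
  obtain ⟨C, hC⟩ := h.exists_abs_le
  exact Laminate.primitive_sub h.measurable hC s t

theorem le_primitive_sub (h : IsStretch ρ) {lo : ℝ} (hlo : ∀ s, lo ≤ ρ s) {s t : ℝ} (hst : s ≤ t) :
    lo * (t - s) ≤ primitive ρ t - primitive ρ s := by
  rw [h.primitive_sub]
  have := intervalIntegral.integral_mono_on (f := fun _ => lo) hst (by simp)
    (h.intervalIntegrable s t) fun x _ => hlo x
  simpa [mul_comm] using this

theorem strictMono (h : IsStretch ρ) : StrictMono (primitive ρ) := fun s t hst => by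
  obtain ⟨lo, hi, h0, hb⟩ := h.bounds
  have := h.le_primitive_sub (fun s => (hb s).1) hst.le
  nlinarith

theorem continuous_primitive (h : IsStretch ρ) : Continuous (primitive ρ) := by
  obtain ⟨C, hC⟩ := h.exists_abs_le
  exact (lipschitzWith_primitive h.measurable hC).continuous

theorem surjective (h : IsStretch ρ) : Function.Surjective (primitive ρ) := by
  obtain ⟨lo, hi, h0, hb⟩ := h.bounds
  have hz : primitive ρ 0 = 0 := by simp [primitive]
  refine h.continuous_primitive.surjective ?_ ?_
  · refine Filter.tendsto_atTop_mono' _ ?_ (Filter.tendsto_id.const_mul_atTop h0)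
    filter_upwards [Filter.eventually_ge_atTop 0] with t ht
    have := h.le_primitive_sub (fun s => (hb s).1) ht
    simp only [id]
    linarith
  · refine Filter.tendsto_atBot_mono' _ ?_ (Filter.tendsto_id.const_mul_atBot h0)
    filter_upwards [Filter.eventually_le_atBot 0] with t ht
    have := h.le_primitive_sub (fun s => (hb s).1) ht
    simp only [id]
    linarith

/-- The change of variables with density `ρ`. -/
def homeo (h : IsStretch ρ) : ℝ ≃ₜ ℝ := (h.strictMono.orderIsoOfSurjective _ h.surjective).toHomeomorph

@[simp] theorem homeo_apply (h : IsStretch ρ) (s : ℝ) : h.homeo s = primitive ρ s := rfl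

theorem homeo_add_one (h : IsStretch ρ) (s : ℝ) : h.homeo (s + 1) = h.homeo s + 1 := by
  obtain ⟨C, hC⟩ := h.exists_abs_le
  simp only [homeo_apply]
  rw [primitive_add_one h.measurable hC h.periodic, primitive, primitive, h.integral_eq_one]

theorem homeo_add_int (h : IsStretch ρ) (s : ℝ) (n : ℤ) : h.homeo (s + n) = h.homeo s + n := by
  have hp : Function.Periodic (fun s => h.homeo s - s) 1 := fun s => by
    simp only [h.homeo_add_one]; ring
  have := hp.int_mul n s
  simp only [mul_one] at this
  linarith

theorem homeo_symm_add_one (h : IsStretch ρ) (s : ℝ) :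
    h.homeo.symm (s + 1) = h.homeo.symm s + 1 := by
  rw [Homeomorph.symm_apply_eq, h.homeo_add_one, Homeomorph.apply_symm_apply]

/-- The lower bound on `ρ` prevents the primitive from contracting distances by more than that
factor. -/
theorem lipschitz_homeo_symm (h : IsStretch ρ) : ∃ C, LipschitzWith C h.homeo.symm := by
  obtain ⟨lo, hi, h0, hb⟩ := h.bounds
  refine ⟨lo⁻¹.toNNReal, ?_⟩
  have key : AntilipschitzWith lo⁻¹.toNNReal h.homeo := by
    refine AntilipschitzWith.of_le_mul_dist fun s t => ?_
    rw [Real.coe_toNNReal _ (by positivity), Real.dist_eq, Real.dist_eq, homeo_apply, homeo_apply,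
      ← div_eq_inv_mul, le_div_iff₀ h0]
    rcases le_total s t with hst | hst
    · have := h.le_primitive_sub (fun s => (hb s).1) hst
      rw [abs_sub_comm, abs_of_nonneg (by linarith), abs_sub_comm,
        abs_of_nonneg (by nlinarith)]
      linarith
    · have := h.le_primitive_sub (fun s => (hb s).1) hst
      rw [abs_of_nonneg (by linarith), abs_of_nonneg (by nlinarith)]
      linarith
  exact key.to_rightInverse h.homeo.apply_symm_apply

/-- The preimage of an interval has `ρ`-mass equal to an increment of the primitive, hence to the
length of the interval; open intervals with rational endpoints determine the measure. -/
theorem measurePreserving (h : IsStretch ρ) : MeasurePreserving h.homeo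
    (volume.withDensity fun s => ENNReal.ofReal (ρ s)) volume := by
  refine ⟨h.homeo.measurable, ?_⟩
  have hIoo : ∀ a b : ℝ, (volume.withDensity fun s => ENNReal.ofReal (ρ s)).map h.homeo
      (Set.Ioo a b) = volume (Set.Ioo a b) := by
    intro a b
    rw [Measure.map_apply h.homeo.measurable measurableSet_Ioo]
    have hpre : h.homeo ⁻¹' Set.Ioo a b = Set.Ioo (h.homeo.symm a) (h.homeo.symm b) :=
      (h.strictMono.orderIsoOfSurjective _ h.surjective).preimage_Ioo a b
    rw [hpre, withDensity_apply _ measurableSet_Ioo, Real.volume_Ioo]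
    rcases le_or_gt a b with hab | hab
    · have hab' : h.homeo.symm a ≤ h.homeo.symm b :=
        (h.strictMono.orderIsoOfSurjective _ h.surjective).symm.monotone hab
      rw [← ofReal_integral_eq_lintegral_ofReal, ← integral_Ioc_eq_integral_Ioo,
        ← intervalIntegral.integral_of_le hab', ← h.primitive_sub, ← h.homeo_apply,
        ← h.homeo_apply, h.homeo.apply_symm_apply, h.homeo.apply_symm_apply]
      · exact ((intervalIntegrable_iff_integrableOn_Ioo_of_le hab').1 (h.intervalIntegrable _ _))
      · exact .of_forall fun s => (h.pos s).le
    · have hab' : h.homeo.symm b ≤ h.homeo.symm a :=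
        (h.strictMono.orderIsoOfSurjective _ h.surjective).symm.monotone hab.le
      rw [Set.Ioo_eq_empty (not_lt.2 hab')]
      simp [hab.le]
  have : IsLocallyFiniteMeasure
      ((volume.withDensity fun s => ENNReal.ofReal (ρ s)).map h.homeo) :=
    ⟨fun x => ⟨Set.Ioo (x - 1) (x + 1), Ioo_mem_nhds (by linarith) (by linarith), by
      rw [hIoo]; simp⟩⟩
  exact Real.measure_ext_Ioo_rat fun a b => hIoo a b

end IsStretch

/-- The homeomorphism `y ↦ (r y₀, y₁ + P₁ y₀, y₂ + P₂ y₀)`. -/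
def shear (r : ℝ ≃ₜ ℝ) (P : ℝ → V3) (hP : Continuous P) : V3 ≃ₜ V3 where
  toFun y i := if i = 0 then r (y 0) else y i + P (y 0) i
  invFun y i := if i = 0 then r.symm (y 0) else y i - P (r.symm (y 0)) i
  left_inv y := by
    funext i
    by_cases h : i = 0 <;> simp [h]
  right_inv y := by
    funext i
    by_cases h : i = 0 <;> simp [h]
  continuous_toFun := continuous_pi fun i => by
    by_cases h : i = 0 <;> simp only [h, if_true, if_false] <;> fun_prop
  continuous_invFun := continuous_pi fun i => by
    by_cases h : i = 0 <;> simp only [h, if_true, if_false] <;> fun_prop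

theorem shear_apply (r : ℝ ≃ₜ ℝ) (P : ℝ → V3) (hP : Continuous P) (y : V3) (i : Fin 3) :
    shear r P hP y i = if i = 0 then r (y 0) else y i + P (y 0) i := rfl

theorem shear_symm_apply (r : ℝ ≃ₜ ℝ) (P : ℝ → V3) (hP : Continuous P) (y : V3) (i : Fin 3) :
    (shear r P hP).symm y i = if i = 0 then r.symm (y 0) else y i - P (r.symm (y 0)) i := rfl

/-- A skew product: the first coordinate is handled by the one-dimensional stretch, and on each
slice the map is a translation. -/
theorem measurePreserving_shear {ρ : ℝ → ℝ} (h : IsStretch ρ) (P : ℝ → V3) (hP : Continuous P) :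
    MeasurePreserving (shear h.homeo P hP)
      (volume.withDensity fun y => ENNReal.ofReal (ρ (y 0))) volume := by
  have hsplit : MeasurePreserving splitFst (volume.withDensity fun y => ENNReal.ofReal (ρ (y 0)))
      ((volume.withDensity fun s => ENNReal.ofReal (ρ s)).prod volume) := by
    refine ⟨splitFst.measurable, ?_⟩
    rw [prod_withDensity_left (h.measurable.ennreal_ofReal), ← Measure.volume_eq_prod]
    rw [← measurePreserving_splitFst.map_eq]
    ext s hs
    rw [Measure.map_apply splitFst.measurable hs, withDensity_apply _ (splitFst.measurable hs),
      withDensity_apply _ hs, splitFst.restrict_map, lintegral_map_equiv]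
    rfl
  have hskew : MeasurePreserving
      (fun p : ℝ × (Fin 2 → ℝ) => (h.homeo p.1, p.2 + fun i : Fin 2 => P p.1 i.succ))
      ((volume.withDensity fun s => ENNReal.ofReal (ρ s)).prod volume) volume :=
    h.measurePreserving.skew_product (g := fun s z => z + fun i : Fin 2 => P s i.succ)
      (by
        have : Continuous fun p : ℝ × (Fin 2 → ℝ) => p.2 + fun i : Fin 2 => P p.1 i.succ := by
          fun_prop
        exact this.measurable)
      (.of_forall fun s => (measurePreserving_add_right volume _).map_eq)
  have := (measurePreserving_splitFst.symm).comp (hskew.comp hsplit)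
  have e : ⇑(shear h.homeo P hP) = splitFst.symm ∘
      (fun p : ℝ × (Fin 2 → ℝ) => (h.homeo p.1, p.2 + fun i : Fin 2 => P p.1 i.succ)) ∘
      splitFst := by
    funext y i
    exact Fin.cases rfl (fun j => rfl) i
  rw [e]
  exact this

/-! ### The profile of a stress-free joint depending on the first coordinate -/

theorem primitive_linear {c : Fin 3 → ℝ → ℝ} (hc : ∀ i, Measurable (c i)) {C : ℝ}
    (hb : ∀ i s, |c i s| ≤ C) (v : V3) (s : ℝ) :
    primitive (fun t => ∑ j, v j * c j t) s = ∑ j, v j * primitive (c j) s := by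
  simp only [primitive]
  rw [intervalIntegral.integral_finsetSum fun j _ =>
    (intervalIntegrable_of_bounded (hc j) (hb j) 0 s).const_mul (v j)]
  simp only [intervalIntegral.integral_const_mul]

/-- These entries are the cofactors of the zeroth column and so do not see that column. This is why
the first row of the inverse joint varies only through the determinant. -/
theorem adjugate_updateCol_zero (N : Mat3) (v : V3) (i : Fin 3) :
    (N.updateCol 0 v).adjugate 0 i = N.adjugate 0 i := by
  fin_cases i <;> simp [Matrix.adjugate_fin_three]

/-- Laplace expansion along the varying column. Linearity in that column lets the determinant
commute with integration. -/
theorem det_updateCol_zero (N : Mat3) (v : V3) :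
    (N.updateCol 0 v).det = ∑ i, N.adjugate 0 i * v i := by
  rw [Matrix.det_fin_three, Matrix.adjugate_fin_three, Fin.sum_univ_three]
  simp
  ring

theorem inv_updateCol_zero (N : Mat3) (v : V3) (i : Fin 3) :
    (N.updateCol 0 v)⁻¹ 0 i = N.adjugate 0 i / (N.updateCol 0 v).det := by
  rw [Matrix.inv_def, Matrix.smul_apply, adjugate_updateCol_zero, Ring.inverse_eq_inv', smul_eq_mul,
    inv_mul_eq_div]

theorem measurable_inv_updateCol_zero (N : Mat3) {c : Fin 3 → ℝ → ℝ} (hc : ∀ i, Measurable (c i))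
    (i j : Fin 3) : Measurable fun s => (N.updateCol 0 fun i => c i s)⁻¹ i j := by
  simp only [Matrix.inv_def, Matrix.smul_apply, Ring.inverse_eq_inv', smul_eq_mul]
  refine Measurable.mul ?_ ?_
  · simp only [det_updateCol_zero]; fun_prop
  · simp only [Matrix.adjugate_fin_three]
    fin_cases i <;> fin_cases j <;> simp <;> fun_prop

/-- Cramer's rule with the Leibniz bound `3! B³` for a cofactor; `1 ≤ B` accommodates the unit row
inserted into the minor. -/
theorem abs_inv_apply_le {M : Mat3} {B δ : ℝ} (hB1 : 1 ≤ B) (hB : ∀ i j, |M i j| ≤ B) (hδ : 0 < δ)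
    (hd : δ ≤ M.det) (i j : Fin 3) : |M⁻¹ i j| ≤ δ⁻¹ * (6 * B ^ 3) := by
  simp only [Matrix.inv_def, Matrix.smul_apply, Ring.inverse_eq_inv', smul_eq_mul, abs_mul]
  have h1 : |M.adjugate i j| ≤ 6 * B ^ 3 := by
    rw [Matrix.adjugate_apply]
    have := Matrix.det_le (A := M.updateRow j (Pi.single i 1)) (abv := AbsoluteValue.abs) (x := B)
      (fun k l => by
        rw [Matrix.updateRow_apply]
        split_ifs
        · by_cases h : l = i
          · subst h; simpa using hB1
          · simpa [h] using zero_le_one.trans hB1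
        · exact hB k l)
    simpa [Nat.factorial] using this
  have h2 : |M.det⁻¹| ≤ δ⁻¹ := by
    rw [abs_of_pos (inv_pos.2 (hδ.trans_le hd))]
    gcongr
  gcongr

theorem exists_lipschitzWith_pi {X : Type*} [PseudoMetricSpace X] {f : X → V3}
    (h : ∀ i, ∃ C, LipschitzWith C fun x => f x i) : ∃ C, LipschitzWith C f := by
  choose C hC using h
  refine ⟨∑ i, C i, LipschitzWith.of_dist_le_mul fun x y => ?_⟩
  rw [dist_pi_le_iff (by positivity)]
  intro i
  refine ((hC i).dist_le_mul x y).trans ?_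
  gcongr
  exact Finset.single_le_sum (f := C) (fun j _ => zero_le) (Finset.mem_univ i)

/-- The determinant of the inverse is at most `3! L³`; the added `1` keeps the denominator positive
even for `L = 0`. -/
theorem det_lower_bound {M : Mat3} {L : ℝ} (hd : 0 < M.det) (h : ∀ i j, |M⁻¹ i j| ≤ L) :
    (6 * L ^ 3 + 1)⁻¹ ≤ M.det := by
  have h1 : |M⁻¹.det| ≤ 6 * L ^ 3 := by
    have := Matrix.det_le (A := M⁻¹) (abv := AbsoluteValue.abs) (x := L) (fun i j => h i j)
    simpa [Nat.factorial] using this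
  have h2 : M.det * M⁻¹.det = 1 := by
    rw [← Matrix.det_mul, Matrix.mul_nonsing_inv _ (isUnit_iff_ne_zero.2 hd.ne'), Matrix.det_one]
  have h3 : 0 ≤ 6 * L ^ 3 := (abs_nonneg _).trans h1
  have h4 : M⁻¹.det ≤ 6 * L ^ 3 := (le_abs_self _).trans h1
  rw [inv_le_iff_one_le_mul₀ (by positivity)]
  nlinarith

/-- The data describing a stress-free joint that depends on the first coordinate only: a
representative `A₁`, the stretch `ρ` of the first coordinate, and the displacement `P` of the
shear. -/
structure JointProfile (A : V3 → Mat3) (a : V3 → V3) (A₁ : ℝ → Mat3) (ρ : ℝ → ℝ) (P : ℝ → V3) :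
    Prop where
  ae_eq : ∀ᵐ y, A y = A₁ (y 0)
  measurable_inv : ∀ i j, Measurable fun s => (A₁ s)⁻¹ i j
  bounded_inv : ∃ C, ∀ s i j, |(A₁ s)⁻¹ i j| ≤ C
  periodic : Function.Periodic A₁ 1
  det_mean_pos : 0 < (meanMat A).det
  stretch : IsStretch ρ
  det_eq : ∀ s, (A₁ s).det = ρ s * (meanMat A).det
  inv_row : ∀ s j, (A₁ s)⁻¹ 0 j = alphaVec A j / ρ s
  lipschitz : ∃ C, LipschitzWith C P
  periodic_shift : ∀ i ≠ 0, Function.Periodic (fun s => P s i) 1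
  potential_eq : ∀ (hP : Continuous P) y, a y = (meanMat A).mulVec (shear stretch.homeo P hP y)

theorem alphaVec_apply (A : V3 → Mat3) (j : Fin 3) : alphaVec A j = (meanMat A)⁻¹ 0 j := by
  simp [alphaVec, e1]

/-- With only the zeroth column varying, applying `Ā⁻¹` to the potential leaves the constant
directions untouched and replaces the first coordinate by a primitive. The density of this primitive
is the determinant ratio, because the first row of `Ā⁻¹` consists of the constant cofactors divided
by `det Ā`. -/
theorem exists_jointProfile {A : V3 → Mat3} (hA : IsPeriodicStressFreeJoint A)
    (hA1 : ∃ A₁ : ℝ → Mat3, ∀ᵐ y : V3, A y = A₁ (y 0)) {a : V3 → V3} (ha : IsPotential a A)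
    (ha0 : a 0 = 0) : ∃ A₁ ρ P, JointProfile A a A₁ ρ P := by
  obtain ⟨L, hL⟩ := hA.bounds
  obtain ⟨c₀, N, hcm, hcb, hcp, hc, hN, hpot⟩ := potential_structure ha ha0 hA.periodic
    (hL.mono fun y hy i j => (hy.2 i j).1) hA1
  -- make the determinant bounded below everywhere
  set δ : ℝ := (6 * L ^ 3 + 1)⁻¹ with hδ
  have hA₀ : ∀ᵐ y, A y = N.updateCol 0 fun i => c₀ i (y 0) := by
    filter_upwards [hc, hN] with y h1 h2
    ext i j
    by_cases hj : j = 0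
    · subst hj; simp [h1 i]
    · simp [hj, h2 i j hj]
  have hL0 : 0 ≤ L := by
    obtain ⟨y, hy⟩ := hL.exists
    exact (abs_nonneg _).trans (hy.2 0 0).1
  have hδ0 : 0 < δ := by positivity
  have hdet₀ : ∀ᵐ s, δ ≤ (N.updateCol 0 fun i => c₀ i s).det :=
    ae_of_ae_comp_fst (p := fun s => δ ≤ (N.updateCol 0 fun i => c₀ i s).det) (by
      filter_upwards [hL, hA₀] with y h1 h2
      rw [← h2]
      exact det_lower_bound h1.1 fun i j => (h1.2 i j).2)
  obtain ⟨s₀, hs₀⟩ := hdet₀.exists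
  classical
  obtain ⟨c, hcm, hcb, hcp, hcc, hdet⟩ : ∃ c : Fin 3 → ℝ → ℝ, (∀ i, Measurable (c i)) ∧
      (∀ i s, |c i s| ≤ L) ∧ (∀ i, Function.Periodic (c i) 1) ∧
      (∀ᵐ s, ∀ i, c₀ i s = c i s) ∧ ∀ s, δ ≤ (N.updateCol 0 fun i => c i s).det := by
    have hS : MeasurableSet {s | δ ≤ (N.updateCol 0 fun i => c₀ i s).det} := by
      simp only [det_updateCol_zero]
      exact measurableSet_le measurable_const (by fun_prop)
    -- On the null set where the determinant is too small the column is frozen at its value at the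
    -- good point `s₀`. That set is periodic, so periodicity survives.
    refine ⟨fun i s => if δ ≤ (N.updateCol 0 fun i => c₀ i s).det then c₀ i s else c₀ i s₀,
      fun i => Measurable.ite hS (hcm i) measurable_const, fun i s => ?_, fun i s => ?_, ?_,
      fun s => ?_⟩
    · dsimp only; split_ifs <;> exact hcb i _
    · simp only [fun i => hcp i s]
    · exact hdet₀.mono fun s hs i => by simp only [if_pos hs]
    · by_cases hs : δ ≤ (N.updateCol 0 fun i => c₀ i s).det
      · simpa only [if_pos hs] using hs
      · simpa only [if_neg hs] using hs₀
  have hprim : ∀ i, primitive (c₀ i) = primitive (c i) := fun i => by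
    funext s
    exact intervalIntegral.integral_congr_ae (hcc.mono fun t ht _ => ht i)
  simp only [hprim] at hpot
  have hAc : ∀ᵐ y, A y = N.updateCol 0 fun i => c i (y 0) := by
    filter_upwards [hA₀, ae_comp_fst hcc] with y h1 h2
    simpa only [h2] using h1
  -- the mean of `A`
  have hmean : meanMat A = N.updateCol 0 fun i => primitive (c i) 1 := by
    ext i j
    rw [meanMat, Matrix.of_apply, mean_congr (hAc.mono fun y hy => by rw [hy])]
    by_cases hj : j = 0
    · subst hj
      simp only [Matrix.updateCol_self]
      exact mean_fst (hcm i)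
    · simp only [Matrix.updateCol_apply, hj, if_false, mean]
      simp
  -- At `s = 1` this says that the mean of the determinants is the determinant of the mean, which
  -- gives the positivity of `det Ā` below.
  have hdetlin : ∀ s, primitive (fun t => (N.updateCol 0 fun i => c i t).det) s =
      (N.updateCol 0 fun i => primitive (c i) s).det := fun s => by
    simp only [det_updateCol_zero]
    exact primitive_linear hcm hcb (N.adjugate 0) s
  have hdm : Measurable fun t => (N.updateCol 0 fun i => c i t).det := by
    simp only [det_updateCol_zero]; fun_prop
  obtain ⟨D, hD⟩ : ∃ D, ∀ s, (N.updateCol 0 fun i => c i s).det ≤ D := by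
    refine ⟨∑ i, |N.adjugate 0 i| * L, fun s => ?_⟩
    rw [det_updateCol_zero]
    refine Finset.sum_le_sum fun i _ => (le_abs_self _).trans ?_
    rw [abs_mul]
    exact mul_le_mul_of_nonneg_left (hcb i s) (abs_nonneg _)
  have hpos : 0 < (meanMat A).det := by
    rw [hmean, ← hdetlin, primitive]
    have hi := intervalIntegrable_of_bounded hdm (C := D) (fun s => by
      rw [abs_of_nonneg (hδ0.le.trans (hdet s))]; exact hD s) 0 1
    have := intervalIntegral.integral_mono_on (f := fun _ => δ) zero_le_one (by simp) hi
      fun x _ => hdet x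
    simp only [intervalIntegral.integral_const, sub_zero, one_smul] at this
    linarith
  have hunit : IsUnit (meanMat A).det := isUnit_iff_ne_zero.2 hpos.ne'
  have hrow : ∀ i, (meanMat A)⁻¹ 0 i = N.adjugate 0 i / (meanMat A).det := fun i => by
    rw [hmean, inv_updateCol_zero]
  have hρeq : ∀ s, ∑ j, (meanMat A)⁻¹ 0 j * c j s =
      (N.updateCol 0 fun i => c i s).det / (meanMat A).det := fun s => by
    rw [det_updateCol_zero, Finset.sum_div]
    exact Finset.sum_congr rfl fun j _ => by rw [hrow]; ring
  set P : ℝ → V3 := fun s i => ∑ j, (meanMat A)⁻¹ i j * primitive (c j) s with hPdef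
  -- The primitive over one period is the zeroth column of `Ā`, that is `Ā e₁`. This yields both the
  -- unit mean of `ρ` and the periodicity of the shear components.
  have hP1 : P 1 = e1 := by
    have : P 1 = (meanMat A)⁻¹.mulVec ((meanMat A).mulVec e1) := by
      funext i
      simp only [hPdef, Matrix.mulVec, dotProduct]
      refine Finset.sum_congr rfl fun j _ => ?_
      congr 1
      rw [Fin.sum_univ_three]
      simp [e1, hmean]
    rw [this, Matrix.mulVec_mulVec, Matrix.nonsing_inv_mul _ hunit, Matrix.one_mulVec]
  have hst : IsStretch fun s => ∑ j, (meanMat A)⁻¹ 0 j * c j s := by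
    refine ⟨by fun_prop, ⟨δ / (meanMat A).det, D / (meanMat A).det, by positivity, fun s => ?_⟩,
      fun s => ?_, ?_⟩
    · rw [hρeq]
      exact ⟨by gcongr; exact hdet s, by gcongr; exact hD s⟩
    · simp only [fun i => hcp i s]
    · have := primitive_linear hcm hcb ((meanMat A)⁻¹ 0) 1
      rw [primitive] at this
      rw [this]
      have := congrFun hP1 0
      simpa [e1, hPdef] using this
  refine ⟨fun s => N.updateCol 0 fun i => c i s, fun s => ∑ j, (meanMat A)⁻¹ 0 j * c j s, P,
    ⟨hAc, ?_, ?_, ?_, hpos, hst, ?_, ?_, ?_, ?_, ?_⟩⟩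
  · exact measurable_inv_updateCol_zero N hcm
  · have hsum : ∀ i j, |N i j| ≤ ∑ i, ∑ j, |N i j| := fun i j =>
      (Finset.single_le_sum (f := fun j => |N i j|) (fun _ _ => abs_nonneg _)
        (Finset.mem_univ j)).trans
      (Finset.single_le_sum (f := fun i => ∑ j, |N i j|)
        (fun _ _ => Finset.sum_nonneg fun _ _ => abs_nonneg _) (Finset.mem_univ i))
    have hs0 : 0 ≤ ∑ i, ∑ j, |N i j| := (abs_nonneg _).trans (hsum 0 0)
    refine ⟨_, fun s i j => abs_inv_apply_le (B := 1 + L + ∑ i, ∑ j, |N i j|) (by linarith)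
      (fun i j => ?_) hδ0 (hdet s) i j⟩
    rw [Matrix.updateCol_apply]
    split_ifs
    · linarith [hcb i s]
    · linarith [hsum i j]
  · intro s
    simp only [fun i => hcp i s]
  · intro s
    rw [hρeq, div_mul_cancel₀ _ hpos.ne']
  · intro s j
    rw [hρeq, alphaVec_apply, hrow, inv_updateCol_zero]
    have := (hδ0.trans_le (hdet s)).ne'
    field_simp
  · refine exists_lipschitzWith_pi fun i => ?_
    have hb : ∀ s, |∑ j, (meanMat A)⁻¹ i j * c j s| ≤ ∑ j, |(meanMat A)⁻¹ i j| * L := fun s =>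
      (Finset.abs_sum_le_sum_abs _ _).trans (Finset.sum_le_sum fun j _ => by
        rw [abs_mul]
        exact mul_le_mul_of_nonneg_left (hcb j s) (abs_nonneg _))
    have := lipschitzWith_primitive (by fun_prop) hb
    refine ⟨(∑ j, |(meanMat A)⁻¹ i j| * L).toNNReal, fun s t => ?_⟩
    have := this s t
    rwa [primitive_linear hcm hcb ((meanMat A)⁻¹ i) s,
      primitive_linear hcm hcb ((meanMat A)⁻¹ i) t] at this
  · intro i hi s
    have h1 : ∀ j, primitive (c j) (s + 1) = primitive (c j) s + primitive (c j) 1 := fun j =>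
      primitive_add_one (hcm j) (hcb j) (hcp j) s
    have h2 := congrFun hP1 i
    simp only [hPdef] at h2 ⊢
    simp only [h1, mul_add, Finset.sum_add_distrib, h2]
    simp [e1, hi]
  · intro hP y
    -- The zeroth component of `P` is the primitive of `ρ`, so the stretch is contained in `P` and
    -- only the other two coordinates have to be added.
    have h1 : shear hst.homeo P hP y = P (y 0) + fun i => if i = 0 then 0 else y i := by
      funext i
      rw [shear_apply]
      by_cases hi : i = 0
      · subst hi
        simp only [if_true, Pi.add_apply, add_zero, IsStretch.homeo_apply]
        exact primitive_linear hcm hcb ((meanMat A)⁻¹ 0) (y 0)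
      · simp [hi, add_comm]
    have h2 : (meanMat A).mulVec (P (y 0)) = fun i => primitive (c i) (y 0) := by
      have : P (y 0) = (meanMat A)⁻¹.mulVec fun i => primitive (c i) (y 0) := rfl
      rw [this, Matrix.mulVec_mulVec, Matrix.mul_nonsing_inv _ hunit, Matrix.one_mulVec]
    rw [h1, Matrix.mulVec_add, h2]
    funext i
    rw [hpot]
    simp [hmean, Matrix.mulVec, dotProduct, Fin.sum_univ_three, Matrix.updateCol_apply]
    ring

/-! ### The bilipschitz chart and the change of variables it induces. -/

namespace JointProfile

variable {A : V3 → Mat3} {a : V3 → V3} {A₁ : ℝ → Mat3} {ρ : ℝ → ℝ} {P : ℝ → V3}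

theorem continuous_shift (h : JointProfile A a A₁ ρ P) : Continuous P := by
  obtain ⟨C, hC⟩ := h.lipschitz
  exact hC.continuous

/-- The bilipschitz map `Ā⁻¹ a`. -/
def chart (h : JointProfile A a A₁ ρ P) : V3 ≃ₜ V3 :=
  shear h.stretch.homeo P h.continuous_shift

theorem chart_symm_zero (h : JointProfile A a A₁ ρ P) (y : V3) :
    h.chart.symm y 0 = h.stretch.homeo.symm (y 0) := by
  simp [chart, shear_symm_apply]

theorem potential_eq_chart (h : JointProfile A a A₁ ρ P) (y : V3) :
    a y = (meanMat A).mulVec (h.chart y) := h.potential_eq _ y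

theorem isUnit_det (h : JointProfile A a A₁ ρ P) : IsUnit (meanMat A).det :=
  isUnit_iff_ne_zero.2 h.det_mean_pos.ne'

theorem lipschitz_chart (h : JointProfile A a A₁ ρ P) : ∃ C, LipschitzWith C h.chart := by
  obtain ⟨C, hC⟩ := h.lipschitz
  obtain ⟨D, hD⟩ := h.stretch.exists_abs_le
  refine exists_lipschitzWith_pi fun i => ?_
  by_cases hi : i = 0
  · subst hi
    exact ⟨_, (lipschitzWith_primitive h.stretch.measurable hD).comp (LipschitzWith.eval 0)⟩
  · have e1 : LipschitzWith 1 fun y : V3 => y i := LipschitzWith.eval i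
    have e2 : LipschitzWith (C * 1) fun y : V3 => P (y 0) :=
      hC.comp (LipschitzWith.eval (α := fun _ : Fin 3 => ℝ) 0)
    have e3 : LipschitzWith (1 * (C * 1)) fun y : V3 => P (y 0) i :=
      (LipschitzWith.eval (α := fun _ : Fin 3 => ℝ) i).comp e2
    have e4 : (fun y => h.chart y i) = fun y => y i + P (y 0) i := by
      funext y
      simp [chart, shear_apply, hi]
    rw [e4]
    exact ⟨_, e1.add e3⟩

theorem lipschitz_chart_symm (h : JointProfile A a A₁ ρ P) :
    ∃ C, LipschitzWith C h.chart.symm := by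
  obtain ⟨C, hC⟩ := h.lipschitz
  obtain ⟨D, hD⟩ := h.stretch.lipschitz_homeo_symm
  have e0 : LipschitzWith (D * 1) fun y : V3 => h.stretch.homeo.symm (y 0) :=
    hD.comp (LipschitzWith.eval (α := fun _ : Fin 3 => ℝ) 0)
  refine exists_lipschitzWith_pi fun i => ?_
  by_cases hi : i = 0
  · subst hi
    simp only [h.chart_symm_zero]
    exact ⟨_, e0⟩
  · have e1 : LipschitzWith 1 fun y : V3 => y i := LipschitzWith.eval i
    have e3 : LipschitzWith (1 * (C * (D * 1))) fun y : V3 => P (h.stretch.homeo.symm (y 0)) i :=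
      (LipschitzWith.eval (α := fun _ : Fin 3 => ℝ) i).comp (hC.comp e0)
    have e4 : (fun y => h.chart.symm y i) =
        fun y => y i - P (h.stretch.homeo.symm (y 0)) i := by
      funext y
      simp [chart, shear_symm_apply, hi]
    rw [e4]
    exact ⟨_, e1.sub e3⟩

theorem exists_lipschitzWith_mulVec (M : Mat3) : ∃ C, LipschitzWith C M.mulVec :=
  ⟨_, (LinearMap.toContinuousLinearMap M.mulVecLin).lipschitz⟩

theorem lipschitz_potential (h : JointProfile A a A₁ ρ P) : ∃ C, LipschitzWith C a := by
  obtain ⟨C, hC⟩ := h.lipschitz_chart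
  obtain ⟨D, hD⟩ := exists_lipschitzWith_mulVec (meanMat A)
  have e : a = (meanMat A).mulVec ∘ h.chart := funext h.potential_eq_chart
  rw [e]
  exact ⟨_, hD.comp hC⟩

theorem inverse_potential (h : JointProfile A a A₁ ρ P) (y : V3) :
    h.chart.symm ((meanMat A)⁻¹.mulVec (a y)) = y := by
  rw [h.potential_eq_chart, Matrix.mulVec_mulVec, Matrix.nonsing_inv_mul _ h.isUnit_det,
    Matrix.one_mulVec, Homeomorph.symm_apply_apply]

theorem potential_inverse (h : JointProfile A a A₁ ρ P) (y : V3) :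
    a (h.chart.symm y) = (meanMat A).mulVec y := by
  rw [h.potential_eq_chart, Homeomorph.apply_symm_apply]

theorem antilipschitz (h : JointProfile A a A₁ ρ P) : ∃ C, AntilipschitzWith C a := by
  obtain ⟨C, hC⟩ := h.lipschitz_chart_symm
  obtain ⟨D, hD⟩ := exists_lipschitzWith_mulVec (meanMat A)⁻¹
  exact ⟨_, (hC.comp hD).to_rightInverse h.inverse_potential⟩

theorem bijective (h : JointProfile A a A₁ ρ P) : Function.Bijective a := by
  refine ⟨Function.LeftInverse.injective (f := a)
    (g := fun z => h.chart.symm ((meanMat A)⁻¹.mulVec z)) h.inverse_potential, fun y => ?_⟩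
  refine ⟨h.chart.symm ((meanMat A)⁻¹.mulVec y), ?_⟩
  rw [h.potential_inverse, Matrix.mulVec_mulVec, Matrix.mul_nonsing_inv _ h.isUnit_det,
    Matrix.one_mulVec]

theorem pullPoint_eq (h : JointProfile A a A₁ ρ P) (y : V3) : pullPoint a A y = h.chart.symm y := by
  rw [pullPoint, ← h.potential_inverse]
  exact Function.leftInverse_invFun h.bijective.1 _

theorem chart_add_int (h : JointProfile A a A₁ ρ P) (k : Fin 3 → ℤ) (y : V3) :
    h.chart (y + fun i => (k i : ℝ)) = h.chart y + fun i => (k i : ℝ) := by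
  funext i
  by_cases hi : i = 0
  · subst hi
    simpa [chart, shear_apply] using h.stretch.homeo_add_int (y 0) (k 0)
  · have := (h.periodic_shift i hi).int_mul (k 0) (y 0)
    simp only [mul_one] at this
    simp only [chart, shear_apply, if_neg hi, Pi.add_apply, this]
    ring

theorem measurePreserving_chart (h : JointProfile A a A₁ ρ P) : MeasurePreserving h.chart
    (volume.withDensity fun y => ENNReal.ofReal (ρ (y 0))) volume :=
  measurePreserving_shear h.stretch P h.continuous_shift

/-- The inverse chart sends Lebesgue measure to `ρ dy`, which is absolutely continuous, so null sets
pull back to null sets. -/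
theorem ae_chart_symm (h : JointProfile A a A₁ ρ P) {p : V3 → Prop} (hp : ∀ᵐ y, p y) :
    ∀ᵐ y, p (h.chart.symm y) := by
  have h1 : MeasurePreserving h.chart.toMeasurableEquiv.symm volume
      (volume.withDensity fun y => ENNReal.ofReal (ρ (y 0))) :=
    MeasurePreserving.symm h.chart.toMeasurableEquiv h.measurePreserving_chart
  exact h1.quasiMeasurePreserving.ae ((withDensity_absolutelyContinuous _ _).ae_le hp)

/-- Transformation of cell means under the chart. -/
theorem mean_comp_chart_symm (h : JointProfile A a A₁ ρ P) {f : V3 → ℝ} (hf : IsCellPeriodic f) :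
    mean (fun y => f (h.chart.symm y)) = mean fun y => f y * ρ (y 0) :=
  mean_comp_symm h.chart.toMeasurableEquiv h.chart_add_int
    (h.stretch.measurable.comp (measurable_pi_apply 0)) (fun y => (h.stretch.pos _).le)
    h.measurePreserving_chart fun k => by
      filter_upwards [hf k, isCellPeriodic_fst h.stretch.periodic k] with y h1 h2
      exact congrArg₂ (· * ·) h1 h2

theorem mean_comp_homeo_symm (h : JointProfile A a A₁ ρ P) {f : ℝ → ℝ}
    (hf : Function.Periodic f 1) :
    mean (fun y => f (h.stretch.homeo.symm (y 0))) = mean fun y => f (y 0) * ρ (y 0) := by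
  rw [← h.mean_comp_chart_symm (isCellPeriodic_fst hf)]
  simp only [h.chart_symm_zero]

theorem jacFactor_eq (h : JointProfile A a A₁ ρ P) :
    ∀ᵐ y, jacFactor a A y = (ρ (h.stretch.homeo.symm (y 0)))⁻¹ := by
  filter_upwards [h.ae_chart_symm h.ae_eq] with y hy
  rw [jacFactor, h.pullPoint_eq, hy, h.det_eq, mul_inv, mul_assoc,
    inv_mul_cancel₀ h.det_mean_pos.ne', mul_one, h.chart_symm_zero]

theorem hatModulus_eq (h : JointProfile A a A₁ ρ P) {f f' : ℝ → ℝ} (hf : ∀ᵐ s, f s = f' s) :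
    ∀ᵐ y, hatModulus f a A y =
      f' (h.stretch.homeo.symm (y 0)) / ρ (h.stretch.homeo.symm (y 0)) := by
  filter_upwards [h.jacFactor_eq, h.ae_chart_symm (ae_comp_fst hf)] with y h1 h2
  rw [hatModulus, h1, h.pullPoint_eq, h2, h.chart_symm_zero, div_eq_mul_inv]

theorem alphaVec_ne_zero (h : JointProfile A a A₁ ρ P) : alphaVec A ≠ 0 := by
  intro h0
  have h1 : (1 : Mat3) 0 0 = 0 := by
    rw [← Matrix.nonsing_inv_mul _ h.isUnit_det, Matrix.mul_apply]
    refine Finset.sum_eq_zero fun j _ => ?_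
    rw [← alphaVec_apply, h0]; simp
  simp at h1

end JointProfile

/-! ### Isotropic quadratic forms -/

/-- The stress `𝕃 F` of the isotropic form with Lamé constants `l` and `m`. -/
def stress (l m : ℝ) (F : Mat3) : Mat3 := (l * F.trace) • (1 : Mat3) + (2 * m) • symPart F

theorem polar_isoForm (l m : ℝ) (F G : Mat3) :
    polar (isoForm l m) F G = ∑ i, ∑ j, stress l m F i j * G i j := by
  simp [polar, isoForm, stress, symPart, Matrix.trace, Fin.sum_univ_three, Matrix.one_apply]
  ring

theorem polar_isoForm_eq (l m : ℝ) (F G : Mat3) : polar (isoForm l m) F G =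
    l * F.trace * G.trace + 2 * m * ∑ i, ∑ j, symPart F i j * symPart G i j := by
  simp [polar, isoForm, symPart, Matrix.trace, Fin.sum_univ_three]
  ring

theorem polar_self (l m : ℝ) (F : Mat3) : polar (isoForm l m) F F = isoForm l m F := by
  rw [polar_isoForm_eq, isoForm]
  simp only [pow_two]
  ring

theorem isoForm_add (l m : ℝ) (F G : Mat3) : isoForm l m (F + G) =
    polar (isoForm l m) F F + 2 * polar (isoForm l m) F G + polar (isoForm l m) G G := by
  rw [polar_self, polar_self, polar]
  ring

theorem polar_comm (l m : ℝ) (F G : Mat3) :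
    polar (isoForm l m) F G = polar (isoForm l m) G F := by
  simp only [polar_isoForm_eq, mul_comm (symPart F _ _)]
  ring

theorem polar_add_left (l m : ℝ) (F F' G : Mat3) : polar (isoForm l m) (F + F') G =
    polar (isoForm l m) F G + polar (isoForm l m) F' G := by
  simp [polar_isoForm_eq, symPart, Matrix.trace, Fin.sum_univ_three]
  ring

theorem polar_smul_left (l m c : ℝ) (F G : Mat3) :
    polar (isoForm l m) (c • F) G = c * polar (isoForm l m) F G := by
  simp [polar_isoForm_eq, symPart, Matrix.trace, Fin.sum_univ_three]
  ring

theorem symPart_symPart (F : Mat3) : symPart (symPart F) = symPart F := by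
  ext i j
  simp [symPart]
  ring

theorem trace_symPart (F : Mat3) : (symPart F).trace = F.trace := by
  simp [symPart, Matrix.trace, Fin.sum_univ_three]
  ring

theorem polar_symPart_left (l m : ℝ) (F G : Mat3) :
    polar (isoForm l m) (symPart F) G = polar (isoForm l m) F G := by
  rw [polar_isoForm_eq, polar_isoForm_eq, symPart_symPart, trace_symPart]

theorem isoForm_lower_bound {l m c : ℝ} (hm : c ≤ m) (hl : c ≤ l + 2 / 3 * m) (hc : 0 < c)
    (F : Mat3) : c * ∑ i, ∑ j, symPart F i j ^ 2 ≤ isoForm l m F := by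
  -- Splitting into trace and deviatoric part diagonalizes the form: the bulk modulus weights the
  -- squared trace and `2 m` the deviatoric part, while the squared norm of the symmetric part
  -- carries one third of the squared trace.
  have key : isoForm l m F - c * ∑ i, ∑ j, symPart F i j ^ 2 =
      (l + 2 / 3 * m - c / 3) * F.trace ^ 2 +
      (2 * m - c) * ∑ i, ∑ j, (symPart F - (F.trace / 3) • (1 : Mat3)) i j ^ 2 := by
    simp [isoForm, symPart, Matrix.trace, Fin.sum_univ_three, Matrix.one_apply]
    ring
  have h1 : 0 ≤ (l + 2 / 3 * m - c / 3) * F.trace ^ 2 :=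
    mul_nonneg (by linarith) (sq_nonneg _)
  have h2 : 0 ≤ (2 * m - c) * ∑ i, ∑ j, (symPart F - (F.trace / 3) • (1 : Mat3)) i j ^ 2 :=
    mul_nonneg (by linarith) (Finset.sum_nonneg fun _ _ => Finset.sum_nonneg fun _ _ => sq_nonneg _)
  linarith

theorem isoForm_smul (l m c : ℝ) (F : Mat3) : isoForm l m F * c = isoForm (l * c) (m * c) F := by
  simp only [isoForm]; ring

theorem isoForm_nonneg {l m c : ℝ} (hm : c ≤ m) (hl : c ≤ l + 2 / 3 * m) (hc : 0 < c)
    (F : Mat3) : 0 ≤ isoForm l m F :=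
  (mul_nonneg hc.le (Finset.sum_nonneg fun _ _ => Finset.sum_nonneg fun _ _ => sq_nonneg _)).trans
    (isoForm_lower_bound hm hl hc F)

theorem symPart_eq_zero_of_isoForm {l m c : ℝ} (hm : c ≤ m) (hl : c ≤ l + 2 / 3 * m) (hc : 0 < c)
    {F : Mat3} (h : isoForm l m F = 0) : symPart F = 0 := by
  have h1 := isoForm_lower_bound hm hl hc F
  rw [h] at h1
  have hnn : ∀ i j, 0 ≤ symPart F i j ^ 2 := fun _ _ => sq_nonneg _
  have h2 : ∑ i, ∑ j, symPart F i j ^ 2 = 0 :=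
    le_antisymm (by nlinarith)
      (Finset.sum_nonneg fun i _ => Finset.sum_nonneg fun j _ => hnn i j)
  ext i j
  have h3 := (Finset.sum_eq_zero_iff_of_nonneg fun i _ => Finset.sum_nonneg fun j _ => hnn i j).1
    h2 i (Finset.mem_univ i)
  have h4 := (Finset.sum_eq_zero_iff_of_nonneg fun j _ => hnn i j).1 h3 j (Finset.mem_univ j)
  simpa using h4

/-! ### Profiles -/

/-- Bounded measurable periodic functions on the line. -/
structure IsProfile (f : ℝ → ℝ) : Prop where
  measurable : Measurable f
  bounded : ∃ C, ∀ s, |f s| ≤ C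
  periodic : Function.Periodic f 1

namespace IsProfile

variable {f g : ℝ → ℝ}

theorem const (c : ℝ) : IsProfile fun _ => c := ⟨measurable_const, ⟨|c|, fun _ => le_rfl⟩, fun _ => rfl⟩

theorem add (hf : IsProfile f) (hg : IsProfile g) : IsProfile fun s => f s + g s := by
  obtain ⟨C, hC⟩ := hf.bounded
  obtain ⟨D, hD⟩ := hg.bounded
  exact ⟨hf.measurable.add hg.measurable,
    ⟨C + D, fun s => (abs_add_le _ _).trans (add_le_add (hC s) (hD s))⟩,
    fun s => by simp only [hf.periodic s, hg.periodic s]⟩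

theorem mul (hf : IsProfile f) (hg : IsProfile g) : IsProfile fun s => f s * g s := by
  obtain ⟨C, hC⟩ := hf.bounded
  obtain ⟨D, hD⟩ := hg.bounded
  refine ⟨hf.measurable.mul hg.measurable, ⟨C * D, fun s => ?_⟩,
    fun s => by simp only [hf.periodic s, hg.periodic s]⟩
  rw [abs_mul]
  exact mul_le_mul (hC s) (hD s) (abs_nonneg _) ((abs_nonneg _).trans (hC s))

theorem const_mul (hf : IsProfile f) (c : ℝ) : IsProfile fun s => c * f s := (const c).mul hf

theorem sub (hf : IsProfile f) (hg : IsProfile g) : IsProfile fun s => f s - g s := by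
  simpa [sub_eq_add_neg] using hf.add (hg.const_mul (-1))

theorem inv (hf : IsProfile f) {c : ℝ} (hc : 0 < c) (h : ∀ s, c ≤ f s) :
    IsProfile fun s => (f s)⁻¹ := by
  refine ⟨hf.measurable.inv, ⟨c⁻¹, fun s => ?_⟩, fun s => by simp only [hf.periodic s]⟩
  rw [abs_of_pos (inv_pos.2 (hc.trans_le (h s)))]
  gcongr
  exact h s

theorem div (hf : IsProfile f) (hg : IsProfile g) {c : ℝ} (hc : 0 < c) (h : ∀ s, c ≤ g s) :
    IsProfile fun s => f s / g s := by
  simpa [div_eq_mul_inv] using hf.mul (hg.inv hc h)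

theorem sum {ι : Type*} {t : Finset ι} {F : ι → ℝ → ℝ} (h : ∀ i ∈ t, IsProfile (F i)) :
    IsProfile fun s => ∑ i ∈ t, F i s := by
  classical
  induction t using Finset.induction_on with
  | empty => simpa using const 0
  | insert i t hi ih =>
    simp only [Finset.sum_insert hi]
    exact (h i (Finset.mem_insert_self i t)).add
      (ih fun j hj => h j (Finset.mem_insert_of_mem hj))

theorem measurable_fst (hf : IsProfile f) : Measurable fun y : V3 => f (y 0) :=
  hf.measurable.comp (measurable_pi_apply 0)

theorem memLp_mul (hf : IsProfile f) {u : V3 → ℝ} {p : ENNReal}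
    (hu : MemLp u p (volume.restrict unitCell)) :
    MemLp (fun y => f (y 0) * u y) p (volume.restrict unitCell) := by
  obtain ⟨C, hC⟩ := hf.bounded
  refine MemLp.of_le_mul (c := C) hu
    (hf.measurable_fst.aestronglyMeasurable.mul hu.aestronglyMeasurable)
    (.of_forall fun y => ?_)
  rw [norm_mul]
  exact mul_le_mul_of_nonneg_right (hC (y 0)) (norm_nonneg _)

theorem memLp (hf : IsProfile f) (p : ENNReal) :
    MemLp (fun y : V3 => f (y 0)) p (volume.restrict unitCell) := by
  simpa using hf.memLp_mul (memLp_const (1 : ℝ))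

theorem integrable_mul (hf : IsProfile f) {u : V3 → ℝ}
    (hu : Integrable u (volume.restrict unitCell)) :
    Integrable (fun y => f (y 0) * u y) (volume.restrict unitCell) :=
  memLp_one_iff_integrable.1 (hf.memLp_mul (memLp_one_iff_integrable.2 hu))

theorem integrable (hf : IsProfile f) :
    Integrable (fun y : V3 => f (y 0)) (volume.restrict unitCell) :=
  memLp_one_iff_integrable.1 (hf.memLp 1)

end IsProfile

/-- Square integrability of matrix fields on the cell. -/
def CellL2 (F : V3 → Mat3) : Prop :=
  ∀ i j, MemLp (fun y => F y i j) 2 (volume.restrict unitCell)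

namespace CellL2

variable {F G : V3 → Mat3}

theorem add (hF : CellL2 F) (hG : CellL2 G) : CellL2 fun y => F y + G y := fun i j =>
  (hF i j).add (hG i j)

theorem smul (hF : CellL2 F) (c : ℝ) : CellL2 fun y => c • F y := fun i j =>
  (hF i j).const_smul c

theorem sub (hF : CellL2 F) (hG : CellL2 G) : CellL2 fun y => F y - G y := fun i j =>
  (hF i j).sub (hG i j)

theorem const (M : Mat3) : CellL2 fun _ => M := fun i j => memLp_const (M i j)

theorem symPart (hF : CellL2 F) : CellL2 fun y => Laminate.symPart (F y) := fun i j =>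
  ((hF i j).add (hF j i)).const_smul (1 / 2 : ℝ)

theorem mul_profile (hF : CellL2 F) {T : ℝ → Mat3} (hT : ∀ i j, IsProfile fun s => T s i j) :
    CellL2 fun y => F y * T (y 0) := fun i j => by
  simp only [Matrix.mul_apply]
  refine memLp_finsetSum _ fun k _ => ?_
  simpa only [mul_comm] using (hT k j).memLp_mul (hF i k)

theorem congr (hF : CellL2 F) (h : ∀ᵐ y ∂volume.restrict unitCell, F y = G y) : CellL2 G :=
  fun i j => (memLp_congr_ae (h.mono fun y hy => by simp only [hy])).1 (hF i j)

theorem profile {T : ℝ → Mat3} (hT : ∀ i j, IsProfile fun s => T s i j) :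
    CellL2 fun y => T (y 0) := fun i j => (hT i j).memLp 2

end CellL2

/-! ### The energy inner product -/

/-- Lamé constants given by profiles for which the quadratic form is uniformly positive on
symmetric matrices. -/
structure IsModuli (l m : ℝ → ℝ) : Prop where
  lam : IsProfile l
  mu : IsProfile m
  pos : ∃ c, 0 < c ∧ ∀ s, c ≤ m s ∧ c ≤ l s + 2 / 3 * m s

theorem laminateForm_eq (l m : ℝ → ℝ) (y : V3) :
    laminateForm l m y = isoForm (l (y 0)) (m (y 0)) := rfl

section Inner

variable {l m : ℝ → ℝ} {F F' G G' : V3 → Mat3}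

theorem IsModuli.integrable_polar (h : IsModuli l m) (hF : CellL2 F) (hG : CellL2 G) :
    Integrable (fun y => polar (laminateForm l m y) (F y) (G y)) (volume.restrict unitCell) := by
  have e : (fun y => polar (laminateForm l m y) (F y) (G y)) = fun y =>
      ∑ i, ∑ j, (l (y 0) * (F y i i * G y j j) +
        2 * (m (y 0) * (symPart (F y) i j * symPart (G y) i j))) := by
    funext y
    simp only [laminateForm_eq, polar_isoForm_eq, Matrix.trace, Matrix.diag, Fin.sum_univ_three]
    ring
  rw [e]
  refine integrable_finsetSum _ fun i _ => integrable_finsetSum _ fun j _ => ?_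
  exact (h.lam.integrable_mul ((hF i i).integrable_mul (hG j j))).add
    ((h.mu.integrable_mul ((hF.symPart i j).integrable_mul (hG.symPart i j))).const_mul 2)

theorem innerQ_comm : innerQ (laminateForm l m) F G = innerQ (laminateForm l m) G F := by
  simp only [innerQ, laminateForm_eq, polar_comm _ _ (F _)]

theorem innerQ_congr {q : V3 → Mat3 → ℝ} (hF : ∀ᵐ y ∂volume.restrict unitCell, F y = F' y)
    (hG : ∀ᵐ y ∂volume.restrict unitCell, G y = G' y) : innerQ q F G = innerQ q F' G' :=
  integral_congr_ae (by filter_upwards [hF, hG] with y h1 h2; rw [h1, h2])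

theorem innerQ_symPart_left : innerQ (laminateForm l m) (fun y => symPart (F y)) G =
    innerQ (laminateForm l m) F G := by
  simp only [innerQ, laminateForm_eq, polar_symPart_left]

theorem innerQ_symPart_right : innerQ (laminateForm l m) F (fun y => symPart (G y)) =
    innerQ (laminateForm l m) F G := by
  rw [innerQ_comm, innerQ_symPart_left, innerQ_comm]

theorem IsModuli.innerQ_add_left (h : IsModuli l m) (hF : CellL2 F) (hF' : CellL2 F')
    (hG : CellL2 G) : innerQ (laminateForm l m) (fun y => F y + F' y) G =
      innerQ (laminateForm l m) F G + innerQ (laminateForm l m) F' G := by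
  rw [innerQ, innerQ, innerQ, mean, mean, mean,
    ← integral_add (h.integrable_polar hF hG) (h.integrable_polar hF' hG)]
  simp only [laminateForm_eq, polar_add_left]

theorem innerQ_smul_left (c : ℝ) : innerQ (laminateForm l m) (fun y => c • F y) G =
      c * innerQ (laminateForm l m) F G := by
  simp only [innerQ, laminateForm_eq, polar_smul_left, mean, integral_const_mul]

theorem IsModuli.innerQ_sub_left (h : IsModuli l m) (hF : CellL2 F) (hF' : CellL2 F')
    (hG : CellL2 G) : innerQ (laminateForm l m) (fun y => F y - F' y) G =
      innerQ (laminateForm l m) F G - innerQ (laminateForm l m) F' G := by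
  have := h.innerQ_add_left hF (hF'.smul (-1)) hG
  rw [innerQ_smul_left] at this
  simp only [neg_smul, one_smul, ← sub_eq_add_neg] at this
  rw [this]; ring

theorem IsModuli.innerQ_add_right (h : IsModuli l m) (hF : CellL2 F) (hG : CellL2 G)
    (hG' : CellL2 G') : innerQ (laminateForm l m) F (fun y => G y + G' y) =
      innerQ (laminateForm l m) F G + innerQ (laminateForm l m) F G' := by
  rw [innerQ_comm, h.innerQ_add_left hG hG' hF, innerQ_comm, innerQ_comm (F := G')]

theorem IsModuli.innerQ_sub_right (h : IsModuli l m) (hF : CellL2 F) (hG : CellL2 G)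
    (hG' : CellL2 G') : innerQ (laminateForm l m) F (fun y => G y - G' y) =
      innerQ (laminateForm l m) F G - innerQ (laminateForm l m) F G' := by
  rw [innerQ_comm, h.innerQ_sub_left hG hG' hF, innerQ_comm, innerQ_comm (F := G')]

theorem IsModuli.innerQ_self_nonneg (h : IsModuli l m) : 0 ≤ innerQ (laminateForm l m) F F := by
  obtain ⟨c, hc, hb⟩ := h.pos
  refine integral_nonneg fun y => ?_
  change 0 ≤ polar (laminateForm l m y) (F y) (F y)
  simp only [laminateForm_eq, polar_self]
  exact isoForm_nonneg (hb _).1 (hb _).2 hc _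

theorem IsModuli.symPart_eq_zero (h : IsModuli l m) (hF : CellL2 F)
    (h0 : innerQ (laminateForm l m) F F = 0) :
    ∀ᵐ y ∂volume.restrict unitCell, symPart (F y) = 0 := by
  obtain ⟨c, hc, hb⟩ := h.pos
  have := (integral_eq_zero_iff_of_nonneg_ae (.of_forall fun y => by
    change 0 ≤ polar (laminateForm l m y) (F y) (F y)
    simp only [laminateForm_eq, polar_self]
    exact isoForm_nonneg (hb _).1 (hb _).2 hc _) (h.integrable_polar hF hF)).1 h0
  filter_upwards [this] with y hy
  rw [laminateForm_eq, polar_self] at hy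
  exact symPart_eq_zero_of_isoForm (hb _).1 (hb _).2 hc hy

theorem IsModuli.mean_energy_add (h : IsModuli l m) (hF : CellL2 F) (hG : CellL2 G) :
    mean (fun y => laminateForm l m y (F y + G y)) = innerQ (laminateForm l m) F F +
      2 * innerQ (laminateForm l m) F G + innerQ (laminateForm l m) G G := by
  have e : (fun y => laminateForm l m y (F y + G y)) = fun y =>
      polar (laminateForm l m y) (F y) (F y) + 2 * polar (laminateForm l m y) (F y) (G y) +
        polar (laminateForm l m y) (G y) (G y) := by
    funext y
    simp only [laminateForm_eq, isoForm_add]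
  rw [e, mean, integral_add, integral_add, integral_const_mul]
  · rfl
  · exact h.integrable_polar hF hF
  · exact (h.integrable_polar hF hG).const_mul 2
  · exact (h.integrable_polar hF hF).add ((h.integrable_polar hF hG).const_mul 2)
  · exact h.integrable_polar hG hG

end Inner

/-! ### Periodic Sobolev functions -/

theorem IsH1Per.locallyIntegrable {φ : V3 → V3} {Φ : V3 → Mat3} (h : IsH1Per φ Φ) (i : Fin 3) :
    LocallyIntegrable fun y => φ y i := (h.memL2 i).locallyIntegrable one_le_two

theorem IsH1Per.locallyIntegrable_deriv {φ : V3 → V3} {Φ : V3 → Mat3} (h : IsH1Per φ Φ)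
    (i j : Fin 3) : LocallyIntegrable fun y => Φ y i j :=
  (h.memL2_deriv i j).locallyIntegrable one_le_two

theorem IsH1Per.sub {φ ψ : V3 → V3} {Φ Ψ : V3 → Mat3} (h : IsH1Per φ Φ) (h' : IsH1Per ψ Ψ) :
    IsH1Per (fun y => φ y - ψ y) fun y => Φ y - Ψ y where
  periodic k := by
    filter_upwards [h.periodic k, h'.periodic k] with y h1 h2
    rw [h1, h2]
  memL2 i K hK := (h.memL2 i K hK).sub (h'.memL2 i K hK)
  memL2_deriv i j K hK := (h.memL2_deriv i j K hK).sub (h'.memL2_deriv i j K hK)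
  weak_deriv i j := (h.weak_deriv i j).sub (h'.weak_deriv i j) (h.locallyIntegrable i)
    (h'.locallyIntegrable i) (h.locallyIntegrable_deriv i j) (h'.locallyIntegrable_deriv i j)

theorem IsH1Per.integrable_cell {φ : V3 → V3} {Φ : V3 → Mat3} (h : IsH1Per φ Φ) (i : Fin 3) :
    Integrable (fun y => φ y i) (volume.restrict unitCell) :=
  (h.memL2 i).memLp_cell.integrable one_le_two

theorem IsH1PerZero.sub {φ ψ : V3 → V3} {Φ Ψ : V3 → Mat3} (h : IsH1PerZero φ Φ)
    (h' : IsH1PerZero ψ Ψ) : IsH1PerZero (fun y => φ y - ψ y) fun y => Φ y - Ψ y where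
  toIsH1Per := h.toIsH1Per.sub h'.toIsH1Per
  mean_zero i := by
    have h1 := h.mean_zero i
    have h2 := h'.mean_zero i
    simp only [mean, Pi.sub_apply] at *
    rw [integral_sub (h.integrable_cell i) (h'.integrable_cell i), h1, h2, sub_zero]

theorem IsH1Per.cellL2 {φ : V3 → V3} {Φ : V3 → Mat3} (h : IsH1Per φ Φ) : CellL2 Φ :=
  fun i j => (h.memL2_deriv i j).memLp_cell

theorem IsH1Per.periodic_deriv {φ : V3 → V3} {Φ : V3 → Mat3} (h : IsH1Per φ Φ) :
    IsCellPeriodic Φ := fun k => by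
  have : ∀ i j, IsCellPeriodic fun y => Φ y i j := fun i j =>
    (h.weak_deriv i j).isCellPeriodic
      (fun k => (h.periodic k).mono fun y hy => congrFun hy i) (h.locallyIntegrable_deriv i j)
  filter_upwards [ae_all_iff.2 fun i => ae_all_iff.2 fun j => this i j k] with y hy
  ext i j
  exact hy i j

/-- For `j ≠ 0` the factor `σ (y 0)` is invariant in direction `j` and passes through the
integration; only for `j = 0` must it be constant. This asymmetry is what reduces equilibrium to a
condition on the normal stress. -/
theorem IsH1Per.mean_profile_mul {φ : V3 → V3} {Φ : V3 → Mat3} (h : IsH1Per φ Φ) (i j : Fin 3)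
    {σ : ℝ → ℝ} (hσ : IsProfile σ) (hj : j = 0 → ∃ c, ∀ s, σ s = c) :
    mean (fun y => σ (y 0) * Φ y i j) = 0 := by
  obtain ⟨C, hC⟩ := hσ.bounded
  refine mean_mul_weakPartial_eq_zero (σ := fun y => σ (y 0)) (h.weak_deriv i j)
    (h.locallyIntegrable i) (h.locallyIntegrable_deriv i j)
    (fun k => (h.periodic k).mono fun y hy => congrFun hy i) hσ.measurable_fst
    (fun y => hC (y 0)) (isCellPeriodic_fst hσ.periodic) fun t y => ?_
  by_cases hj0 : j = 0
  · obtain ⟨c, hc⟩ := hj hj0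
    rw [hc, hc]
  · simp [Ne.symm hj0]

/-- The mean-free primitive of a profile with vanishing mean. -/
def profileField (v : ℝ → V3) (y : V3) : V3 := fun i =>
  primitive (fun s => v s i) (y 0) - mean fun z => primitive (fun s => v s i) (z 0)

theorem isH1PerZero_profileField {v : ℝ → V3} (hv : ∀ i, IsProfile fun s => v s i)
    (h0 : ∀ i, mean (fun y => v (y 0) i) = 0) :
    IsH1PerZero (profileField v) fun y => Matrix.vecMulVec (v (y 0)) e1 := by
  -- Vanishing mean is exactly what makes the primitive periodic.
  have hp1 : ∀ i, primitive (fun s => v s i) 1 = 0 := fun i => by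
    rw [primitive, ← mean_fst (hv i).measurable, h0]
  have hprim : ∀ i, IsProfile (primitive fun s => v s i) := by
    intro i
    obtain ⟨C, hC⟩ := (hv i).bounded
    have hL := lipschitzWith_primitive (hv i).measurable hC
    have hper : Function.Periodic (primitive fun s => v s i) 1 := fun s => by
      rw [primitive_add_one (hv i).measurable hC (hv i).periodic, hp1, add_zero]
    refine ⟨hL.continuous.measurable, ?_, hper⟩
    obtain ⟨D, hD⟩ := (isCompact_Icc (a := (0 : ℝ)) (b := 1)).exists_bound_of_continuousOn
      hL.continuous.continuousOn
    refine ⟨D, fun s => ?_⟩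
    have h1 := hper.sub_int_mul_eq (x := s) ⌊s⌋
    rw [mul_one] at h1
    rw [← h1]
    exact hD _ ⟨Int.fract_nonneg s, (Int.fract_lt_one s).le⟩
  refine ⟨⟨fun k => ?_, fun i => ?_, fun i j => ?_, fun i j => ?_⟩, fun i => ?_⟩
  · refine .of_forall fun y => ?_
    funext i
    have := (hprim i).periodic.int_mul (k 0) (y 0)
    simp only [mul_one] at this
    simp only [profileField, Pi.add_apply, this]
  · have hq := (hprim i).sub (IsProfile.const (mean fun z => primitive (fun s => v s i) (z 0)))
    obtain ⟨D, hD⟩ := hq.bounded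
    exact memLpLoc_of_bounded hq.measurable_fst.aestronglyMeasurable
      (.of_forall fun y => hD (y 0)) 2
  · have hq := (hv i).mul (IsProfile.const (e1 j))
    obtain ⟨D, hD⟩ := hq.bounded
    exact memLpLoc_of_bounded hq.measurable_fst.aestronglyMeasurable
      (.of_forall fun y => hD (y 0)) 2
  · obtain ⟨C, hC⟩ := (hv i).bounded
    have h1 := isWeakPartial_primitive (hv i).measurable hC j
    have h2 := h1.sub (isWeakPartial_const (mean fun z => primitive (fun s => v s i) (z 0)) j)
      (locallyIntegrable_fst (hprim i).measurable (hprim i).bounded.choose_spec)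
      continuous_const.locallyIntegrable
      ((locallyIntegrable_fst (hv i).measurable hC).smul ((Pi.single j 1 : V3) 0))
      continuous_const.locallyIntegrable
    refine h2.congr (.of_forall fun y => rfl) (.of_forall fun y => ?_)
    rw [Matrix.vecMulVec_apply, e1, sub_zero, mul_comm]
    congr 1
    by_cases hj : j = 0
    · subst hj; rfl
    · simp [hj, Ne.symm hj]
  · simp only [profileField, mean]
    rw [integral_sub (hprim i).integrable (integrable_const _)]
    simp

/-! ### The Euler–Lagrange equation and correctors -/

theorem IsModuli.stress_profile {l m : ℝ → ℝ} (h : IsModuli l m) {F : ℝ → Mat3}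
    (hF : ∀ i j, IsProfile fun s => F s i j) (i j : Fin 3) :
    IsProfile fun s => stress (l s) (m s) (F s) i j := by
  have h1 : IsProfile fun s => (F s).trace := by
    simp only [Matrix.trace, Matrix.diag]
    exact IsProfile.sum fun i _ => hF i i
  have h2 : IsProfile fun s => symPart (F s) i j :=
    ((hF i j).add (hF j i)).const_mul (1 / 2)
  simp only [stress, Matrix.add_apply, Matrix.smul_apply, smul_eq_mul]
  exact ((h.lam.mul h1).mul (.const _)).add ((h.mu.const_mul 2).mul h2)

/-- A field depending on the first coordinate is in equilibrium if its normal stress is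
constant. -/
theorem IsModuli.innerQ_eq_zero {l m : ℝ → ℝ} (h : IsModuli l m) {T F : ℝ → Mat3}
    (hT : ∀ i j, IsProfile fun s => T s i j) (hF : ∀ i j, IsProfile fun s => F s i j)
    (hτ : ∀ i, ∃ c, ∀ s, ∑ k, stress (l s) (m s) (F s) i k * T s 0 k = c)
    {ψ : V3 → V3} {Ψ : V3 → Mat3} (hψ : IsH1Per ψ Ψ) :
    innerQ (laminateForm l m) (fun y => F (y 0)) (fun y => Ψ y * T (y 0)) = 0 := by
  have hσ : ∀ i j, IsProfile fun s => ∑ k, stress (l s) (m s) (F s) i k * T s j k := fun i j =>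
    IsProfile.sum fun k _ => (h.stress_profile hF i k).mul (hT j k)
  -- The transformation is moved from the test gradient to the stress; column `j` of `Ψ` then meets
  -- row `j` of `T`, and only row `0` enters the hypothesis `hτ`.
  have e : (fun y => polar (laminateForm l m y) (F (y 0)) (Ψ y * T (y 0))) = fun y =>
      ∑ i, ∑ j, (fun s => ∑ k, stress (l s) (m s) (F s) i k * T s j k) (y 0) * Ψ y i j := by
    funext y
    simp only [laminateForm_eq, polar_isoForm, Matrix.mul_apply, Fin.sum_univ_three]
    ring
  have hint : ∀ i j, Integrable (fun y : V3 => (fun s => ∑ k, stress (l s) (m s) (F s) i k *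
      T s j k) (y 0) * Ψ y i j) (volume.restrict unitCell) := fun i j =>
    (hσ i j).integrable_mul ((hψ.cellL2 i j).integrable one_le_two)
  rw [innerQ, e, mean, integral_finsetSum _ fun i _ => integrable_finsetSum _ fun j _ => hint i j]
  refine Finset.sum_eq_zero fun i _ => ?_
  rw [integral_finsetSum _ fun j _ => hint i j]
  refine Finset.sum_eq_zero fun j _ => ?_
  exact hψ.mean_profile_mul i j (hσ i j) fun hj => by subst hj; exact hτ i

section Corrector

variable {l m : ℝ → ℝ} {T : ℝ → Mat3} {G : Mat3} {φ ψ : V3 → V3} {Φ Ψ : V3 → Mat3}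

/-- Expand the quadratic energy around the equilibrium field; the cross term is the Euler–Lagrange
equation tested with `Ψ - Φ`. -/
theorem IsModuli.energy_eq (h : IsModuli l m) (hT : ∀ i j, IsProfile fun s => T s i j)
    (hφ : IsH1Per φ Φ)
    (hEL : ∀ ψ Ψ, IsH1Per ψ Ψ → innerQ (laminateForm l m) (fun y => G + Φ y * T (y 0))
      (fun y => Ψ y * T (y 0)) = 0) (hψ : IsH1Per ψ Ψ) :
    mean (fun y => laminateForm l m y (G + Ψ y * T (y 0))) =
      mean (fun y => laminateForm l m y (G + Φ y * T (y 0))) +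
      innerQ (laminateForm l m) (fun y => (Ψ y - Φ y) * T (y 0))
        (fun y => (Ψ y - Φ y) * T (y 0)) := by
  have hF : CellL2 fun y => G + Φ y * T (y 0) := (CellL2.const G).add (hφ.cellL2.mul_profile hT)
  have hD : CellL2 fun y => (Ψ y - Φ y) * T (y 0) := (hψ.cellL2.sub hφ.cellL2).mul_profile hT
  have e1 : (fun y => laminateForm l m y (G + Ψ y * T (y 0))) = fun y =>
      laminateForm l m y ((G + Φ y * T (y 0)) + (Ψ y - Φ y) * T (y 0)) := by
    funext y
    rw [sub_mul]
    congr 1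
    abel
  have e2 : mean (fun y => laminateForm l m y (G + Φ y * T (y 0))) =
      innerQ (laminateForm l m) (fun y => G + Φ y * T (y 0)) fun y => G + Φ y * T (y 0) := by
    simp only [innerQ, laminateForm_eq, polar_self]
  rw [e1, h.mean_energy_add hF hD, e2, hEL _ _ (hψ.sub hφ)]
  ring

theorem IsModuli.isCorrector (h : IsModuli l m) (hT : ∀ i j, IsProfile fun s => T s i j)
    (hφ : IsH1PerZero φ Φ)
    (hEL : ∀ ψ Ψ, IsH1Per ψ Ψ → innerQ (laminateForm l m) (fun y => G + Φ y * T (y 0))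
      (fun y => Ψ y * T (y 0)) = 0) :
    IsCorrector (laminateForm l m) (fun y => T (y 0)) G φ Φ :=
  ⟨hφ, fun ψ Ψ hψ => by
    rw [h.energy_eq hT hφ.toIsH1Per hEL hψ.toIsH1Per]
    linarith [h.innerQ_self_nonneg (F := fun y => (Ψ y - Φ y) * T (y 0))]⟩

/-- Equal energies force the quadratic remainder to vanish. Since the form sees only symmetric
parts, this alone does not identify the gradients. -/
theorem IsModuli.corrector_unique (h : IsModuli l m) (hT : ∀ i j, IsProfile fun s => T s i j)
    (hφ : IsH1PerZero φ Φ)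
    (hEL : ∀ ψ Ψ, IsH1Per ψ Ψ → innerQ (laminateForm l m) (fun y => G + Φ y * T (y 0))
      (fun y => Ψ y * T (y 0)) = 0)
    (hψ : IsCorrector (laminateForm l m) (fun y => T (y 0)) G ψ Ψ) :
    ∀ᵐ y ∂volume.restrict unitCell, symPart ((Ψ y - Φ y) * T (y 0)) = 0 := by
  refine h.symPart_eq_zero ((hψ.mem.cellL2.sub hφ.cellL2).mul_profile hT) ?_
  have h1 := h.energy_eq hT hφ.toIsH1Per hEL hψ.mem.toIsH1Per
  have h2 := hψ.minimal φ Φ hφ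
  exact le_antisymm (by linarith) h.innerQ_self_nonneg

theorem IsCorrector.congr {q q' : V3 → Mat3 → ℝ} {T T' : V3 → Mat3}
    (h : IsCorrector q T G φ Φ) (hq : ∀ᵐ y, ∀ F, q y F = q' y F) (hT : ∀ᵐ y, T y = T' y) :
    IsCorrector q' T' G φ Φ := by
  refine ⟨h.mem, fun ψ Ψ hψ => ?_⟩
  have e : ∀ Ψ : V3 → Mat3, mean (fun y => q' y (G + Ψ y * T' y)) =
      mean fun y => q y (G + Ψ y * T y) := fun Ψ => mean_congr (by
    filter_upwards [hq, hT] with y h1 h2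
    rw [h1, h2])
  rw [e, e]
  exact h.minimal ψ Ψ hψ

end Corrector

/-! ### Rigidity -/

theorem locallyIntegrable_mul_const {W : V3 → Mat3} (hW : ∀ i j, LocallyIntegrable fun y => W y i j)
    (T : Mat3) (i j : Fin 3) : LocallyIntegrable fun y => (W y * T) i j := by
  simp only [Matrix.mul_apply, Fin.sum_univ_three]
  have h : ∀ k, LocallyIntegrable fun y => W y i k * T k j := fun k => by
    have e : (fun y => W y i k * T k j) = T k j • fun y => W y i k := by
      funext y; simp [mul_comm]
    rw [e]
    exact (hW i k).smul (T k j)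
  exact ((h 0).add (h 1)).add (h 2)

theorem vec_eq_sum (v : V3) : v = ∑ k, v k • (Pi.single k 1 : V3) := by
  funext i
  fin_cases i <;> simp [Fin.sum_univ_three]

/-- Column `j` of `W T` is the derivative of `w` along column `j` of `T`, so the rigidity argument
can be run in this constant basis. -/
theorem IsH1Per.weak_deriv_col {w : V3 → V3} {W : V3 → Mat3} (hw : IsH1Per w W) (T : Mat3)
    (i j : Fin 3) {θ : V3 → ℝ} (hθ : IsTest θ) :
    ∫ y, w y i * fderiv ℝ θ y (fun k => T k j) = -∫ y, (W y * T) i j * θ y := by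
  have e : ∀ y, w y i * fderiv ℝ θ y (fun k => T k j) =
      ∑ k, T k j * (w y i * fderiv ℝ θ y (Pi.single k 1)) := fun y => by
    conv_lhs => rw [vec_eq_sum fun k => T k j]
    simp only [map_sum, map_smul, smul_eq_mul, Finset.mul_sum]
    exact Finset.sum_congr rfl fun k _ => by ring
  have e' : ∀ y, (W y * T) i j * θ y = ∑ k, T k j * (W y i k * θ y) := fun y => by
    simp only [Matrix.mul_apply, Finset.sum_mul]
    exact Finset.sum_congr rfl fun k _ => by ring
  simp only [e, e']
  rw [integral_finsetSum _ fun k _ =>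
      ((hθ.fderiv _).integrable_mul (hw.locallyIntegrable i)).const_mul _,
    integral_finsetSum _ fun k _ =>
      (hθ.integrable_mul (hw.locallyIntegrable_deriv i k)).const_mul _, ← Finset.sum_neg_distrib]
  refine Finset.sum_congr rfl fun k _ => ?_
  rw [integral_const_mul, integral_const_mul, isWeakPartial_iff.1 (hw.weak_deriv i k) θ hθ]
  ring

/-- A periodic mean-free field whose transformed gradient is skew-symmetric vanishes. -/
theorem IsH1PerZero.eq_zero_of_skew {w : V3 → V3} {W : V3 → Mat3} (hw : IsH1PerZero w W)
    {T : Mat3} (hT : IsUnit T.det) (h : ∀ᵐ y, symPart (W y * T) = 0) :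
    (∀ᵐ y, w y = 0) ∧ ∀ᵐ y, W y = 0 := by
  have hE := locallyIntegrable_mul_const hw.locallyIntegrable_deriv T
  have hskew : ∀ i j, ∀ᵐ y, (W y * T) i j = -(W y * T) j i := fun i j => h.mono fun y hy => by
    have := congrFun (congrFun hy i) j
    simp only [symPart, Matrix.smul_apply, Matrix.add_apply, Matrix.transpose_apply, smul_eq_mul,
      Matrix.zero_apply] at this
    linarith
  -- The derivatives of `W T` form a three-index object symmetric in the last two indices and skew
  -- in the first two. Six alternating exchanges show that it equals its own negative.
  have hzero : ∀ i j k, ∀ θ, IsTest θ →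
      ∫ y, (W y * T) i j * fderiv ℝ θ y (fun p => T p k) = 0 := by
    intro i j k θ hθ
    have hsymm : ∀ i j k, ∫ y, (W y * T) i j * fderiv ℝ θ y (fun p => T p k) =
        ∫ y, (W y * T) i k * fderiv ℝ θ y (fun p => T p j) := fun i j k => by
      have h1 := hw.weak_deriv_col T i j (hθ.fderiv fun p => T p k)
      have h2 := hw.weak_deriv_col T i k (hθ.fderiv fun p => T p j)
      simp only [hθ.fderiv_comm (fun p => T p k)] at h1
      rw [h1] at h2
      exact neg_injective h2
    have hanti : ∀ i j k, ∫ y, (W y * T) i j * fderiv ℝ θ y (fun p => T p k) =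
        -∫ y, (W y * T) j i * fderiv ℝ θ y (fun p => T p k) := fun i j k => by
      rw [← integral_neg]
      exact integral_congr_ae ((hskew i j).mono fun y hy => by simp only [hy]; ring)
    have h1 := hanti i j k
    rw [hsymm j i k, hanti j k i, hsymm k j i, hanti k i j, hsymm i k j] at h1
    linarith
  have hconst : ∀ i j, ∃ c, ∀ᵐ y, (W y * T) i j = c := fun i j => by
    refine ae_const_of_weak_gradient_zero (hE i j) fun l => ?_
    rw [isWeakPartial_iff]
    intro θ hθ
    -- The columns of the invertible `T` span space, so vanishing derivatives along them give
    -- vanishing coordinate derivatives.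
    have hl : (Pi.single l 1 : V3) = ∑ k, T⁻¹ k l • fun p => T p k := by
      have h1 := Matrix.mul_nonsing_inv T hT
      funext p
      have h2 := congrFun (congrFun h1 p) l
      rw [Matrix.mul_apply] at h2
      rw [Finset.sum_apply]
      simp only [Pi.smul_apply, smul_eq_mul, mul_comm (T⁻¹ _ _), h2]
      simp [Matrix.one_apply, Pi.single_apply]
    simp only [hl, map_sum, map_smul, smul_eq_mul, Finset.mul_sum, mul_left_comm _ (T⁻¹ _ l)]
    rw [integral_finsetSum _ fun k _ => ((hθ.fderiv _).integrable_mul (hE i j)).const_mul _]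
    simp only [integral_const_mul, hzero i j _ θ hθ]
    simp
  choose E hEc using hconst
  have hW : ∀ᵐ y, W y = Matrix.of E * T⁻¹ := by
    filter_upwards [ae_all_iff.2 fun i => ae_all_iff.2 fun j => hEc i j] with y hy
    have : W y * T = Matrix.of E := by ext i j; exact hy i j
    rw [← this, Matrix.mul_assoc, Matrix.mul_nonsing_inv _ hT, Matrix.mul_one]
  -- The gradient is constant, and the gradient of a periodic function has mean zero.
  have hC : Matrix.of E * T⁻¹ = 0 := by
    ext i j
    have h1 := hw.mean_profile_mul i j (IsProfile.const 1) fun _ => ⟨1, fun _ => rfl⟩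
    rw [mean_congr (g := fun _ => (Matrix.of E * T⁻¹) i j)
      (hW.mono fun y hy => by rw [hy, one_mul])] at h1
    simpa [mean] using h1
  rw [hC] at hW
  refine ⟨?_, hW⟩
  have hwi : ∀ i, ∀ᵐ y, w y i = 0 := fun i => by
    obtain ⟨c, hc⟩ := ae_const_of_weak_gradient_zero (hw.locallyIntegrable i) fun j =>
      (hw.weak_deriv i j).congr (.of_forall fun _ => rfl)
        (hW.mono fun y hy => by rw [hy]; rfl)
    have h1 := hw.mean_zero i
    rw [mean_congr hc] at h1
    have hc0 : c = 0 := by simpa [mean] using h1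
    simpa only [hc0] using hc
  filter_upwards [ae_all_iff.2 hwi] with y hy
  funext i
  exact hy i

/-! ### The explicit slopes -/

/-- The slope of the corrector for `G₁` per unit of `γ`, and of the other correctors per unit of
`β₁` and `β₂`. -/
def slopeVec (α : V3) (c₁ c₂ h K M μ : ℝ) (i : Fin 6) : V3 :=
  if i = 0 then ((c₁ - K) / ((α ⬝ᵥ α) * M)) • α
  else (2 * (h / μ - 1) / (α ⬝ᵥ α)) • (basisG i).mulVec α +
    (2 * (α ⬝ᵥ (basisG i).mulVec α) / (α ⬝ᵥ α) ^ 2 * (c₂ / M - h / μ + 1 - μ / M)) • α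

/-- The last five formulas share one shape, with `G α` multiplying `β₁` and `α · G α` multiplying
`β₂`. This uniform form permits one equilibrium computation for all trace-free directions. -/
theorem correctorSlope_eq (α : V3) (K M mu : V3 → ℝ) (i : Fin 6) (y : V3) :
    correctorSlope α K M mu i y = slopeVec α (harmMean M * mean fun z => K z / M z)
      (harmMean M * mean fun z => mu z / M z) (harmMean mu) (K y) (M y) (mu y) i := by
  by_cases hi : i = 0
  · subst hi
    simp [correctorSlope, slopeVec]
  · simp only [correctorSlope, slopeVec, if_neg hi, beta1, beta2]
    generalize harmMean M * (mean fun z => mu z / M z) = c₂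
    generalize harmMean mu = h
    generalize hn : α ⬝ᵥ α = n
    generalize h / mu y = b
    generalize mu y / M y = d
    generalize c₂ / M y = e
    funext j
    fin_cases i
    · exact absurd rfl hi
    all_goals
      change (_ • _ + _ • _ : V3) j = (_ • _ + _ • _ : V3) j
      simp only [Pi.add_apply, Pi.smul_apply, smul_eq_mul, basisG]
      fin_cases j <;> simp [Matrix.mulVec, dotProduct, Fin.sum_univ_three] <;>
        first | ring1 | exact Or.inl (Or.inl (by ring))

theorem basisG_isSymm (i : Fin 6) : (basisG i).IsSymm := by
  ext j k
  fin_cases i <;> fin_cases j <;> fin_cases k <;> simp [basisG]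

theorem basisG_trace {i : Fin 6} (hi : i ≠ 0) : (basisG i).trace = 0 := by
  fin_cases i <;> simp [basisG, Matrix.trace, Fin.sum_univ_three] at hi ⊢ <;> norm_num

/-- The constant normal stress of the correctors. -/
def normalStress (α : V3) (c₁ c₂ h : ℝ) (i : Fin 6) : V3 :=
  if i = 0 then c₁ • α
  else (2 * h) • (basisG i).mulVec α + (2 * (α ⬝ᵥ (basisG i).mulVec α) / (α ⬝ᵥ α) * (c₂ - h)) • α

/-- Isolates the acoustic tensor `(l + m) α αᵀ + m |α|² I` acting on `u`; prescribing the normal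
stress becomes a linear equation for `u`. -/
theorem stress_mulVec (l m : ℝ) {G : Mat3} (hG : G.IsSymm) (u α : V3) :
    (stress l m (G + Matrix.vecMulVec u α)).mulVec α =
      (l * (G.trace + u ⬝ᵥ α) + m * (u ⬝ᵥ α)) • α + (2 * m) • G.mulVec α + (m * (α ⬝ᵥ α)) • u := by
  have h01 := hG.apply 0 1
  have h02 := hG.apply 0 2
  have h12 := hG.apply 1 2
  funext i
  fin_cases i <;>
  simp [stress, symPart, Matrix.mulVec, dotProduct, Fin.sum_univ_three, Matrix.trace,
    Matrix.one_apply, Matrix.vecMulVec_apply, h01, h02, h12] <;> ring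

/-- The slope solves the acoustic equation with a right-hand side free of the pointwise moduli. For
`G₁` everything is parallel to `α`; the other directions are trace-free, so the trace of the strain
comes from the slope only. -/
theorem stress_slopeVec {α : V3} (hα : α ≠ 0) (c₁ c₂ h : ℝ) {l m : ℝ} (hm : m ≠ 0)
    (hM : l + 2 * m ≠ 0) (i : Fin 6) :
    (stress l m (basisG i + Matrix.vecMulVec
      (slopeVec α c₁ c₂ h (l + 2 / 3 * m) (l + 2 * m) m i) α)).mulVec α =
      normalStress α c₁ c₂ h i := by
  have hn : α ⬝ᵥ α ≠ 0 := fun h0 => hα (dotProduct_self_eq_zero.1 h0)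
  rw [stress_mulVec l m (basisG_isSymm i)]
  by_cases hi : i = 0
  · subst hi
    have h1 : (basisG 0).mulVec α = (1 / 3 : ℝ) • α := by
      funext j
      fin_cases j <;> simp [basisG, Matrix.mulVec, dotProduct, Fin.sum_univ_three]
    have h2 : (basisG 0).trace = 1 := by
      simp [basisG, Matrix.trace, Fin.sum_univ_three]; norm_num
    simp only [slopeVec, normalStress, if_true, h1, h2, smul_smul, ← add_smul, smul_dotProduct,
      smul_eq_mul]
    congr 1
    field_simp
    ring
  · simp only [slopeVec, normalStress, if_neg hi, basisG_trace hi, add_dotProduct, smul_dotProduct,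
      smul_eq_mul]
    rw [dotProduct_comm ((basisG i).mulVec α) α]
    set q := α ⬝ᵥ (basisG i).mulVec α
    set n := α ⬝ᵥ α
    funext j
    simp only [Pi.add_apply, Pi.smul_apply, smul_eq_mul]
    field_simp
    ring

/-! ### Weighted means -/

/-- The mean of a function of the first coordinate with respect to the weight `ρ`. -/
def weightedMean (ρ f : ℝ → ℝ) : ℝ := mean fun y => f (y 0) * ρ (y 0)

theorem IsStretch.isProfile {ρ : ℝ → ℝ} (h : IsStretch ρ) : IsProfile ρ :=
  ⟨h.measurable, h.exists_abs_le, h.periodic⟩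

section WeightedMean

variable {ρ f g : ℝ → ℝ}

theorem weightedMean_add (hρ : IsStretch ρ) (hf : IsProfile f) (hg : IsProfile g) :
    weightedMean ρ (fun s => f s + g s) = weightedMean ρ f + weightedMean ρ g := by
  simp only [weightedMean, add_mul, mean]
  exact integral_add (hf.mul hρ.isProfile).integrable (hg.mul hρ.isProfile).integrable

theorem weightedMean_const_mul (c : ℝ) :
    weightedMean ρ (fun s => c * f s) = c * weightedMean ρ f := by
  simp only [weightedMean, mul_assoc, mean, integral_const_mul]

theorem weightedMean_sub (hρ : IsStretch ρ) (hf : IsProfile f) (hg : IsProfile g) :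
    weightedMean ρ (fun s => f s - g s) = weightedMean ρ f - weightedMean ρ g := by
  have := weightedMean_add hρ hf (hg.const_mul (-1))
  rw [weightedMean_const_mul] at this
  simpa [sub_eq_add_neg] using this

theorem weightedMean_one (hρ : IsStretch ρ) : weightedMean ρ (fun _ => 1) = 1 := by
  simp only [weightedMean, one_mul]
  rw [mean_fst hρ.measurable, hρ.integral_eq_one]

theorem weightedMean_const (hρ : IsStretch ρ) (c : ℝ) : weightedMean ρ (fun _ => c) = c := by
  have := weightedMean_const_mul (ρ := ρ) (f := fun _ => 1) c
  simpa [weightedMean_one hρ] using this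

theorem weightedMean_pos (hρ : IsStretch ρ) (hf : IsProfile f) {c : ℝ} (hc : 0 < c)
    (h : ∀ s, c ≤ f s) : 0 < weightedMean ρ f := by
  have h1 : weightedMean ρ (fun _ => c) ≤ weightedMean ρ f :=
    integral_mono ((IsProfile.const c).mul hρ.isProfile).integrable
      (hf.mul hρ.isProfile).integrable fun y =>
        mul_le_mul_of_nonneg_right (h (y 0)) (hρ.pos _).le
  rw [weightedMean_const hρ] at h1
  linarith

end WeightedMean

/-! ### Laminates -/

/-- A laminate with Lamé constants `l` and `m`, for gradients transformed by a matrix field `T`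
whose first row is `α / ρ`. -/
structure IsLaminate (l m ρ : ℝ → ℝ) (T : ℝ → Mat3) (α : V3) : Prop where
  moduli : IsModuli l m
  stretch : IsStretch ρ
  transform : ∀ i j, IsProfile fun s => T s i j
  row : ∀ s j, T s 0 j = α j / ρ s
  ne_zero : α ≠ 0

section Normalized

variable (l m ρ : ℝ → ℝ)

/-- The normalized shear modulus. -/
def nMu (s : ℝ) : ℝ := m s / ρ s

/-- The normalized bulk modulus. -/
def nK (s : ℝ) : ℝ := l s / ρ s + 2 / 3 * nMu m ρ s

/-- The normalized P-wave modulus. -/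
def nM (s : ℝ) : ℝ := nK l m ρ s + 4 / 3 * nMu m ρ s

/-- The weighted harmonic mean. -/
def weightedHarm (f : ℝ → ℝ) : ℝ := (weightedMean ρ fun s => (f s)⁻¹)⁻¹

/-- The mean of `K / M` times the harmonic mean of `M`. -/
def cBulk : ℝ := weightedHarm ρ (nM l m ρ) * weightedMean ρ fun s => nK l m ρ s / nM l m ρ s

/-- The mean of `μ / M` times the harmonic mean of `M`. -/
def cShear : ℝ := weightedHarm ρ (nM l m ρ) * weightedMean ρ fun s => nMu m ρ s / nM l m ρ s

/-- The explicit slopes. -/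
def slope (α : V3) (i : Fin 6) (s : ℝ) : V3 :=
  slopeVec α (cBulk l m ρ) (cShear l m ρ) (weightedHarm ρ (nMu m ρ)) (nK l m ρ s) (nM l m ρ s)
    (nMu m ρ s) i

/-- The transformed strain of the explicit corrector. -/
def strain (α : V3) (i : Fin 6) (s : ℝ) : Mat3 :=
  basisG i + Matrix.vecMulVec (slope l m ρ α i s) α

end Normalized

namespace IsLaminate

variable {l m ρ : ℝ → ℝ} {T : ℝ → Mat3} {α : V3}

theorem exists_bounds (h : IsLaminate l m ρ T α) :
    ∃ c, 0 < c ∧ ∀ s, c ≤ nMu m ρ s ∧ c ≤ nK l m ρ s ∧ c ≤ nM l m ρ s := by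
  obtain ⟨c, hc, hb⟩ := h.moduli.pos
  obtain ⟨lo, hi, h0, hρ⟩ := h.stretch.bounds
  have hhi : 0 < hi := h0.trans_le ((hρ 0).1.trans (hρ 0).2)
  have key : ∀ {x : ℝ} (s : ℝ), c ≤ x → c / hi ≤ x / ρ s := fun s hx =>
    div_le_div₀ (hc.le.trans hx) hx (h.stretch.pos s) (hρ s).2
  have hpos : 0 < c / hi := by positivity
  refine ⟨c / hi, hpos, fun s => ?_⟩
  have h1 : c / hi ≤ nMu m ρ s := key s (hb s).1
  have h2 : c / hi ≤ nK l m ρ s := by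
    have e : nK l m ρ s = (l s + 2 / 3 * m s) / ρ s := by simp only [nK, nMu]; ring
    rw [e]
    exact key s (hb s).2
  refine ⟨h1, h2, ?_⟩
  simp only [nM]
  linarith

theorem mu_pos (h : IsLaminate l m ρ T α) (s : ℝ) : 0 < nMu m ρ s := by
  obtain ⟨c, hc, hb⟩ := h.exists_bounds
  exact hc.trans_le (hb s).1

theorem M_pos (h : IsLaminate l m ρ T α) (s : ℝ) : 0 < nM l m ρ s := by
  obtain ⟨c, hc, hb⟩ := h.exists_bounds
  exact hc.trans_le (hb s).2.2

theorem profile_div (h : IsLaminate l m ρ T α) {f : ℝ → ℝ} (hf : IsProfile f) :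
    IsProfile fun s => f s / ρ s := by
  obtain ⟨lo, hi, h0, hρ⟩ := h.stretch.bounds
  exact hf.div h.stretch.isProfile h0 fun s => (hρ s).1

theorem profile_mu (h : IsLaminate l m ρ T α) : IsProfile (nMu m ρ) := h.profile_div h.moduli.mu

theorem profile_K (h : IsLaminate l m ρ T α) : IsProfile (nK l m ρ) :=
  (h.profile_div h.moduli.lam).add (h.profile_mu.const_mul _)

theorem profile_M (h : IsLaminate l m ρ T α) : IsProfile (nM l m ρ) :=
  h.profile_K.add (h.profile_mu.const_mul _)

theorem profile_inv_mu (h : IsLaminate l m ρ T α) : IsProfile fun s => (nMu m ρ s)⁻¹ := by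
  obtain ⟨c, hc, hb⟩ := h.exists_bounds
  exact h.profile_mu.inv hc fun s => (hb s).1

theorem profile_inv_M (h : IsLaminate l m ρ T α) : IsProfile fun s => (nM l m ρ s)⁻¹ := by
  obtain ⟨c, hc, hb⟩ := h.exists_bounds
  exact h.profile_M.inv hc fun s => (hb s).2.2

theorem profile_div_M (h : IsLaminate l m ρ T α) {f : ℝ → ℝ} (hf : IsProfile f) :
    IsProfile fun s => f s / nM l m ρ s := by
  simpa only [div_eq_mul_inv] using hf.mul h.profile_inv_M

theorem mean_inv_mu_pos (h : IsLaminate l m ρ T α) :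
    0 < weightedMean ρ fun s => (nMu m ρ s)⁻¹ := by
  obtain ⟨D, hD⟩ := h.profile_mu.bounded
  have hD' : ∀ s, nMu m ρ s ≤ D := fun s => (le_abs_self _).trans (hD s)
  have hD0 : 0 < D := (h.mu_pos 0).trans_le (hD' 0)
  exact weightedMean_pos h.stretch h.profile_inv_mu (inv_pos.2 hD0) fun s =>
    inv_anti₀ (h.mu_pos s) (hD' s)

theorem mean_inv_M_pos (h : IsLaminate l m ρ T α) :
    0 < weightedMean ρ fun s => (nM l m ρ s)⁻¹ := by
  obtain ⟨D, hD⟩ := h.profile_M.bounded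
  have hD' : ∀ s, nM l m ρ s ≤ D := fun s => (le_abs_self _).trans (hD s)
  have hD0 : 0 < D := (h.M_pos 0).trans_le (hD' 0)
  exact weightedMean_pos h.stretch h.profile_inv_M (inv_pos.2 hD0) fun s =>
    inv_anti₀ (h.M_pos s) (hD' s)

theorem harm_mu (h : IsLaminate l m ρ T α) :
    weightedHarm ρ (nMu m ρ) * (weightedMean ρ fun s => (nMu m ρ s)⁻¹) = 1 :=
  inv_mul_cancel₀ h.mean_inv_mu_pos.ne'

theorem harm_M (h : IsLaminate l m ρ T α) :
    weightedHarm ρ (nM l m ρ) * (weightedMean ρ fun s => (nM l m ρ s)⁻¹) = 1 :=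
  inv_mul_cancel₀ h.mean_inv_M_pos.ne'

/-- The functions `(c₁ - K) / M`, `β₁` and `β₂` from which the slopes are built. -/
theorem profile_gamma (h : IsLaminate l m ρ T α) :
    IsProfile fun s => cBulk l m ρ * (nM l m ρ s)⁻¹ - nK l m ρ s / nM l m ρ s :=
  (h.profile_inv_M.const_mul _).sub (h.profile_div_M h.profile_K)

theorem profile_beta1 (h : IsLaminate l m ρ T α) :
    IsProfile fun s => weightedHarm ρ (nMu m ρ) * (nMu m ρ s)⁻¹ - 1 :=
  (h.profile_inv_mu.const_mul _).sub (.const 1)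

theorem profile_beta12 (h : IsLaminate l m ρ T α) :
    IsProfile fun s => cShear l m ρ * (nM l m ρ s)⁻¹ - nMu m ρ s / nM l m ρ s :=
  (h.profile_inv_M.const_mul _).sub (h.profile_div_M h.profile_mu)

/-- The constant `cBulk` is chosen for this cancellation: the harmonic mean times the mean of the
reciprocal is one. The same mechanism fixes the constants in the next two means. -/
theorem mean_gamma (h : IsLaminate l m ρ T α) : weightedMean ρ
    (fun s => cBulk l m ρ * (nM l m ρ s)⁻¹ - nK l m ρ s / nM l m ρ s) = 0 := by
  rw [weightedMean_sub h.stretch (h.profile_inv_M.const_mul _) (h.profile_div_M h.profile_K),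
    weightedMean_const_mul, cBulk]
  linear_combination (weightedMean ρ fun s => nK l m ρ s / nM l m ρ s) * h.harm_M

theorem mean_beta1 (h : IsLaminate l m ρ T α) : weightedMean ρ
    (fun s => weightedHarm ρ (nMu m ρ) * (nMu m ρ s)⁻¹ - 1) = 0 := by
  rw [weightedMean_sub h.stretch (h.profile_inv_mu.const_mul _) (.const 1),
    weightedMean_const_mul, weightedMean_one h.stretch]
  linear_combination h.harm_mu

theorem mean_beta12 (h : IsLaminate l m ρ T α) : weightedMean ρ
    (fun s => cShear l m ρ * (nM l m ρ s)⁻¹ - nMu m ρ s / nM l m ρ s) = 0 := by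
  rw [weightedMean_sub h.stretch (h.profile_inv_M.const_mul _) (h.profile_div_M h.profile_mu),
    weightedMean_const_mul, cShear]
  linear_combination (weightedMean ρ fun s => nMu m ρ s / nM l m ρ s) * h.harm_M

/-- Every slope component is a combination of three mean-zero profiles, because `β₂` is the shear
profile minus `β₁`. Boundedness and vanishing mean of all slopes follow together. -/
theorem slope_eq (α : V3) (i : Fin 6) (j : Fin 3) : ∃ a b c : ℝ, ∀ s, slope l m ρ α i s j =
    a * (cBulk l m ρ * (nM l m ρ s)⁻¹ - nK l m ρ s / nM l m ρ s) +
    (b * (weightedHarm ρ (nMu m ρ) * (nMu m ρ s)⁻¹ - 1) +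
    c * (cShear l m ρ * (nM l m ρ s)⁻¹ - nMu m ρ s / nM l m ρ s)) := by
  by_cases hi : i = 0
  · refine ⟨α j / (α ⬝ᵥ α), 0, 0, fun s => ?_⟩
    simp only [slope, slopeVec, if_pos hi, Pi.smul_apply, smul_eq_mul]
    rw [div_mul_eq_div_div_swap]
    ring
  · refine ⟨0, 2 / (α ⬝ᵥ α) * (basisG i).mulVec α j -
      2 * (α ⬝ᵥ (basisG i).mulVec α) / (α ⬝ᵥ α) ^ 2 * α j,
      2 * (α ⬝ᵥ (basisG i).mulVec α) / (α ⬝ᵥ α) ^ 2 * α j, fun s => ?_⟩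
    simp only [slope, slopeVec, if_neg hi, Pi.smul_apply, Pi.add_apply, smul_eq_mul]
    ring

theorem profile_slope (h : IsLaminate l m ρ T α) (i : Fin 6) (j : Fin 3) :
    IsProfile fun s => slope l m ρ α i s j := by
  obtain ⟨a, b, c, he⟩ := slope_eq (l := l) (m := m) (ρ := ρ) α i j
  simp only [he]
  exact (h.profile_gamma.const_mul a).add
    ((h.profile_beta1.const_mul b).add (h.profile_beta12.const_mul c))

theorem mean_slope (h : IsLaminate l m ρ T α) (i : Fin 6) (j : Fin 3) :
    weightedMean ρ (fun s => slope l m ρ α i s j) = 0 := by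
  obtain ⟨a, b, c, he⟩ := slope_eq (l := l) (m := m) (ρ := ρ) α i j
  simp only [he]
  rw [weightedMean_add h.stretch (h.profile_gamma.const_mul a)
    ((h.profile_beta1.const_mul b).add (h.profile_beta12.const_mul c)),
    weightedMean_add h.stretch (h.profile_beta1.const_mul b) (h.profile_beta12.const_mul c),
    weightedMean_const_mul, weightedMean_const_mul, weightedMean_const_mul, h.mean_gamma,
    h.mean_beta1, h.mean_beta12]
  ring

theorem profile_strain (h : IsLaminate l m ρ T α) (i : Fin 6) (j k : Fin 3) :
    IsProfile fun s => strain l m ρ α i s j k := by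
  simp only [strain, Matrix.add_apply, Matrix.vecMulVec_apply]
  exact (IsProfile.const _).add ((h.profile_slope i j).mul (.const _))

theorem stress_scale (h : IsLaminate l m ρ T α) (s : ℝ) (F : Mat3) :
    stress (l s) (m s) F = ρ s • stress (l s / ρ s) (nMu m ρ s) F := by
  have := (h.stretch.pos s).ne'
  ext i j
  simp only [stress, nMu, Matrix.add_apply, Matrix.smul_apply, smul_eq_mul]
  field_simp

theorem stress_strain (h : IsLaminate l m ρ T α) (i : Fin 6) (s : ℝ) :
    (stress (l s / ρ s) (nMu m ρ s) (strain l m ρ α i s)).mulVec α =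
      normalStress α (cBulk l m ρ) (cShear l m ρ) (weightedHarm ρ (nMu m ρ)) i := by
  have hM : l s / ρ s + 2 * nMu m ρ s = nM l m ρ s := by simp only [nM, nK]; ring
  rw [← stress_slopeVec h.ne_zero (l := l s / ρ s) (m := nMu m ρ s) _ _ _ (h.mu_pos s).ne'
    (hM ▸ (h.M_pos s).ne') i, hM]
  rfl

/-! #### Combinations of the explicit correctors -/

/-- The slopes of linear combinations of the explicit correctors. -/
theorem exists_corrector_combination (h : IsLaminate l m ρ T α) (n : Fin 6 → ℝ) :
    ∃ φ, IsH1PerZero φ (fun y => Matrix.vecMulVec (∑ i, n i • (ρ (y 0) • slope l m ρ α i (y 0))) e1)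
      ∧ (∃ ψ : ℝ → V3, ∀ y, φ y = ψ (y 0)) ∧
      ∀ y : V3, (∑ i, n i • basisG i) +
        Matrix.vecMulVec (∑ i, n i • (ρ (y 0) • slope l m ρ α i (y 0))) e1 * T (y 0) =
          ∑ i, n i • strain l m ρ α i (y 0) := by
  set v : ℝ → V3 := fun s => ∑ i, n i • (ρ s • slope l m ρ α i s) with hv
  have hvp : ∀ j, IsProfile fun s => v s j := fun j => by
    simp only [hv, Finset.sum_apply, Pi.smul_apply, smul_eq_mul]
    exact IsProfile.sum fun i _ => (h.stretch.isProfile.mul (h.profile_slope i j)).const_mul (n i)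
  refine ⟨profileField v, isH1PerZero_profileField hvp fun j => ?_,
    ⟨fun s i => primitive (fun s => v s i) s - mean fun z => primitive (fun s => v s i) (z 0),
      fun y => rfl⟩, fun y => ?_⟩
  · simp only [hv, Finset.sum_apply, Pi.smul_apply, smul_eq_mul, mean]
    rw [integral_finsetSum _ fun i _ =>
      ((h.stretch.isProfile.mul (h.profile_slope i j)).const_mul (n i)).integrable]
    refine Finset.sum_eq_zero fun i _ => ?_
    rw [integral_const_mul]
    have := h.mean_slope i j
    simp only [weightedMean, mean, mul_comm _ (ρ _)] at this
    rw [this, mul_zero]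
  · have hT : Matrix.vecMulVec (v (y 0)) e1 * T (y 0) =
        Matrix.vecMulVec ((ρ (y 0))⁻¹ • v (y 0)) α := by
      ext i j
      simp only [Matrix.mul_apply, Matrix.vecMulVec_apply, e1, Fin.sum_univ_three]
      simp [h.row]
      ring
    have hρ := (h.stretch.pos (y 0)).ne'
    have hv' : (ρ (y 0))⁻¹ • v (y 0) = ∑ i, n i • slope l m ρ α i (y 0) := by
      simp only [hv, Finset.smul_sum]
      refine Finset.sum_congr rfl fun i _ => ?_
      rw [smul_comm, inv_smul_smul₀ hρ]
    rw [hT, hv']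
    ext i j
    simp only [strain, Matrix.add_apply, Matrix.sum_apply, Matrix.smul_apply,
      Matrix.vecMulVec_apply, Finset.sum_apply, Pi.smul_apply, smul_eq_mul, Finset.sum_mul,
      mul_add, Finset.sum_add_distrib, mul_assoc]

/-- The unnormalized stress carries a factor `ρ` and the first row of `T` a factor `1 / ρ`, so the
relevant normal stress is the constant one of the normalized moduli. -/
theorem innerQ_strain_eq_zero (h : IsLaminate l m ρ T α) (i : Fin 6) {ψ : V3 → V3}
    {Ψ : V3 → Mat3} (hψ : IsH1Per ψ Ψ) :
    innerQ (laminateForm l m) (fun y => strain l m ρ α i (y 0)) (fun y => Ψ y * T (y 0)) = 0 := by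
  refine h.moduli.innerQ_eq_zero h.transform (h.profile_strain i) (fun j =>
    ⟨normalStress α (cBulk l m ρ) (cShear l m ρ) (weightedHarm ρ (nMu m ρ)) i j,
      fun s => ?_⟩) hψ
  rw [← h.stress_strain i s, h.stress_scale]
  simp only [h.row, Matrix.mulVec, dotProduct, Matrix.smul_apply, smul_eq_mul]
  refine Finset.sum_congr rfl fun k _ => ?_
  have := (h.stretch.pos s).ne'
  field_simp

/-- The explicit corrector for `G_i`. -/
theorem exists_corrector (h : IsLaminate l m ρ T α) (i : Fin 6) :
    ∃ φ, IsH1PerZero φ (fun y => Matrix.vecMulVec (ρ (y 0) • slope l m ρ α i (y 0)) e1)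
      ∧ (∃ ψ : ℝ → V3, ∀ y, φ y = ψ (y 0)) ∧
      ∀ y : V3, basisG i + Matrix.vecMulVec (ρ (y 0) • slope l m ρ α i (y 0)) e1 * T (y 0) =
          strain l m ρ α i (y 0) := by
  have := exists_corrector_combination h (Pi.single i 1)
  simpa [Pi.single_apply, ite_smul] using this

end IsLaminate

/-! ### Correctors of laminates -/

section

variable {l m ρ : ℝ → ℝ} {T : ℝ → Mat3} {α : V3}

theorem IsLaminate.innerQ_corrector_eq_zero (h : IsLaminate l m ρ T α) {i : Fin 6}
    {Φ : V3 → Mat3} (hΦ : ∀ y, basisG i + Φ y * T (y 0) = strain l m ρ α i (y 0)) (ψ : V3 → V3)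
    (Ψ : V3 → Mat3) (hψ : IsH1Per ψ Ψ) : innerQ (laminateForm l m)
      (fun y => basisG i + Φ y * T (y 0)) (fun y => Ψ y * T (y 0)) = 0 := by
  simp only [hΦ]
  exact h.innerQ_strain_eq_zero i hψ

theorem IsLaminate.exists_isCorrector (h : IsLaminate l m ρ T α) (i : Fin 6) :
    ∃ φ Φ, IsCorrector (laminateForm l m) (fun y => T (y 0)) (basisG i) φ Φ := by
  obtain ⟨φ, hφ, -, hs⟩ := h.exists_corrector i
  exact ⟨φ, _, h.moduli.isCorrector h.transform hφ (h.innerQ_corrector_eq_zero hs)⟩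

/-- All correctors for `G_i` have the same strain. -/
theorem IsLaminate.symPart_corrector (h : IsLaminate l m ρ T α) {i : Fin 6} {φ : V3 → V3}
    {Φ : V3 → Mat3} (hφ : IsCorrector (laminateForm l m) (fun y => T (y 0)) (basisG i) φ Φ) :
    ∀ᵐ y ∂volume.restrict unitCell,
      symPart (basisG i + Φ y * T (y 0)) = symPart (strain l m ρ α i (y 0)) := by
  obtain ⟨φ', hφ', -, hs⟩ := h.exists_corrector i
  filter_upwards [h.moduli.corrector_unique h.transform hφ' (h.innerQ_corrector_eq_zero hs) hφ]
    with y hy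
  rw [← hs y]
  ext j k
  have := congrFun (congrFun hy j) k
  simp only [symPart, sub_mul, Matrix.smul_apply, Matrix.add_apply, Matrix.sub_apply,
    Matrix.transpose_apply, Matrix.zero_apply, smul_eq_mul] at this ⊢
  linarith

/-- For a constant transformation, correctors are unique. -/
theorem IsLaminate.corrector_eq {S : Mat3} (h : IsLaminate l m ρ (fun _ => S) α)
    (hS : IsUnit S.det) {i : Fin 6} {φ : V3 → V3} {Φ : V3 → Mat3}
    (hφ : IsCorrector (laminateForm l m) (fun _ => S) (basisG i) φ Φ) :
    (∃ ψ : ℝ → V3, ∀ᵐ y, φ y = ψ (y 0)) ∧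
      ∀ᵐ y : V3, Φ y = Matrix.vecMulVec (ρ (y 0) • slope l m ρ α i (y 0)) e1 := by
  obtain ⟨φ', hφ', ⟨ψ, hψ⟩, hs⟩ := h.exists_corrector i
  have h1 := h.moduli.corrector_unique h.transform hφ' (h.innerQ_corrector_eq_zero hs) hφ
  have hw := hφ.mem.sub hφ'
  obtain ⟨h2, h3⟩ := hw.eq_zero_of_skew hS
    (hw.periodic_deriv.ae_of_ae_cell (p := fun W => symPart (W * S) = 0) h1)
  exact ⟨⟨ψ, h2.mono fun y hy => by rw [sub_eq_zero.1 hy, hψ]⟩,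
    h3.mono fun y hy => sub_eq_zero.1 hy⟩

theorem IsLaminate.isModuli_normalized (h : IsLaminate l m ρ T α) :
    IsModuli (fun s => l s / ρ s) (nMu m ρ) := by
  obtain ⟨c, hc, hb⟩ := h.exists_bounds
  exact ⟨h.profile_div h.moduli.lam, h.profile_mu, c, hc, fun s => ⟨(hb s).1, (hb s).2.1⟩⟩

theorem IsProfile.comp_homeo {f : ℝ → ℝ} (hf : IsProfile f) (hρ : IsStretch ρ) :
    IsProfile fun t => f (hρ.homeo.symm t) := by
  obtain ⟨C, hC⟩ := hf.bounded
  refine ⟨hf.measurable.comp hρ.homeo.symm.continuous.measurable, ⟨C, fun _ => hC _⟩, fun t => ?_⟩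
  simp only [hρ.homeo_symm_add_one]
  exact hf.periodic _

theorem IsModuli.comp_homeo (h : IsModuli l m) (hρ : IsStretch ρ) :
    IsModuli (fun t => l (hρ.homeo.symm t)) (fun t => m (hρ.homeo.symm t)) := by
  obtain ⟨c, hc, hb⟩ := h.pos
  exact ⟨h.lam.comp_homeo hρ, h.mu.comp_homeo hρ, c, hc, fun _ => hb _⟩

end

/-! ### Admissible moduli -/

theorem IsPerLinfty.exists_abs_le {f : ℝ → ℝ} (hf : IsPerLinfty f) : ∃ C, ∀ᵐ s, |f s| ≤ C := by
  have h1 := hf.memLp.2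
  rw [eLpNorm_exponent_top] at h1
  refine ⟨(eLpNormEssSup f volume).toReal, ?_⟩
  filter_upwards [ae_le_eLpNormEssSup (f := f) (μ := volume)] with s hs
  rw [← Real.norm_eq_abs, ← toReal_enorm]
  exact ENNReal.toReal_mono h1.ne hs

/-- Representatives are chosen for the shear and the bulk modulus, and `l` is recovered from them.
In this way both lower bounds hold everywhere, which separate representatives of `lam` and `mu`
would not guarantee. -/
theorem exists_isModuli {lam mu : ℝ → ℝ} (hlam : IsPerLinfty lam) (hmu : IsPerLinfty mu)
    (hmu_pos : EssBoundedBelow mu) (hK_pos : EssBoundedBelow fun t => lam t + 2 / 3 * mu t) :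
    ∃ l m, IsModuli l m ∧ (∀ᵐ s, lam s = l s) ∧ ∀ᵐ s, mu s = m s := by
  obtain ⟨C, hC⟩ := hlam.exists_abs_le
  obtain ⟨D, hD⟩ := hmu.exists_abs_le
  obtain ⟨c, hc, hcm⟩ := hmu_pos
  obtain ⟨d, hd, hdk⟩ := hK_pos
  obtain ⟨m, hm1, hm2, hm3, hm4⟩ := exists_periodic_representative
    hmu.memLp.1.aemeasurable (lo := c) (hi := D)
    (by filter_upwards [hD, hcm] with s h1 h2 using ⟨h2, (le_abs_self _).trans h1⟩) hmu.periodic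
  obtain ⟨k, hk1, hk2, hk3, hk4⟩ := exists_periodic_representative
    (f := fun t => lam t + 2 / 3 * mu t)
    (hlam.memLp.1.aemeasurable.add (hmu.memLp.1.aemeasurable.const_mul (2 / 3)))
    (lo := d) (hi := C + 2 / 3 * D)
    (by
      filter_upwards [hC, hD, hdk] with s h1 h2 h3
      have := le_abs_self (lam s)
      have := le_abs_self (mu s)
      exact ⟨h3, by linarith⟩)
    (by filter_upwards [hlam.periodic, hmu.periodic] with s h1 h2; rw [h1, h2])
  have hm : IsProfile m := ⟨hm1, ⟨D, fun s => by
    rw [abs_of_pos (hc.trans_le (hm2 s).1)]; exact (hm2 s).2⟩, hm3⟩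
  have hk : IsProfile k := ⟨hk1, ⟨_, fun s => by
    rw [abs_of_pos (hd.trans_le (hk2 s).1)]; exact (hk2 s).2⟩, hk3⟩
  refine ⟨fun s => k s - 2 / 3 * m s, m, ⟨hk.sub (hm.const_mul _), hm, min c d, lt_min hc hd,
    fun s => ⟨(min_le_left _ _).trans (hm2 s).1, ?_⟩⟩, ?_, hm4⟩
  · rw [sub_add_cancel]
    exact (min_le_right _ _).trans (hk2 s).1
  · filter_upwards [hm4, hk4] with s h1 h2
    rw [← h1, ← h2]
    ring

/-! ### Laminates generated by stress-free joints -/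

namespace JointProfile

variable {A : V3 → Mat3} {a : V3 → V3} {A₁ : ℝ → Mat3} {ρ : ℝ → ℝ} {P : ℝ → V3}
  {l m lam mu : ℝ → ℝ}

theorem isLaminate (h : JointProfile A a A₁ ρ P) (hm : IsModuli l m) :
    IsLaminate l m ρ (fun s => (A₁ s)⁻¹) (alphaVec A) where
  moduli := hm
  stretch := h.stretch
  transform i j := by
    obtain ⟨C, hC⟩ := h.bounded_inv
    exact ⟨h.measurable_inv i j, ⟨C, fun s => hC s i j⟩, fun s => by simp only [h.periodic s]⟩
  row := h.inv_row
  ne_zero := h.alphaVec_ne_zero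

/-- The transformed problem has constant transformation `Ā⁻¹` and hence trivial weight; the factor
`1 / ρ` has moved into the moduli. -/
theorem isLaminate_hat (h : JointProfile A a A₁ ρ P) (hm : IsModuli l m) :
    IsLaminate (fun t => l (h.stretch.homeo.symm t) / ρ (h.stretch.homeo.symm t))
      (fun t => nMu m ρ (h.stretch.homeo.symm t)) (fun _ => 1) (fun _ => (meanMat A)⁻¹)
      (alphaVec A) where
  moduli := (h.isLaminate hm).isModuli_normalized.comp_homeo h.stretch
  stretch := .one
  transform i j := .const _
  row s j := by rw [div_one, alphaVec_apply]
  ne_zero := h.alphaVec_ne_zero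

theorem hatForm_eq (h : JointProfile A a A₁ ρ P) (hlam : ∀ᵐ s, lam s = l s)
    (hmu : ∀ᵐ s, mu s = m s) : ∀ᵐ y, ∀ F, hatForm (laminateForm lam mu) a A y F =
      laminateForm (fun t => l (h.stretch.homeo.symm t) / ρ (h.stretch.homeo.symm t))
        (fun t => nMu m ρ (h.stretch.homeo.symm t)) y F := by
  filter_upwards [h.hatModulus_eq hlam, h.hatModulus_eq hmu] with y h1 h2 F
  rw [hatForm, laminateForm, isoForm_smul, laminateForm, nMu, ← h1, ← h2]
  rfl

theorem hatBulk_eq (h : JointProfile A a A₁ ρ P) (hlam : ∀ᵐ s, lam s = l s)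
    (hmu : ∀ᵐ s, mu s = m s) :
    ∀ᵐ y, hatBulk lam mu a A y = nK l m ρ (h.stretch.homeo.symm (y 0)) := by
  filter_upwards [h.hatModulus_eq hlam, h.hatModulus_eq hmu] with y h1 h2
  rw [hatBulk, h1, h2]; rfl

theorem hatPWave_eq (h : JointProfile A a A₁ ρ P) (hlam : ∀ᵐ s, lam s = l s)
    (hmu : ∀ᵐ s, mu s = m s) :
    ∀ᵐ y, hatPWave lam mu a A y = nM l m ρ (h.stretch.homeo.symm (y 0)) := by
  filter_upwards [h.hatBulk_eq hlam hmu, h.hatModulus_eq hmu] with y h1 h2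
  rw [hatPWave, h1, h2]; rfl

theorem mean_hat (h : JointProfile A a A₁ ρ P) {f : V3 → ℝ} {g : ℝ → ℝ} (hg : IsProfile g)
    (hf : ∀ᵐ y, f y = g (h.stretch.homeo.symm (y 0))) : mean f = weightedMean ρ g := by
  rw [mean_congr hf, h.mean_comp_homeo_symm hg.periodic, weightedMean]

theorem correctorSlope_hat (h : JointProfile A a A₁ ρ P) (hlam : ∀ᵐ s, lam s = l s)
    (hmu : ∀ᵐ s, mu s = m s) (i : Fin 6) : ∀ᵐ y,
      correctorSlope (alphaVec A) (hatBulk lam mu a A) (hatPWave lam mu a A) (hatModulus mu a A)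
        i y = slope (fun t => l (h.stretch.homeo.symm t) / ρ (h.stretch.homeo.symm t))
        (fun t => nMu m ρ (h.stretch.homeo.symm t)) (fun _ => 1) (alphaVec A) i (y 0) := by
  have hK := h.hatBulk_eq hlam hmu
  have hM := h.hatPWave_eq hlam hmu
  have hG := h.hatModulus_eq hmu
  have w1 : ∀ f, weightedMean (fun _ => 1) f = mean fun y => f (y 0) := fun f => by
    simp only [weightedMean, mul_one]
  filter_upwards [hK, hM, hG] with y h1 h2 h3
  simp only [correctorSlope_eq, slope, cBulk, cShear, weightedHarm, harmMean, w1, nM, nK, nMu,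
    div_one] at h1 h2 h3 ⊢
  rw [h1, h2, h3, mean_congr (f := fun y => (hatPWave lam mu a A y)⁻¹)
    (hM.mono fun y hy => by rw [hy]),
    mean_congr (f := fun y => hatBulk lam mu a A y / hatPWave lam mu a A y)
    (by filter_upwards [hK, hM] with y h1 h2; rw [h1, h2]),
    mean_congr (f := fun y => hatModulus mu a A y / hatPWave lam mu a A y)
    (by filter_upwards [hG, hM] with y h1 h2; rw [h1, h2]),
    mean_congr (f := fun y => (hatModulus mu a A y)⁻¹)
    (hG.mono fun y hy => by rw [hy])]
  rfl

/-- Here the transformation is constant and invertible, so rigidity upgrades uniqueness of strains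
to uniqueness of correctors. -/
theorem transformed_correctors (h : JointProfile A a A₁ ρ P) (hm : IsModuli l m)
    (hlam : ∀ᵐ s, lam s = l s) (hmu : ∀ᵐ s, mu s = m s) (i : Fin 6) :
    (∃ φ Φ, IsCorrector (hatForm (laminateForm lam mu) a A) (fun _ => (meanMat A)⁻¹) (basisG i)
      φ Φ) ∧ ∀ φ Φ, IsCorrector (hatForm (laminateForm lam mu) a A) (fun _ => (meanMat A)⁻¹)
        (basisG i) φ Φ → (∃ ψ : ℝ → V3, ∀ᵐ y, φ y = ψ (y 0)) ∧
        ∀ᵐ y, Φ y = Matrix.vecMulVec (correctorSlope (alphaVec A) (hatBulk lam mu a A)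
          (hatPWave lam mu a A) (hatModulus mu a A) i y) e1 := by
  have hL := h.isLaminate_hat hm
  have hq := h.hatForm_eq hlam hmu
  refine ⟨?_, fun φ Φ hφ => ?_⟩
  · obtain ⟨φ, Φ, hφ⟩ := hL.exists_isCorrector i
    exact ⟨φ, Φ, hφ.congr (hq.mono fun y hy F => (hy F).symm) (.of_forall fun _ => rfl)⟩
  · obtain ⟨h1, h2⟩ := hL.corrector_eq (Matrix.isUnit_nonsing_inv_det _ h.isUnit_det)
      (hφ.congr hq (.of_forall fun _ => rfl))
    refine ⟨h1, ?_⟩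
    filter_upwards [h2, h.correctorSlope_hat hlam hmu i] with y h3 h4
    rw [h3, h4, one_smul]

end JointProfile

/-! ### The effective prestrain as a finite-dimensional problem -/

theorem symPart_add (F G : Mat3) : symPart (F + G) = symPart F + symPart G := by
  simp only [symPart, Matrix.transpose_add, ← smul_add]
  congr 1
  abel

theorem symPart_sub (F G : Mat3) : symPart (F - G) = symPart F - symPart G := by
  simp only [symPart, Matrix.transpose_sub, ← smul_sub]
  congr 1
  abel

theorem symPart_of_isSymm {G : Mat3} (hG : G.IsSymm) : symPart G = G := by
  rw [symPart, hG.eq, ← two_smul ℝ, smul_smul]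
  norm_num

theorem exists_eq_sum_basisG {N : Mat3} (hN : N.IsSymm) : ∃ n : Fin 6 → ℝ,
    ∑ i, n i • basisG i = N := by
  refine ⟨![N 0 0 + N 1 1 + N 2 2, N 0 0 - (N 1 1 + N 2 2) / 2, N 2 2 - N 1 1, 2 * N 0 1,
    2 * N 0 2, 2 * N 1 2], ?_⟩
  have h01 := hN.apply 0 1
  have h02 := hN.apply 0 2
  have h12 := hN.apply 1 2
  ext i j
  fin_cases i <;> fin_cases j <;>
    simp [Matrix.sum_apply, Fin.sum_univ_six, basisG, h01, h02, h12] <;> ring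

theorem isSymm_sum_basisG (n : Fin 6 → ℝ) : (∑ i, n i • basisG i).IsSymm := by
  rw [Matrix.IsSymm, Matrix.transpose_sum]
  exact Finset.sum_congr rfl fun i _ => by rw [Matrix.transpose_smul, (basisG_isSymm i).eq]

theorem IsModuli.innerQ_sum_left {l m : ℝ → ℝ} (h : IsModuli l m) {F : Fin 6 → V3 → Mat3}
    (hF : ∀ i, CellL2 (F i)) {G : V3 → Mat3} (hG : CellL2 G) (n : Fin 6 → ℝ) :
    innerQ (laminateForm l m) (fun y => ∑ i, n i • F i y) G =
      ∑ i, n i * innerQ (laminateForm l m) (F i) G := by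
  simp only [innerQ, mean, ← integral_const_mul]
  rw [← integral_finsetSum _ fun i _ => (h.integrable_polar (hF i) hG).const_mul (n i)]
  simp only [laminateForm_eq, Fin.sum_univ_six, polar_add_left, polar_smul_left]

section Prestrain

variable {l m ρ : ℝ → ℝ} {A₁ : ℝ → Mat3} {α : V3}

theorem InS.cellL2 {S : V3 → Mat3} (hT : ∀ i j, IsProfile fun s => (A₁ s)⁻¹ i j)
    (hS : InS (fun y => A₁ (y 0)) S) : CellL2 S := by
  obtain ⟨φ, Φ, hφ, h⟩ := hS
  exact (hφ.cellL2.mul_profile hT).symPart.congr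
    (ae_restrict_of_ae (h.mono fun y hy => hy.symm))

theorem InS.sub {A : V3 → Mat3} {S S' : V3 → Mat3} (hS : InS A S) (hS' : InS A S') :
    InS A fun y => S y - S' y := by
  obtain ⟨φ, Φ, hφ, h⟩ := hS
  obtain ⟨φ', Φ', hφ', h'⟩ := hS'
  refine ⟨_, _, hφ.sub hφ', ?_⟩
  filter_upwards [h, h'] with y h1 h2
  rw [h1, h2, sub_mul, symPart_sub]

theorem InSPlusSym.cellL2 {Ψ : V3 → Mat3} (hT : ∀ i j, IsProfile fun s => (A₁ s)⁻¹ i j)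
    (hΨ : InSPlusSym (fun y => A₁ (y 0)) Ψ) : CellL2 Ψ := by
  obtain ⟨S, M, hS, -, h⟩ := hΨ
  exact ((hS.cellL2 hT).add (.const M)).congr (ae_restrict_of_ae (h.mono fun y hy => hy.symm))

namespace IsLaminate

theorem cellL2_strain (h : IsLaminate l m ρ (fun s => (A₁ s)⁻¹) α) (i : Fin 6) :
    CellL2 fun y => strain l m ρ α i (y 0) := CellL2.profile (h.profile_strain i)

theorem innerQ_sum_strain (h : IsLaminate l m ρ (fun s => (A₁ s)⁻¹) α) {X : V3 → Mat3}
    (hX : CellL2 X) (n : Fin 6 → ℝ) :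
    innerQ (laminateForm l m) X (fun y => ∑ i, n i • strain l m ρ α i (y 0)) =
      ∑ i, n i * innerQ (laminateForm l m) X (fun y => strain l m ρ α i (y 0)) := by
  rw [innerQ_comm, h.moduli.innerQ_sum_left h.cellL2_strain hX]
  simp only [innerQ_comm (G := X)]

/-- The strains of the correctors belong to a symmetric matrix plus an element of `𝒮`. -/
theorem exists_inS (h : IsLaminate l m ρ (fun s => (A₁ s)⁻¹) α) (n : Fin 6 → ℝ) :
    ∃ S, InS (fun y => A₁ (y 0)) S ∧ ∀ y, symPart (∑ i, n i • strain l m ρ α i (y 0)) =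
      S y + ∑ i, n i • basisG i := by
  obtain ⟨φ, hφ, -, hs⟩ := exists_corrector_combination h n
  refine ⟨_, ⟨φ, _, hφ.toIsH1Per, .of_forall fun y => rfl⟩, fun y => ?_⟩
  rw [← hs, symPart_add, symPart_of_isSymm (isSymm_sum_basisG n), add_comm]

/-- A corrector strain is a constant matrix plus a transformed gradient, and orthogonality to `𝒮` is
its Euler–Lagrange equation. -/
theorem inO_strain (h : IsLaminate l m ρ (fun s => (A₁ s)⁻¹) α) (n : Fin 6 → ℝ) :
    InO (laminateForm l m) (fun y => A₁ (y 0))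
      fun y => symPart (∑ i, n i • strain l m ρ α i (y 0)) := by
  obtain ⟨S, hS, he⟩ := h.exists_inS n
  refine ⟨⟨S, _, hS, isSymm_sum_basisG n, .of_forall he⟩, fun S' hS' => ?_⟩
  rw [innerQ_symPart_right, h.innerQ_sum_strain (hS'.cellL2 h.transform)]
  obtain ⟨ψ, Ψ, hψ, hS'⟩ := hS'
  refine Finset.sum_eq_zero fun i _ => ?_
  rw [innerQ_congr (ae_restrict_of_ae hS') (.of_forall fun _ => rfl), innerQ_symPart_left,
    innerQ_comm, h.innerQ_strain_eq_zero i hψ, mul_zero]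

/-- `𝒪` is spanned by the strains of the correctors. -/
theorem innerQ_inO_eq_zero (h : IsLaminate l m ρ (fun s => (A₁ s)⁻¹) α) {X Θ : V3 → Mat3}
    (hX : CellL2 X) (h0 : ∀ i, innerQ (laminateForm l m) X (fun y => strain l m ρ α i (y 0)) = 0)
    (hΘ : InO (laminateForm l m) (fun y => A₁ (y 0)) Θ) : innerQ (laminateForm l m) X Θ = 0 := by
  have hΘ2 := hΘ.1.cellL2 h.transform
  obtain ⟨⟨S, N, hS, hN, he⟩, horth⟩ := hΘ
  obtain ⟨n, hn⟩ := exists_eq_sum_basisG hN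
  obtain ⟨S', hS', he'⟩ := h.exists_inS n
  have hO := h.inO_strain n
  have hO2 := hO.1.cellL2 h.transform
  -- Subtracting the corrector strain with the same constant part leaves an element of `𝒮` that is
  -- also orthogonal to `𝒮`, hence of zero energy.
  have hD := hS.sub hS'
  have hDe : ∀ᵐ y, S y - S' y = Θ y - symPart (∑ i, n i • strain l m ρ α i (y 0)) := by
    filter_upwards [he] with y h1
    rw [h1, he', hn]
    abel
  have hD0 : innerQ (laminateForm l m)
      (fun y => Θ y - symPart (∑ i, n i • strain l m ρ α i (y 0)))
      (fun y => Θ y - symPart (∑ i, n i • strain l m ρ α i (y 0))) = 0 := by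
    rw [h.moduli.innerQ_sub_right (hΘ2.sub hO2) hΘ2 hO2,
      ← innerQ_congr (ae_restrict_of_ae hDe) (.of_forall fun _ => rfl),
      ← innerQ_congr (ae_restrict_of_ae hDe) (.of_forall fun _ => rfl), horth _ hD, hO.2 _ hD,
      sub_zero]
  have hz := h.moduli.symPart_eq_zero (hΘ2.sub hO2) hD0
  have h1 : innerQ (laminateForm l m) X Θ =
      innerQ (laminateForm l m) X (fun y => ∑ i, n i • strain l m ρ α i (y 0)) := by
    rw [← innerQ_symPart_right (G := Θ),
      ← innerQ_symPart_right (G := fun y => ∑ i, n i • strain l m ρ α i (y 0))]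
    refine innerQ_congr (.of_forall fun _ => rfl) (hz.mono fun y hy => ?_)
    rw [symPart_sub, symPart_symPart] at hy
    exact sub_eq_zero.1 hy
  rw [h1, h.innerQ_sum_strain hX]
  exact Finset.sum_eq_zero fun i _ => by rw [h0, mul_zero]

/-- The projection of a constant symmetric `M` is the symmetrized corrector strain with constant
part `M`, as the difference lies in `𝒮`. Since such strains span `𝒪`, equal projections mean equal
products with the six basic strains. -/
theorem isEffectivePrestrain_iff (h : IsLaminate l m ρ (fun s => (A₁ s)⁻¹) α) {B : V3 → Mat3}
    (hB : CellL2 B) (M : Mat3) :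
    IsEffectivePrestrain (laminateForm l m) (fun y => A₁ (y 0)) B M ↔ M.IsSymm ∧
      ∀ i, innerQ (laminateForm l m) (fun y => strain l m ρ α i (y 0)) (fun _ => M) =
        innerQ (laminateForm l m) (fun y => strain l m ρ α i (y 0)) B := by
  refine and_congr_right fun hM => ⟨fun ⟨Ψ, h1, h2⟩ i => ?_, fun hI => ?_⟩
  · have hΨ := h1.1.1.cellL2 h.transform
    have hO := h.inO_strain (Pi.single i 1)
    have hs : ∀ y : V3, ∑ j, (Pi.single i 1 : Fin 6 → ℝ) j • strain l m ρ α j (y 0) =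
        strain l m ρ α i (y 0) := fun y => by simp [Pi.single_apply, ite_smul]
    simp only [hs] at hO
    have e1 := h1.2 _ hO
    have e2 := h2.2 _ hO
    rw [innerQ_symPart_right, h.moduli.innerQ_sub_left (.const M) hΨ (h.cellL2_strain i)] at e1
    rw [innerQ_symPart_right, h.moduli.innerQ_sub_left hB.symPart hΨ (h.cellL2_strain i),
      innerQ_symPart_left] at e2
    rw [innerQ_comm, innerQ_comm (G := B)]
    linarith
  · obtain ⟨n, hn⟩ := exists_eq_sum_basisG hM
    obtain ⟨S, hS, he⟩ := h.exists_inS n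
    have hO := h.inO_strain n
    have hO2 := hO.1.cellL2 h.transform
    have key : ∀ Θ, InO (laminateForm l m) (fun y => A₁ (y 0)) Θ → innerQ (laminateForm l m)
        (fun y => M - symPart (∑ i, n i • strain l m ρ α i (y 0))) Θ = 0 := fun Θ hΘ => by
      have h1 := hΘ.2 _ hS
      have e : (fun y => M - symPart (∑ i, n i • strain l m ρ α i (y 0))) =
          fun y => (-1 : ℝ) • S y := by
        funext y
        rw [he, hn]
        simp
      rw [e, innerQ_smul_left, h1, mul_zero]
    refine ⟨_, ⟨hO, key⟩, hO, fun Θ hΘ => ?_⟩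
    have hΘ2 := hΘ.1.cellL2 h.transform
    have h1 : innerQ (laminateForm l m) (fun y => symPart (B y) - M) Θ = 0 := by
      refine h.innerQ_inO_eq_zero (hB.symPart.sub (.const M)) (fun i => ?_) hΘ
      rw [h.moduli.innerQ_sub_left hB.symPart (.const M) (h.cellL2_strain i),
        innerQ_symPart_left, innerQ_comm, innerQ_comm (F := fun _ => M), hI, sub_self]
    have h2 := key Θ hΘ
    rw [h.moduli.innerQ_sub_left hB.symPart (.const M) hΘ2] at h1
    rw [h.moduli.innerQ_sub_left (.const M) hO2 hΘ2] at h2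
    rw [h.moduli.innerQ_sub_left hB.symPart hO2 hΘ2]
    linarith

/-- The effective matrix in terms of the explicit strains. -/
theorem innerQ_correctors (h : IsLaminate l m ρ (fun s => (A₁ s)⁻¹) α)
    {φ : Fin 6 → V3 → V3} {Φ : Fin 6 → V3 → Mat3}
    (hφ : ∀ i, IsCorrector (laminateForm l m) (fun y => (A₁ (y 0))⁻¹) (basisG i) (φ i) (Φ i))
    (i j : Fin 6) :
    innerQ (laminateForm l m) (fun y => basisG i + Φ i y * (A₁ (y 0))⁻¹)
      (fun y => basisG j + Φ j y * (A₁ (y 0))⁻¹) =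
      innerQ (laminateForm l m) (fun y => strain l m ρ α i (y 0)) (fun _ => basisG j) := by
  rw [← innerQ_symPart_left, ← innerQ_symPart_right,
    innerQ_congr (h.symPart_corrector (hφ i)) (h.symPart_corrector (hφ j)), innerQ_symPart_left,
    innerQ_symPart_right]
  -- Only one of the two strains has to be resolved: its gradient part is annihilated by the
  -- equilibrium of the other, leaving the constant `G_j`.
  obtain ⟨φ', hφ', -, hs⟩ := h.exists_corrector j
  simp only [← hs]
  rw [h.moduli.innerQ_add_right (h.cellL2_strain i) (.const _)
    (hφ'.cellL2.mul_profile h.transform), h.innerQ_strain_eq_zero i hφ'.toIsH1Per, add_zero]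

end IsLaminate

end Prestrain

/-! ### Explicit stresses when the normal is preserved -/

/-- The stresses of the explicit correctors when `α` is parallel to `e₁`. -/
def stressMat (c₁ c₂ h l K M μ : ℝ) : Fin 6 → Mat3 :=
  ![Matrix.diagonal ![c₁, (c₁ * l + 2 * K * μ) / M, (c₁ * l + 2 * K * μ) / M],
    (4 / 3 : ℝ) • Matrix.diagonal
      ![c₂, (c₂ * l - 3 / 2 * K * μ) / M, (c₂ * l - 3 / 2 * K * μ) / M],
    Matrix.diagonal ![0, -μ, μ],
    (2 * h) • basisG 3, (2 * h) • basisG 4, (2 * μ) • basisG 5]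

/-- The product of slope and `α` is homogeneous of degree zero in `α`, so the length and sign of `α`
are irrelevant for the strain. -/
theorem vecMulVec_slopeVec_smul {t : ℝ} (ht : t ≠ 0) (c₁ c₂ h K M μ : ℝ) (i : Fin 6) :
    Matrix.vecMulVec (slopeVec (t • e1) c₁ c₂ h K M μ i) (t • e1) =
      Matrix.vecMulVec (slopeVec e1 c₁ c₂ h K M μ i) e1 := by
  have h1 : e1 ⬝ᵥ e1 = 1 := by simp [e1]
  ext j k
  by_cases hi : i = 0
  · simp only [slopeVec, if_pos hi, Matrix.vecMulVec_apply, dotProduct_smul, smul_dotProduct, h1,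
      Pi.smul_apply, smul_eq_mul]
    field_simp
  · simp only [slopeVec, if_neg hi, Matrix.vecMulVec_apply, dotProduct_smul, smul_dotProduct, h1,
      Pi.smul_apply, Pi.add_apply, smul_eq_mul, Matrix.mulVec_smul]
    field_simp

theorem stress_slopeVec_e1 (c₁ c₂ h : ℝ) {l K M μ : ℝ} (hμ : μ ≠ 0) (hM : M ≠ 0)
    (hl : l = K - 2 / 3 * μ) (hKM : K = M - 4 / 3 * μ) (i : Fin 6) :
    stress l μ (basisG i + Matrix.vecMulVec (slopeVec e1 c₁ c₂ h K M μ i) e1) =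
      stressMat c₁ c₂ h l K M μ i := by
  subst hl
  subst hKM
  ext j k
  fin_cases i <;> fin_cases j <;> fin_cases k <;>
    simp [stress, stressMat, slopeVec, basisG, symPart, Matrix.trace, Matrix.vecMulVec_apply,
      Fin.sum_univ_three, e1, Matrix.mulVec, dotProduct] <;>
    field_simp <;> first | ring1 | exact Or.inr (by ring)

section

variable {l m ρ : ℝ → ℝ} {T : ℝ → Mat3} {α : V3} {t : ℝ}

theorem IsLaminate.stress_strain_parallel (h : IsLaminate l m ρ T α) (hα : α = t • e1) (i : Fin 6)
    (s : ℝ) : stress (l s) (m s) (strain l m ρ α i s) = ρ s •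
      stressMat (cBulk l m ρ) (cShear l m ρ) (weightedHarm ρ (nMu m ρ)) (l s / ρ s) (nK l m ρ s)
        (nM l m ρ s) (nMu m ρ s) i := by
  have ht : t ≠ 0 := fun h0 => h.ne_zero (by rw [hα, h0, zero_smul])
  rw [h.stress_scale, strain, slope, hα, vecMulVec_slopeVec_smul ht,
    stress_slopeVec_e1 _ _ _ (h.mu_pos s).ne' (h.M_pos s).ne']
  · simp only [nK]; ring
  · simp only [nM]; ring

theorem IsLaminate.innerQ_strain_parallel (h : IsLaminate l m ρ T α) (hα : α = t • e1) (i : Fin 6)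
    (X : V3 → Mat3) : innerQ (laminateForm l m) (fun y => strain l m ρ α i (y 0)) X =
      mean fun y => (∑ j, ∑ k, stressMat (cBulk l m ρ) (cShear l m ρ) (weightedHarm ρ (nMu m ρ))
        (l (y 0) / ρ (y 0)) (nK l m ρ (y 0)) (nM l m ρ (y 0)) (nMu m ρ (y 0)) i j k * X y j k) *
        ρ (y 0) := by
  simp only [innerQ, laminateForm_eq, polar_isoForm, h.stress_strain_parallel hα,
    Matrix.smul_apply, smul_eq_mul, Finset.sum_mul]
  congr 1
  funext y
  exact Finset.sum_congr rfl fun j _ => Finset.sum_congr rfl fun k _ => by ring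

/-! ### The components of a field that determine its projection -/

variable (l m ρ) in
/-- The mean of the normal component, corrected by the transverse contraction. -/
def normalPart (X : V3 → Mat3) : ℝ := mean fun y =>
  (X y 0 0 + l (y 0) / ρ (y 0) / nM l m ρ (y 0) * X y 1 1 +
    l (y 0) / ρ (y 0) / nM l m ρ (y 0) * X y 2 2) * ρ (y 0)

variable (l m ρ) in
/-- The weighted mean of the in-plane trace. -/
def planarPart (X : V3 → Mat3) : ℝ := mean fun y =>
  ((X y 1 1 + X y 2 2) * (nK l m ρ (y 0) * nMu m ρ (y 0) / nM l m ρ (y 0))) * ρ (y 0)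

namespace IsLaminate

variable {X : V3 → Mat3}

theorem integrable_mul_entry (h : IsLaminate l m ρ T α) {f : ℝ → ℝ} (hf : IsProfile f)
    (hX : CellL2 X) (i j : Fin 3) :
    Integrable (fun y => f (y 0) * X y i j * ρ (y 0)) (volume.restrict unitCell) := by
  have := (hf.mul h.stretch.isProfile).integrable_mul ((hX i j).integrable one_le_two)
  simpa only [mul_right_comm] using this

theorem integrable_normalPart (h : IsLaminate l m ρ T α) (hX : CellL2 X) :
    Integrable (fun y => (X y 0 0 + l (y 0) / ρ (y 0) / nM l m ρ (y 0) * X y 1 1 +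
      l (y 0) / ρ (y 0) / nM l m ρ (y 0) * X y 2 2) * ρ (y 0)) (volume.restrict unitCell) := by
  have hp := h.profile_div_M (h.profile_div h.moduli.lam)
  have h0 := h.integrable_mul_entry (IsProfile.const 1) hX 0 0
  simp only [one_mul] at h0
  simp only [add_mul]
  exact (h0.add (h.integrable_mul_entry hp hX 1 1)).add (h.integrable_mul_entry hp hX 2 2)

theorem integrable_planarPart (h : IsLaminate l m ρ T α) (hX : CellL2 X) :
    Integrable (fun y => ((X y 1 1 + X y 2 2) *
      (nK l m ρ (y 0) * nMu m ρ (y 0) / nM l m ρ (y 0))) * ρ (y 0))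
      (volume.restrict unitCell) := by
  have hp := h.profile_div_M (h.profile_K.mul h.profile_mu)
  refine ((h.integrable_mul_entry hp hX 1 1).add (h.integrable_mul_entry hp hX 2 2)).congr
    (.of_forall fun y => ?_)
  simp only [Pi.add_apply]
  ring

/-- The stress for `G₁` is diagonal with equal in-plane entries, so it sees only two scalars of `X`.
The stress for `G₂` sees the same two, which is why these directions couple. -/
theorem innerQ_strain_zero (h : IsLaminate l m ρ T α) (hα : α = t • e1) (hX : CellL2 X) :
    innerQ (laminateForm l m) (fun y => strain l m ρ α 0 (y 0)) X =
      cBulk l m ρ * normalPart l m ρ X + 2 * planarPart l m ρ X := by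
  rw [h.innerQ_strain_parallel hα, normalPart, planarPart, mean, mean, mean, ← integral_const_mul,
    ← integral_const_mul, ← integral_add ((h.integrable_normalPart hX).const_mul _)
      ((h.integrable_planarPart hX).const_mul _)]
  refine integral_congr_ae (.of_forall fun y => ?_)
  simp [stressMat, Fin.sum_univ_three]
  ring

theorem innerQ_strain_one (h : IsLaminate l m ρ T α) (hα : α = t • e1) (hX : CellL2 X) :
    innerQ (laminateForm l m) (fun y => strain l m ρ α 1 (y 0)) X =
      4 / 3 * cShear l m ρ * normalPart l m ρ X - 2 * planarPart l m ρ X := by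
  rw [h.innerQ_strain_parallel hα, normalPart, planarPart, mean, mean, mean, ← integral_const_mul,
    ← integral_const_mul, ← integral_sub ((h.integrable_normalPart hX).const_mul _)
      ((h.integrable_planarPart hX).const_mul _)]
  refine integral_congr_ae (.of_forall fun y => ?_)
  simp [stressMat, Fin.sum_univ_three]
  ring

theorem innerQ_strain_two (h : IsLaminate l m ρ T α) (hα : α = t • e1) :
    innerQ (laminateForm l m) (fun y => strain l m ρ α 2 (y 0)) X =
      mean fun y => nMu m ρ (y 0) * (X y 2 2 - X y 1 1) * ρ (y 0) := by
  rw [h.innerQ_strain_parallel hα]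
  refine integral_congr_ae (.of_forall fun y => ?_)
  simp [stressMat, Fin.sum_univ_three]
  exact Or.inl (by ring)

theorem innerQ_strain_three (h : IsLaminate l m ρ T α) (hα : α = t • e1) :
    innerQ (laminateForm l m) (fun y => strain l m ρ α 3 (y 0)) X =
      weightedHarm ρ (nMu m ρ) * mean fun y => (X y 0 1 + X y 1 0) * ρ (y 0) := by
  rw [h.innerQ_strain_parallel hα, mean, mean, ← integral_const_mul]
  refine integral_congr_ae (.of_forall fun y => ?_)
  simp [stressMat, Fin.sum_univ_three, basisG]
  ring

theorem innerQ_strain_four (h : IsLaminate l m ρ T α) (hα : α = t • e1) :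
    innerQ (laminateForm l m) (fun y => strain l m ρ α 4 (y 0)) X =
      weightedHarm ρ (nMu m ρ) * mean fun y => (X y 0 2 + X y 2 0) * ρ (y 0) := by
  rw [h.innerQ_strain_parallel hα, mean, mean, ← integral_const_mul]
  refine integral_congr_ae (.of_forall fun y => ?_)
  simp [stressMat, Fin.sum_univ_three, basisG]
  ring

theorem innerQ_strain_five (h : IsLaminate l m ρ T α) (hα : α = t • e1) :
    innerQ (laminateForm l m) (fun y => strain l m ρ α 5 (y 0)) X =
      mean fun y => nMu m ρ (y 0) * (X y 1 2 + X y 2 1) * ρ (y 0) := by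
  rw [h.innerQ_strain_parallel hα]
  refine integral_congr_ae (.of_forall fun y => ?_)
  simp [stressMat, Fin.sum_univ_three, basisG]
  exact Or.inl (by ring)

/-! #### Constant fields -/

/-- The mean of `M / M`; it removes one unknown mean from all later algebra. -/
theorem mean_K_M_add (h : IsLaminate l m ρ T α) : (weightedMean ρ fun s => nK l m ρ s / nM l m ρ s)
    + 4 / 3 * (weightedMean ρ fun s => nMu m ρ s / nM l m ρ s) = 1 := by
  rw [← weightedMean_const_mul, ← weightedMean_add h.stretch (h.profile_div_M h.profile_K)
    ((h.profile_div_M h.profile_mu).const_mul _), ← weightedMean_one h.stretch]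
  congr 1
  funext s
  have h1 := (h.M_pos s).ne'
  have h2 : nM l m ρ s = nK l m ρ s + 4 / 3 * nMu m ρ s := rfl
  field_simp
  linarith

theorem mean_lam_M (h : IsLaminate l m ρ T α) :
    (weightedMean ρ fun s => l s / ρ s / nM l m ρ s) =
      (weightedMean ρ fun s => nK l m ρ s / nM l m ρ s) -
        2 / 3 * (weightedMean ρ fun s => nMu m ρ s / nM l m ρ s) := by
  rw [← weightedMean_const_mul, ← weightedMean_sub h.stretch (h.profile_div_M h.profile_K)
    ((h.profile_div_M h.profile_mu).const_mul _)]
  congr 1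
  funext s
  simp only [nK]
  ring

theorem normalPart_const (h : IsLaminate l m ρ T α) (M : Mat3) :
    normalPart l m ρ (fun _ => M) =
      M 0 0 + (weightedMean ρ fun s => l s / ρ s / nM l m ρ s) * (M 1 1 + M 2 2) := by
  have hp := h.profile_div_M (h.profile_div h.moduli.lam)
  have h1 := weightedMean_add h.stretch (IsProfile.const (M 0 0)) (hp.const_mul (M 1 1 + M 2 2))
  rw [weightedMean_const h.stretch, weightedMean_const_mul] at h1
  rw [mul_comm, ← h1, normalPart, weightedMean]
  congr 1
  funext y
  ring

theorem planarPart_const (M : Mat3) : planarPart l m ρ (fun _ => M) =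
    (weightedMean ρ fun s => nK l m ρ s * nMu m ρ s / nM l m ρ s) * (M 1 1 + M 2 2) := by
  rw [mul_comm, ← weightedMean_const_mul]
  rfl

theorem mean_mu_mul_const (c : ℝ) :
    (mean fun y => nMu m ρ (y 0) * c * ρ (y 0)) = weightedMean ρ (nMu m ρ) * c := by
  rw [mul_comm, ← weightedMean_const_mul, weightedMean]
  simp only [mul_comm c]

theorem mean_const_mul_stretch (h : IsLaminate l m ρ T α) (c : ℝ) :
    (mean fun y => c * ρ (y 0)) = c := weightedMean_const h.stretch c

end IsLaminate

end

/-! ### The homogenized quantities -/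

section

variable {l m ρ : ℝ → ℝ} {T : ℝ → Mat3} {α : V3} {t : ℝ}

namespace IsLaminate

theorem harm_M_ne_zero (h : IsLaminate l m ρ T α) : weightedHarm ρ (nM l m ρ) ≠ 0 :=
  left_ne_zero_of_mul_eq_one h.harm_M

theorem harm_mu_ne_zero (h : IsLaminate l m ρ T α) : weightedHarm ρ (nMu m ρ) ≠ 0 :=
  left_ne_zero_of_mul_eq_one h.harm_mu

theorem mean_mu_pos (h : IsLaminate l m ρ T α) : 0 < weightedMean ρ (nMu m ρ) := by
  obtain ⟨c, hc, hb⟩ := h.exists_bounds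
  exact weightedMean_pos h.stretch h.profile_mu hc fun s => (hb s).1

theorem profile_K_mu_M (h : IsLaminate l m ρ T α) :
    IsProfile fun s => nK l m ρ s * nMu m ρ s / nM l m ρ s :=
  h.profile_div_M (h.profile_K.mul h.profile_mu)

theorem mean_K_mu_M_pos (h : IsLaminate l m ρ T α) :
    0 < weightedMean ρ fun s => nK l m ρ s * nMu m ρ s / nM l m ρ s := by
  obtain ⟨c, hc, hb⟩ := h.exists_bounds
  obtain ⟨D, hD⟩ := h.profile_M.bounded
  have hD' : ∀ s, nM l m ρ s ≤ D := fun s => (le_abs_self _).trans (hD s)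
  have hD0 : 0 < D := (h.M_pos 0).trans_le (hD' 0)
  refine weightedMean_pos h.stretch h.profile_K_mu_M (c := c * c / D) (by positivity) fun s => ?_
  obtain ⟨h1, h2, -⟩ := hb s
  exact div_le_div₀ (mul_nonneg (hc.le.trans h2) (hc.le.trans h1))
    (mul_le_mul h2 h1 hc.le (hc.le.trans h2)) (h.M_pos s) (hD' s)

/-- The effective matrix of the laminate. -/
theorem innerQ_strain_basisG (h : IsLaminate l m ρ T α) (hα : α = t • e1) {g : ℝ}
    (hg : g = 4 / 3 * (cBulk l m ρ * (weightedMean ρ fun s => nMu m ρ s / nM l m ρ s) -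
      weightedMean ρ fun s => nK l m ρ s * nMu m ρ s / nM l m ρ s)) (i j : Fin 6) :
    innerQ (laminateForm l m) (fun y => strain l m ρ α i (y 0)) (fun _ => basisG j) =
      (!![cBulk l m ρ - g, g, 0, 0, 0, 0;
        g, 4 / 3 * cShear l m ρ - g, 0, 0, 0, 0;
        0, 0, weightedMean ρ (nMu m ρ), 0, 0, 0;
        0, 0, 0, weightedHarm ρ (nMu m ρ), 0, 0;
        0, 0, 0, 0, weightedHarm ρ (nMu m ρ), 0;
        0, 0, 0, 0, 0, weightedMean ρ (nMu m ρ)] : Matrix (Fin 6) (Fin 6) ℝ) i j := by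
  have h1 := h.mean_K_M_add
  have h2 := h.mean_lam_M
  have hX := CellL2.const (basisG j)
  have e0 := h.innerQ_strain_zero hα hX
  have e1 := h.innerQ_strain_one hα hX
  have e2 := h.innerQ_strain_two hα (X := fun _ => basisG j)
  have e3 := h.innerQ_strain_three hα (X := fun _ => basisG j)
  have e4 := h.innerQ_strain_four hα (X := fun _ => basisG j)
  have e5 := h.innerQ_strain_five hα (X := fun _ => basisG j)
  rw [h.normalPart_const, planarPart_const, h2] at e0 e1
  rw [mean_mu_mul_const] at e2 e5
  rw [h.mean_const_mul_stretch] at e3 e4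
  rw [cBulk] at e0 hg ⊢
  rw [cShear] at e1 ⊢
  generalize weightedHarm ρ (nM l m ρ) = H at *
  generalize (weightedMean ρ fun s => nK l m ρ s / nM l m ρ s) = k₁ at *
  generalize (weightedMean ρ fun s => nMu m ρ s / nM l m ρ s) = k₂ at *
  -- Needed for the closed form: the two expressions for each entry of the upper block agree only
  -- modulo this relation.
  obtain rfl : k₁ = 1 - 4 / 3 * k₂ := by linarith
  subst hg
  fin_cases i
  · refine e0.trans ?_
    fin_cases j <;> simp [basisG] <;> ring
  · refine e1.trans ?_
    fin_cases j <;> simp [basisG] <;> ring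
  · refine e2.trans ?_
    fin_cases j <;> simp [basisG]
    ring
  · refine e3.trans ?_
    fin_cases j <;> simp [basisG]
    ring
  · refine e4.trans ?_
    fin_cases j <;> simp [basisG]
    ring
  · refine e5.trans ?_
    fin_cases j <;> simp [basisG]
    ring

/-- The explicit solution of the linear system for the effective prestrain. -/
theorem prestrain_iff (h : IsLaminate l m ρ T α) (hα : α = t • e1) {B : V3 → Mat3}
    (hB : CellL2 B) (M : Mat3) : (M.IsSymm ∧
      ∀ i, innerQ (laminateForm l m) (fun y => strain l m ρ α i (y 0)) (fun _ => M) =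
        innerQ (laminateForm l m) (fun y => strain l m ρ α i (y 0)) B) ↔
      M = ∑ i, (![normalPart l m ρ B + 2 * planarPart l m ρ B *
          ((weightedMean ρ fun s => nMu m ρ s / nM l m ρ s) /
            weightedMean ρ fun s => nK l m ρ s * nMu m ρ s / nM l m ρ s),
        normalPart l m ρ B - 3 / 2 * planarPart l m ρ B *
          ((weightedMean ρ fun s => nK l m ρ s / nM l m ρ s) /
            weightedMean ρ fun s => nK l m ρ s * nMu m ρ s / nM l m ρ s),
        (mean fun y => nMu m ρ (y 0) * (B y 2 2 - B y 1 1) * ρ (y 0)) / weightedMean ρ (nMu m ρ),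
        mean fun y => (B y 0 1 + B y 1 0) * ρ (y 0),
        mean fun y => (B y 0 2 + B y 2 0) * ρ (y 0),
        (mean fun y => nMu m ρ (y 0) * (B y 1 2 + B y 2 1) * ρ (y 0)) /
          weightedMean ρ (nMu m ρ)] : Fin 6 → ℝ) i • basisG i := by
  have h1 := h.mean_K_M_add
  have hH := h.harm_M_ne_zero
  have hh := h.harm_mu_ne_zero
  have hw := h.mean_K_mu_M_pos.ne'
  have hu := h.mean_mu_pos.ne'
  have hM := CellL2.const M
  simp only [Fin.forall_fin_succ (n := 5), Fin.forall_fin_succ (n := 4),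
    Fin.forall_fin_succ (n := 3), Fin.forall_fin_succ (n := 2), Fin.forall_fin_succ (n := 1),
    Fin.forall_fin_one]
  change (_ ∧ innerQ _ (fun y => strain l m ρ α 0 (y 0)) _ = _ ∧
    innerQ _ (fun y => strain l m ρ α 1 (y 0)) _ = innerQ _ (fun y => strain l m ρ α 1 (y 0)) _ ∧
    innerQ _ (fun y => strain l m ρ α 2 (y 0)) _ = innerQ _ (fun y => strain l m ρ α 2 (y 0)) _ ∧
    innerQ _ (fun y => strain l m ρ α 3 (y 0)) _ = innerQ _ (fun y => strain l m ρ α 3 (y 0)) _ ∧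
    innerQ _ (fun y => strain l m ρ α 4 (y 0)) _ = innerQ _ (fun y => strain l m ρ α 4 (y 0)) _ ∧
    innerQ _ (fun y => strain l m ρ α 5 (y 0)) _ = innerQ _ (fun y => strain l m ρ α 5 (y 0)) _)
    ↔ _
  simp only [h.innerQ_strain_zero hα hM, h.innerQ_strain_zero hα hB, h.innerQ_strain_one hα hM,
    h.innerQ_strain_one hα hB, h.innerQ_strain_two hα, h.innerQ_strain_three hα,
    h.innerQ_strain_four hα, h.innerQ_strain_five hα, h.normalPart_const, planarPart_const,
    h.mean_lam_M, mean_mu_mul_const, h.mean_const_mul_stretch, mul_right_inj' hh, cBulk, cShear]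
  generalize weightedHarm ρ (nM l m ρ) = H at *
  generalize (weightedMean ρ fun s => nK l m ρ s / nM l m ρ s) = k₁ at *
  generalize (weightedMean ρ fun s => nMu m ρ s / nM l m ρ s) = k₂ at *
  generalize (weightedMean ρ fun s => nK l m ρ s * nMu m ρ s / nM l m ρ s) = w at *
  generalize weightedMean ρ (nMu m ρ) = u at *
  generalize normalPart l m ρ B = x
  generalize planarPart l m ρ B = z
  generalize (mean fun y => nMu m ρ (y 0) * (B y 2 2 - B y 1 1) * ρ (y 0)) = b₂
  generalize (mean fun y => (B y 0 1 + B y 1 0) * ρ (y 0)) = b₃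
  generalize (mean fun y => (B y 0 2 + B y 2 0) * ρ (y 0)) = b₄
  generalize (mean fun y => nMu m ρ (y 0) * (B y 1 2 + B y 2 1) * ρ (y 0)) = b₅
  obtain rfl : k₁ = 1 - 4 / 3 * k₂ := by linarith
  constructor
  · rintro ⟨hs, e0, e1, e2, e3, e4, e5⟩
    -- In the sum of the first two equations the planar parts cancel and the coefficients of the
    -- normal part add up to the nonzero harmonic mean `H`, so the normal parts agree.
    have hx : M 0 0 + (1 - 4 / 3 * k₂ - 2 / 3 * k₂) * (M 1 1 + M 2 2) = x :=
      mul_left_cancel₀ hH (by linear_combination e0 + e1)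
    rw [hx] at e0
    -- With the normal parts equal, the first equation determines the in-plane trace.
    obtain rfl : z = w * (M 1 1 + M 2 2) := by linarith
    have h01 := hs.apply 0 1
    have h02 := hs.apply 0 2
    have h12 := hs.apply 1 2
    rw [← e2, ← e3, ← e4, ← e5, ← hx]
    ext i j
    fin_cases i <;> fin_cases j <;>
      simp [Matrix.sum_apply, Fin.sum_univ_six, basisG, h01, h02, h12] <;> field_simp <;> ring
  · intro hMe
    refine ⟨hMe ▸ isSymm_sum_basisG _, ?_⟩
    have hent : ∀ i j, M i j = _ := fun i j => congrFun (congrFun hMe i) j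
    simp only [hent]
    simp [Matrix.sum_apply, Fin.sum_univ_six, basisG]
    refine ⟨?_, ?_, ?_, ?_, ?_, ?_⟩ <;> field_simp <;> ring

end IsLaminate

end

/-! ### Hatted means as weighted means, and the homogenized quantities of the joint. -/

namespace JointProfile

variable {A : V3 → Mat3} {a : V3 → V3} {A₁ : ℝ → Mat3} {ρ : ℝ → ℝ} {P : ℝ → V3}
  {l m lam mu : ℝ → ℝ}

/-- The prestrain may depend on all coordinates, so the full chart is used here and not only its
first component. -/
theorem mean_hat_field (h : JointProfile A a A₁ ρ P) {B : V3 → Mat3} (hB : IsCellPeriodic B)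
    {f : V3 → ℝ} {g : ℝ → Mat3 → ℝ} (hg : ∀ s N, g (s + 1) N = g s N)
    (hf : ∀ᵐ y, f y = g (h.stretch.homeo.symm (y 0)) (B (pullPoint a A y))) :
    mean f = mean fun y => g (y 0) (B y) * ρ (y 0) := by
  rw [mean_congr hf, ← h.mean_comp_chart_symm (f := fun y => g (y 0) (B y))]
  · simp only [h.chart_symm_zero, h.pullPoint_eq]
  · intro k
    filter_upwards [hB k, isCellPeriodic_fst (f := g) (fun s => funext (hg s)) k] with y h1 h2
    rw [h1]
    exact congrFun h2 _

end JointProfile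

theorem innerQ_laminateForm_congr {lam mu l m : ℝ → ℝ} (hlam : ∀ᵐ s, lam s = l s)
    (hmu : ∀ᵐ s, mu s = m s) : innerQ (laminateForm lam mu) = innerQ (laminateForm l m) := by
  funext F G
  refine mean_congr ?_
  filter_upwards [ae_comp_fst hlam, ae_comp_fst hmu] with y h1 h2
  simp only [laminateForm_eq, h1, h2]

theorem InS_congr {A A' : V3 → Mat3} (h : ∀ᵐ y, A y = A' y) : InS A = InS A' := by
  funext Ψ
  refine propext (exists_congr fun φ => exists_congr fun Φ => and_congr_right fun _ => ?_)
  exact Filter.eventually_congr (h.mono fun y hy => by rw [hy])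

/-- The notion depends on the energy only through its inner product and on the joint only through
`𝒮`, so almost everywhere representatives may be substituted. -/
theorem isEffectivePrestrain_congr {q q' : V3 → Mat3 → ℝ} {A A' B : V3 → Mat3} {M : Mat3}
    (hq : innerQ q = innerQ q') (hA : ∀ᵐ y, A y = A' y) :
    IsEffectivePrestrain q A B M ↔ IsEffectivePrestrain q' A' B M := by
  simp only [IsEffectivePrestrain, IsProjO, InO, InSPlusSym, hq, InS_congr hA]

namespace JointProfile

variable {A : V3 → Mat3} {a : V3 → V3} {A₁ : ℝ → Mat3} {ρ : ℝ → ℝ} {P : ℝ → V3}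
  {l m lam mu : ℝ → ℝ}


theorem mean_hatModulus (h : JointProfile A a A₁ ρ P) (hm : IsModuli l m)
    (hmu : ∀ᵐ s, mu s = m s) : mean (hatModulus mu a A) = weightedMean ρ (nMu m ρ) :=
  h.mean_hat (h.isLaminate hm).profile_mu (h.hatModulus_eq hmu)

theorem harmMean_hatModulus (h : JointProfile A a A₁ ρ P) (hm : IsModuli l m)
    (hmu : ∀ᵐ s, mu s = m s) : harmMean (hatModulus mu a A) = weightedHarm ρ (nMu m ρ) := by
  rw [harmMean, h.mean_hat (h.isLaminate hm).profile_inv_mu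
    ((h.hatModulus_eq hmu).mono fun y hy => by rw [hy]; rfl), weightedHarm]

theorem harmMean_hatPWave (h : JointProfile A a A₁ ρ P) (hm : IsModuli l m)
    (hlam : ∀ᵐ s, lam s = l s) (hmu : ∀ᵐ s, mu s = m s) :
    harmMean (hatPWave lam mu a A) = weightedHarm ρ (nM l m ρ) := by
  rw [harmMean, h.mean_hat (h.isLaminate hm).profile_inv_M
    ((h.hatPWave_eq hlam hmu).mono fun y hy => by rw [hy]), weightedHarm]

theorem mean_hatBulk_div (h : JointProfile A a A₁ ρ P) (hm : IsModuli l m)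
    (hlam : ∀ᵐ s, lam s = l s) (hmu : ∀ᵐ s, mu s = m s) :
    mean (fun y => hatBulk lam mu a A y / hatPWave lam mu a A y) =
      weightedMean ρ fun s => nK l m ρ s / nM l m ρ s := by
  refine h.mean_hat ((h.isLaminate hm).profile_div_M (h.isLaminate hm).profile_K) ?_
  filter_upwards [h.hatBulk_eq hlam hmu, h.hatPWave_eq hlam hmu] with y h1 h2
  rw [h1, h2]

theorem mean_hatModulus_div (h : JointProfile A a A₁ ρ P) (hm : IsModuli l m)
    (hlam : ∀ᵐ s, lam s = l s) (hmu : ∀ᵐ s, mu s = m s) :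
    mean (fun y => hatModulus mu a A y / hatPWave lam mu a A y) =
      weightedMean ρ fun s => nMu m ρ s / nM l m ρ s := by
  refine h.mean_hat ((h.isLaminate hm).profile_div_M (h.isLaminate hm).profile_mu) ?_
  filter_upwards [h.hatModulus_eq hmu, h.hatPWave_eq hlam hmu] with y h1 h2
  rw [h1, h2]; rfl

theorem mean_hatBulk_mul_div (h : JointProfile A a A₁ ρ P) (hm : IsModuli l m)
    (hlam : ∀ᵐ s, lam s = l s) (hmu : ∀ᵐ s, mu s = m s) :
    mean (fun y => hatBulk lam mu a A y * hatModulus mu a A y / hatPWave lam mu a A y) =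
      weightedMean ρ fun s => nK l m ρ s * nMu m ρ s / nM l m ρ s := by
  refine h.mean_hat (h.isLaminate hm).profile_K_mu_M ?_
  filter_upwards [h.hatModulus_eq hmu, h.hatBulk_eq hlam hmu, h.hatPWave_eq hlam hmu] with y h1 h2 h3
  rw [h1, h2, h3]; rfl

/-- Multiplying out `γ μ̂` leaves `μ̂ / M̂` times a constant minus `K̂ μ̂ / M̂`, the combination
that occurs in the upper block of `𝐐`. -/
theorem mean_gammaFun_mul (h : JointProfile A a A₁ ρ P) (hm : IsModuli l m)
    (hlam : ∀ᵐ s, lam s = l s) (hmu : ∀ᵐ s, mu s = m s) :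
    mean (fun y => gammaFun (hatBulk lam mu a A) (hatPWave lam mu a A) y * hatModulus mu a A y) =
      cBulk l m ρ * (weightedMean ρ fun s => nMu m ρ s / nM l m ρ s) -
        weightedMean ρ fun s => nK l m ρ s * nMu m ρ s / nM l m ρ s := by
  have hL := h.isLaminate hm
  have hp := hL.profile_div_M hL.profile_mu
  rw [← weightedMean_const_mul, ← weightedMean_sub h.stretch (hp.const_mul _) hL.profile_K_mu_M]
  refine h.mean_hat ((hp.const_mul _).sub hL.profile_K_mu_M) ?_
  filter_upwards [h.hatModulus_eq hmu, h.hatBulk_eq hlam hmu, h.hatPWave_eq hlam hmu]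
    with y h1 h2 h3
  rw [gammaFun, h1, h2, h3, h.mean_hatBulk_div hm hlam hmu, h.harmMean_hatPWave hm hlam hmu,
    cBulk, nMu]
  ring


theorem exists_isCorrector (h : JointProfile A a A₁ ρ P) (hm : IsModuli l m)
    (hlam : ∀ᵐ s, lam s = l s) (hmu : ∀ᵐ s, mu s = m s) (i : Fin 6) :
    ∃ φ Φ, IsCorrector (laminateForm lam mu) (fun y => (A y)⁻¹) (basisG i) φ Φ := by
  obtain ⟨φ, Φ, hφ⟩ := (h.isLaminate hm).exists_isCorrector i
  refine ⟨φ, Φ, hφ.congr ?_ (h.ae_eq.mono fun y hy => by rw [hy])⟩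
  filter_upwards [ae_comp_fst hlam, ae_comp_fst hmu] with y h1 h2 F
  rw [laminateForm, laminateForm, h1, h2]

theorem matrixQ_eq (h : JointProfile A a A₁ ρ P) (hm : IsModuli l m)
    (hlam : ∀ᵐ s, lam s = l s) (hmu : ∀ᵐ s, mu s = m s) {t : ℝ} (hα : alphaVec A = t • e1)
    {φ : Fin 6 → V3 → V3} {Φ : Fin 6 → V3 → Mat3}
    (hφ : ∀ i, IsCorrector (laminateForm lam mu) (fun y => (A y)⁻¹) (basisG i) (φ i) (Φ i)) :
    matrixQ (laminateForm lam mu) A Φ = explicitQ (hatBulk lam mu a A) (hatPWave lam mu a A)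
      (hatModulus mu a A) := by
  have hL := h.isLaminate hm
  have hφ' : ∀ i, IsCorrector (laminateForm l m) (fun y => (A₁ (y 0))⁻¹) (basisG i) (φ i)
      (Φ i) := fun i => (hφ i).congr (by
        filter_upwards [ae_comp_fst hlam, ae_comp_fst hmu] with y h1 h2 F
        rw [laminateForm, laminateForm, h1, h2]) (h.ae_eq.mono fun y hy => by rw [hy])
  have hA : ∀ i, ∀ᵐ y ∂volume.restrict unitCell,
      basisG i + Φ i y * (A y)⁻¹ = basisG i + Φ i y * (A₁ (y 0))⁻¹ := fun i =>
    ae_restrict_of_ae (h.ae_eq.mono fun y hy => by rw [hy])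
  ext i j
  rw [matrixQ, Matrix.of_apply, innerQ_laminateForm_congr hlam hmu, innerQ_congr (hA i) (hA j),
    hL.innerQ_correctors hφ', hL.innerQ_strain_basisG hα rfl]
  simp only [explicitQ, h.mean_hatModulus hm hmu, h.harmMean_hatModulus hm hmu,
    h.harmMean_hatPWave hm hlam hmu, h.mean_hatBulk_div hm hlam hmu,
    h.mean_hatModulus_div hm hlam hmu, h.mean_gammaFun_mul hm hlam hmu, cBulk, cShear,
    mul_comm (weightedHarm ρ (nM l m ρ)), mul_assoc]

theorem explicitB_eq (h : JointProfile A a A₁ ρ P) (hm : IsModuli l m)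
    (hlam : ∀ᵐ s, lam s = l s) (hmu : ∀ᵐ s, mu s = m s) {B : V3 → Mat3} (hB : IsCellPeriodic B) :
    explicitB (hatModulus lam a A) (hatBulk lam mu a A) (hatPWave lam mu a A) (hatModulus mu a A)
      (fun y => B (pullPoint a A y)) =
    ![normalPart l m ρ B + 2 * planarPart l m ρ B *
        ((weightedMean ρ fun s => nMu m ρ s / nM l m ρ s) /
          weightedMean ρ fun s => nK l m ρ s * nMu m ρ s / nM l m ρ s),
      normalPart l m ρ B - 3 / 2 * planarPart l m ρ B *
        ((weightedMean ρ fun s => nK l m ρ s / nM l m ρ s) /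
          weightedMean ρ fun s => nK l m ρ s * nMu m ρ s / nM l m ρ s),
      (mean fun y => nMu m ρ (y 0) * (B y 2 2 - B y 1 1) * ρ (y 0)) / weightedMean ρ (nMu m ρ),
      mean fun y => (B y 0 1 + B y 1 0) * ρ (y 0),
      mean fun y => (B y 0 2 + B y 2 0) * ρ (y 0),
      (mean fun y => nMu m ρ (y 0) * (B y 1 2 + B y 2 1) * ρ (y 0)) /
        weightedMean ρ (nMu m ρ)] := by
  have hL := h.isLaminate hm
  have hlp : Function.Periodic l 1 := hm.lam.periodic
  have hρp : Function.Periodic ρ 1 := h.stretch.periodic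
  have hGp : Function.Periodic (nMu m ρ) 1 := hL.profile_mu.periodic
  have hKp : Function.Periodic (nK l m ρ) 1 := hL.profile_K.periodic
  have hMp : Function.Periodic (nM l m ρ) 1 := hL.profile_M.periodic
  have hl := h.hatModulus_eq hlam
  have hG := h.hatModulus_eq hmu
  have hK := h.hatBulk_eq hlam hmu
  have hM := h.hatPWave_eq hlam hmu
  have x := h.mean_hat_field hB (g := fun s N => N 0 0 + l s / ρ s / nM l m ρ s * N 1 1 +
    l s / ρ s / nM l m ρ s * N 2 2) (f := fun y => B (pullPoint a A y) 0 0 +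
      hatModulus lam a A y / hatPWave lam mu a A y * B (pullPoint a A y) 1 1 +
      hatModulus lam a A y / hatPWave lam mu a A y * B (pullPoint a A y) 2 2)
    (fun s N => by simp only [hlp s, hρp s, hMp s])
    (by filter_upwards [hl, hM] with y h1 h2; rw [h1, h2])
  have z := h.mean_hat_field hB
    (g := fun s N => (N 1 1 + N 2 2) * (nK l m ρ s * nMu m ρ s / nM l m ρ s))
    (f := fun y => (B (pullPoint a A y) 1 1 + B (pullPoint a A y) 2 2) *
      (hatBulk lam mu a A y * hatModulus mu a A y / hatPWave lam mu a A y))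
    (fun s N => by simp only [hKp s, hGp s, hMp s])
    (by filter_upwards [hK, hG, hM] with y h1 h2 h3; rw [h1, h2, h3]; rfl)
  have b2 := h.mean_hat_field hB (g := fun s N => nMu m ρ s * (N 2 2 - N 1 1))
    (f := fun y => hatModulus mu a A y * (B (pullPoint a A y) 2 2 - B (pullPoint a A y) 1 1))
    (fun s N => by simp only [hGp s])
    (by filter_upwards [hG] with y h1; rw [h1]; rfl)
  have b3 := h.mean_hat_field hB (g := fun s N => N 0 1 + N 1 0)
    (f := fun y => B (pullPoint a A y) 0 1 + B (pullPoint a A y) 1 0) (fun _ _ => rfl)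
    (.of_forall fun _ => rfl)
  have b4 := h.mean_hat_field hB (g := fun s N => N 0 2 + N 2 0)
    (f := fun y => B (pullPoint a A y) 0 2 + B (pullPoint a A y) 2 0) (fun _ _ => rfl)
    (.of_forall fun _ => rfl)
  have b5 := h.mean_hat_field hB (g := fun s N => nMu m ρ s * (N 1 2 + N 2 1))
    (f := fun y => hatModulus mu a A y * (B (pullPoint a A y) 1 2 + B (pullPoint a A y) 2 1))
    (fun s N => by simp only [hGp s])
    (by filter_upwards [hG] with y h1; rw [h1]; rfl)
  simp only [explicitB, x, z, b2, b3, b4, b5, h.mean_hatModulus hm hmu,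
    h.mean_hatBulk_div hm hlam hmu, h.mean_hatModulus_div hm hlam hmu,
    h.mean_hatBulk_mul_div hm hlam hmu, normalPart, planarPart]

theorem isEffectivePrestrain_iff (h : JointProfile A a A₁ ρ P) (hm : IsModuli l m)
    (hlam : ∀ᵐ s, lam s = l s) (hmu : ∀ᵐ s, mu s = m s) {t : ℝ} (hα : alphaVec A = t • e1)
    {B : V3 → Mat3} (hB : IsCellPeriodic B) (hB2 : ∀ i j, MemLpLoc 2 fun y => B y i j)
    (M : Mat3) : IsEffectivePrestrain (laminateForm lam mu) A B M ↔
      M = ∑ i, explicitB (hatModulus lam a A) (hatBulk lam mu a A) (hatPWave lam mu a A)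
        (hatModulus mu a A) (fun y => B (pullPoint a A y)) i • basisG i := by
  have hL := h.isLaminate hm
  have hBc : CellL2 B := fun i j => (hB2 i j).memLp_cell
  rw [isEffectivePrestrain_congr (innerQ_laminateForm_congr hlam hmu) h.ae_eq,
    hL.isEffectivePrestrain_iff hBc, hL.prestrain_iff hα hBc, h.explicitB_eq hm hlam hmu hB]

end JointProfile

end Laminate

end

theorem proposition4p2
    (lam mu : ℝ → ℝ) (hlam : Laminate.IsPerLinfty lam) (hmu : Laminate.IsPerLinfty mu)
    (hmu_pos : Laminate.EssBoundedBelow mu)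
    (hK_pos : Laminate.EssBoundedBelow fun t => lam t + 2 / 3 * mu t)
    (A : Laminate.V3 → Laminate.Mat3) (hA : Laminate.IsPeriodicStressFreeJoint A)
    (hA1 : ∃ A₁ : ℝ → Laminate.Mat3, ∀ᵐ y : Laminate.V3, A y = A₁ (y 0))
    (a : Laminate.V3 → Laminate.V3) (ha : Laminate.IsPotential a A) (ha0 : a 0 = 0) :
    -- the potential is a bilipschitz bijection and the mean of `A` has positive determinant
    ((∃ C, LipschitzWith C a) ∧ (∃ C, AntilipschitzWith C a) ∧ Function.Bijective a ∧
      0 < (Laminate.meanMat A).det) ∧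
    -- the transformed correctors exist, depend only on `y₁`, and have explicit gradients
    (∀ i : Fin 6,
      (∃ φ Φ, Laminate.IsCorrector (Laminate.hatForm (Laminate.laminateForm lam mu) a A)
        (fun _ => (Laminate.meanMat A)⁻¹) (Laminate.basisG i) φ Φ) ∧
      ∀ φ Φ, Laminate.IsCorrector (Laminate.hatForm (Laminate.laminateForm lam mu) a A)
        (fun _ => (Laminate.meanMat A)⁻¹) (Laminate.basisG i) φ Φ →
        (∃ ψ : ℝ → Laminate.V3, ∀ᵐ y : Laminate.V3, φ y = ψ (y 0)) ∧
        ∀ᵐ y : Laminate.V3, Φ y = Matrix.vecMulVec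
          (Laminate.correctorSlope (Laminate.alphaVec A) (Laminate.hatBulk lam mu a A)
            (Laminate.hatPWave lam mu a A) (Laminate.hatModulus mu a A) i y) Laminate.e1) ∧
    -- the case in which `α` is parallel to `e₁`
    ((∃ t : ℝ, Laminate.alphaVec A = t • Laminate.e1) →
      -- the matrix `𝐐`
      ((∀ i : Fin 6, ∃ φ Φ, Laminate.IsCorrector (Laminate.laminateForm lam mu)
          (fun y => (A y)⁻¹) (Laminate.basisG i) φ Φ) ∧
        ∀ (φ : Fin 6 → Laminate.V3 → Laminate.V3) (Φ : Fin 6 → Laminate.V3 → Laminate.Mat3),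
          (∀ i, Laminate.IsCorrector (Laminate.laminateForm lam mu)
            (fun y => (A y)⁻¹) (Laminate.basisG i) (φ i) (Φ i)) →
          Laminate.matrixQ (Laminate.laminateForm lam mu) A Φ =
            Laminate.explicitQ (Laminate.hatBulk lam mu a A) (Laminate.hatPWave lam mu a A)
              (Laminate.hatModulus mu a A)) ∧
      -- the effective incremental prestrain
      ∀ B : Laminate.V3 → Laminate.Mat3, Laminate.IsCellPeriodic B →
        (∀ i j, Laminate.MemLpLoc 2 fun y => B y i j) →
        ∀ M : Laminate.Mat3,
          Laminate.IsEffectivePrestrain (Laminate.laminateForm lam mu) A B M ↔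
            M = ∑ i, Laminate.explicitB (Laminate.hatModulus lam a A)
              (Laminate.hatBulk lam mu a A) (Laminate.hatPWave lam mu a A)
              (Laminate.hatModulus mu a A)
              (fun y => B (Laminate.pullPoint a A y)) i • Laminate.basisG i) := by
  -- Moduli and joint are replaced by representatives with everywhere valid bounds; all remaining
  -- statements are insensitive to this change.
  obtain ⟨l, m, hm, hl, hmu'⟩ := Laminate.exists_isModuli hlam hmu hmu_pos hK_pos
  obtain ⟨A₁, ρ, P, h⟩ := Laminate.exists_jointProfile hA hA1 ha ha0
  refine ⟨⟨h.lipschitz_potential, h.antilipschitz, h.bijective, h.det_mean_pos⟩,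
    h.transformed_correctors hm hl hmu', ?_⟩
  rintro ⟨t, hα⟩
  exact ⟨⟨h.exists_isCorrector hm hl hmu', fun φ Φ hφ => h.matrixQ_eq hm hl hmu' hα hφ⟩,
    fun B hB hB2 M => h.isEffectivePrestrain_iff hm hl hmu' hα hB hB2 M⟩
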